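/- Let $\mathcal X_1,\mathcal X_2,\mathcal Y_1$ be finite nonempty sets and let $p(y_1|x_1,x_2)$ be a discrete memoryless channel with input $x_1$, state $x_2$ and output $y_1$. All logarithms are to base $2$. \emph{Generalized Gel'fand--Pinsker problem.} Let $0\le R_2\le\log|\mathcal X_2|$. A code of length $n$ and rate $R_1\ge 0$ consists of a set $\mathcal S_n\subseteq\mathcal X_2^n$ with $|\mathcal S_n|=\lceil 2^{nR_2}\rceil$, an encoder $f_n:\{1,\dots,M_n\}\times\mathcal S_n\to\mathcal X_1^n$ and a decoder $g_n:\mathcal Y_1^n\to\{1,\dots,M_n\}$, where $M_n=\lceil 2^{nR_1}\rceil$. Its error probability is $\Pr[g_n(Y_1^n)\ne W_1]$, where the message $W_1$ is uniform on $\{1,\dots,M_n\}$, the state sequence $X_2^n$ is uniform on $\mathcal S_n$ and independent of $W_1$, and $Y_1^n$ is the output of the memoryless channel for the input $f_n(W_1,X_2^n)$ and the state $X_2^n$. The rate $R_1$ is achievable if there are such codes (one for each $n$, with the sets $\mathcal S_n$ freely chosen) whose error probability tends to $0$ as $n\to\infty$. The capacity $C(R_2)$ is the supremum of the achievable rates $R_1$.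 \emph{Theorem.} For every $R_2\in[0,\log|\mathcal X_2|]$, the capacity is finite and $$C(R_2)=\max\; I(U;Y_1|V)-I(U;X_2|V),$$ where the maximum, which is attained, is over all finite alphabets of the auxiliary random variables $U,V$ and all distributions $p(v,u,x_2)\,p(x_1|u,x_2)$ that satisfy $$H(X_2|V)+\min\{I(V;Y_1),\,I(V;X_2)\}\ge R_2,$$ all quantities being computed for $p(v,u,x_2)\,p(x_1|u,x_2)\,p(y_1|x_1,x_2)$. Moreover, for $R_2=\log|\mathcal X_2|$ the capacity equals the classical Gel'fand--Pinsker rate for an i.i.d. state uniform on $\mathcal X_2$: $$C(\log|\mathcal X_2|)=\max\; I(U;Y_1)-I(U;X_2),$$ where the maximum, which is attained, is over all finite alphabets of $U$ and all distributions $p(u|x_2)\,p(x_1|u,x_2)$, all quantities being computed for $p(x_2)\,p(u|x_2)\,p(x_1|u,x_2)\,p(y_1|x_1,x_2)$ with $p(x_2)=1/|\mathcal X_2|$. -/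

import Mathlib

namespace GenGP

noncomputable section

open Filter Topology

section Information

variable {Ω α β γ : Type*} [Fintype Ω] [Fintype α] [Fintype β] [Fintype γ]

open scoped Classical in
/-- The probability `Pr[X = a]` when the sample point has probability mass function `P`. -/
def pr (P : Ω → ℝ) (X : Ω → α) (a : α) : ℝ :=
  ∑ ω with X ω = a, P ω

/-- Shannon entropy `H(X)` in bits. -/
def entropy (P : Ω → ℝ) (X : Ω → α) : ℝ :=
  -∑ a, pr P X a * Real.logb 2 (pr P X a)

/-- Conditional entropy `H(X|Z) = -∑ p(x,z) log p(x|z)` in bits (a term with `p(x,z) = 0` is `0`). -/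
def condEntropy (P : Ω → ℝ) (X : Ω → α) (Z : Ω → γ) : ℝ :=
  -∑ x, ∑ z, pr P (fun ω => (X ω, Z ω)) (x, z) *
    Real.logb 2 (pr P (fun ω => (X ω, Z ω)) (x, z) / pr P Z z)

/-- Mutual information `I(X;Y) = H(X) - H(X|Y)`. -/
def mutualInfo (P : Ω → ℝ) (X : Ω → α) (Y : Ω → β) : ℝ :=
  entropy P X - condEntropy P X Y

/-- Conditional mutual information `I(X;Y|Z) = H(X|Z) - H(X|Y,Z)`. -/
def condMutualInfo (P : Ω → ℝ) (X : Ω → α) (Y : Ω → β) (Z : Ω → γ) : ℝ :=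
  condEntropy P X Z - condEntropy P X (fun ω => (Y ω, Z ω))

end Information

section Operational

variable {X₁ X₂ Y₁ : Type*}

/-- A block code of length `n` with `M` messages for the generalized Gel'fand-Pinsker problem with
`N` states: a set of `N` state sequences (part of the design), an encoder that knows the message
and the whole state sequence, and a decoder that sees the channel output only. -/
structure Code (X₁ X₂ Y₁ : Type*) (n M N : ℕ) where
  states : Finset (Fin n → X₂)
  card_states : states.card = N
  enc : Fin M → states → (Fin n → X₁)
  dec : (Fin n → Y₁) → Fin M

/-- Average error probability over the memoryless channel `W x₁ x₂ y₁ = p(y₁|x₁,x₂)`, for a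
message uniform on `Fin M` and an independent state sequence uniform on `c.states`. -/
def Code.errorProb [Fintype Y₁] {n M N : ℕ} (c : Code X₁ X₂ Y₁ n M N) (W : X₁ → X₂ → Y₁ → ℝ) : ℝ :=
  (1 / ((M : ℝ) * (N : ℝ))) * ∑ w : Fin M, ∑ s : c.states,
    ∑ y : Fin n → Y₁ with c.dec y ≠ w, ∏ i, W (c.enc w s i) (s.1 i) (y i)

/-- The rate `R₁` is achievable at state rate `R₂`: there are codes with `⌈2^(n R₁)⌉` messages and
`⌈2^(n R₂)⌉` state sequences, one for each block length `n`, with vanishing error probability. -/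
def Achievable [Fintype Y₁] (W : X₁ → X₂ → Y₁ → ℝ) (R₂ R₁ : ℝ) : Prop :=
  0 ≤ R₁ ∧
  ∃ c : (n : ℕ) → Code X₁ X₂ Y₁ n ⌈(2 : ℝ) ^ ((n : ℝ) * R₁)⌉₊ ⌈(2 : ℝ) ^ ((n : ℝ) * R₂)⌉₊,
    Tendsto (fun n => (c n).errorProb W) atTop (𝓝 0)

/-- The capacity `C(R₂)`: the supremum of the achievable rates. -/
def capacity [Fintype Y₁] (W : X₁ → X₂ → Y₁ → ℝ) (R₂ : ℝ) : ℝ :=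
  sSup {R₁ : ℝ | Achievable W R₂ R₁}

end Operational

section Formula

variable {U V X₁ X₂ Y₁ : Type*}

/-- The joint law `p(v,u,x₂) p(x₁|u,x₂) p(y₁|x₁,x₂)` of `(V,U,X₂,X₁,Y₁)`. -/
def jointLaw (W : X₁ → X₂ → Y₁ → ℝ) (p : V × U × X₂ → ℝ) (q : U → X₂ → X₁ → ℝ) :
    V × U × X₂ × X₁ × Y₁ → ℝ :=
  fun (v, u, x₂, x₁, y₁) => p (v, u, x₂) * q u x₂ x₁ * W x₁ x₂ y₁

/-- The coordinate random variables on the sample space `V × U × X₂ × X₁ × Y₁`. -/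
def rvV : V × U × X₂ × X₁ × Y₁ → V := fun (v, _, _, _, _) => v
def rvU : V × U × X₂ × X₁ × Y₁ → U := fun (_, u, _, _, _) => u
def rvX₂ : V × U × X₂ × X₁ × Y₁ → X₂ := fun (_, _, x₂, _, _) => x₂
def rvY₁ : V × U × X₂ × X₁ × Y₁ → Y₁ := fun (_, _, _, _, y₁) => y₁

/-- `I(U;Y₁|V) - I(U;X₂|V)`. -/
def objective [Fintype U] [Fintype V] [Fintype X₁] [Fintype X₂] [Fintype Y₁]
    (P : V × U × X₂ × X₁ × Y₁ → ℝ) : ℝ :=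
  condMutualInfo P rvU rvY₁ rvV - condMutualInfo P rvU rvX₂ rvV

/-- `H(X₂|V) + min {I(V;Y₁), I(V;X₂)}`. -/
def stateRateBound [Fintype U] [Fintype V] [Fintype X₁] [Fintype X₂] [Fintype Y₁]
    (P : V × U × X₂ × X₁ × Y₁ → ℝ) : ℝ :=
  condEntropy P rvX₂ rvV + min (mutualInfo P rvV rvY₁) (mutualInfo P rvV rvX₂)

/-- The values of `I(U;Y₁|V) - I(U;X₂|V)` over all `p(v,u,x₂) p(x₁|u,x₂)`, with auxiliary variables
of arbitrary finite alphabets, such that `H(X₂|V) + min {I(V;Y₁), I(V;X₂)} ≥ R₂`. -/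
def capacityValues [Fintype X₁] [Fintype X₂] [Fintype Y₁] (W : X₁ → X₂ → Y₁ → ℝ) (R₂ : ℝ) : Set ℝ :=
  {r | ∃ (k m : ℕ) (p : Fin k × Fin m × X₂ → ℝ) (q : Fin m → X₂ → X₁ → ℝ),
    p ∈ stdSimplex ℝ (Fin k × Fin m × X₂) ∧
    (∀ u x₂, q u x₂ ∈ stdSimplex ℝ X₁) ∧
    stateRateBound (jointLaw W p q) ≥ R₂ ∧
    r = objective (jointLaw W p q)}

/-- The joint law `p(u,x₂) p(x₁|u,x₂) p(y₁|x₁,x₂)` of `(U,X₂,X₁,Y₁)`. -/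
def gpJointLaw (W : X₁ → X₂ → Y₁ → ℝ) (p : U × X₂ → ℝ) (q : U → X₂ → X₁ → ℝ) :
    U × X₂ × X₁ × Y₁ → ℝ :=
  fun (u, x₂, x₁, y₁) => p (u, x₂) * q u x₂ x₁ * W x₁ x₂ y₁

/-- The values of `I(U;Y₁) - I(U;X₂)` over all `p(u,x₂) p(x₁|u,x₂)` whose state marginal `p(x₂)` is
`pS`; the classical Gel'fand-Pinsker rate for an i.i.d. state of law `pS` is their maximum. -/
def gpValues [Fintype X₁] [Fintype X₂] [Fintype Y₁] (W : X₁ → X₂ → Y₁ → ℝ) (pS : X₂ → ℝ) : Set ℝ :=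
  {r | ∃ (m : ℕ) (p : Fin m × X₂ → ℝ) (q : Fin m → X₂ → X₁ → ℝ),
    p ∈ stdSimplex ℝ (Fin m × X₂) ∧
    (∀ x₂, ∑ u, p (u, x₂) = pS x₂) ∧
    (∀ u x₂, q u x₂ ∈ stdSimplex ℝ X₁) ∧
    r = mutualInfo (gpJointLaw W p q) (fun (u, _, _, _) => u) (fun (_, _, _, y₁) => y₁) -
        mutualInfo (gpJointLaw W p q) (fun (u, _, _, _) => u) (fun (_, x₂, _, _) => x₂)}

end Formula

end

end GenGP

/-! The capacity is the maximum of a linear functional over a compact set from which the auxiliary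
alphabets have disappeared. Choosing U means mixing laws of (X₂,X₁), so the pairs (law of (X₂,X₁),
H(Y₁|U) − H(X₂|U)) fill the convex hull `innerHull` of a graph over a simplex. `liftPoint` rewrites
such a pair in terms of entropies and of I(U;Y₁) − I(U;X₂), and averaging over V is a second convex
hull, `outerHull`. Since H(X₂|V) + I(V;X₂) = H(X₂), the constraint becomes the two closed
inequalities of `Feasible`. Hulls of compact sets are compact in finite dimension, so the maximum is
attained without any cardinality bound; `mem_capacityValues_iff` translates back to random
variables.

Converse (`Code.exists_point`). At time i take V = (Y^{i−1}, X_{i+1}^n), with U the message.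
Adjoining Y_i or X_i to V gives consecutive terms of a chain of hybrid sequences leading from X^n to
Y^n, so the Csiszár sum identity becomes a telescoping sum. With Fano's inequality the objectives
add up to almost log M. The feasibility margins add up to at least log N, by subadditivity of
entropy. Convexity of `outerHull` and concavity of entropy replace a time-sharing variable.

Achievability (`random_coding`). Draw J cloud centers, and for each center one satellite for every
pair (message w, index l). Let the state first have the mixture law of the clouds. Threshold tests
on likelihoods control the decoder (`packing`). Soft covering (`covering`) says that for each
message the satellites of a cloud nearly reproduce its state law, so an encoder that picks the best
input for each message and state does at least as well as the satellites, up to the covering error.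
The mixture has few large atoms (`mean_atoms_le`), so more than 2^{nR₂} state sequences have small
error, and any 2^{nR₂} of them form the state set (`exists_finset_of_mean_le`).

This needs strict slack in the state rate. If R₂ < log|X₂|, a little of a point feasible at log|X₂|
is mixed into the maximizer. If R₂ = log|X₂|, feasibility forces X₂ to be uniform and V can be
merged into U without loss; this gives the classical formula, and coding uses all state sequences.
-/

namespace GenGP

noncomputable section

open Filter Topology

set_option linter.unusedSectionVars false

/-! ### Compactness of convex hulls -/

section Hull

/-- The convex hull of a compact set in a finite-dimensional space is compact. -/
theorem isCompact_convexHull_of_finiteDimensional {E : Type*} [NormedAddCommGroup E]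
    [NormedSpace ℝ E] [FiniteDimensional ℝ E] {s : Set E} (hs : IsCompact s) :
    IsCompact (convexHull ℝ s) := by
  rcases s.eq_empty_or_nonempty with rfl | ⟨s₀, hs₀⟩
  · simp
  -- By Carathéodory, d points always suffice, so the hull is a continuous image of a compact set of
  -- weights and points.
  set d := Module.finrank ℝ E + 1
  have himg : convexHull ℝ s = (fun p : (Fin d → ℝ) × (Fin d → E) => ∑ i, p.1 i • p.2 i) ''
      (stdSimplex ℝ (Fin d) ×ˢ Set.univ.pi fun _ => s) := by
    apply Set.Subset.antisymm
    · intro x hx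
      obtain ⟨ι, _, z, w, hz, hind, hw, hw1, rfl⟩ := eq_pos_convex_span_of_mem_convexHull hx
      have hcard : Fintype.card ι ≤ Fintype.card (Fin d) := by
        simpa [d] using hind.card_le_finrank_succ.trans
          (Nat.add_le_add_right (Submodule.finrank_le _) 1)
      obtain ⟨e⟩ := Function.Embedding.nonempty_of_card_le hcard
      -- Combinations with fewer than d points are padded with weight 0 and the dummy point `s₀`.
      have hwe : ∀ i, i ∉ Set.range e → Function.extend e w 0 i = 0 := fun i hi => by
        rw [Function.extend_apply' _ _ _ (by simpa using hi)]; rfl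
      refine ⟨(Function.extend e w 0, Function.extend e z fun _ => s₀), ⟨⟨fun i => ?_, ?_⟩, ?_⟩, ?_⟩
      · by_cases hi : ∃ a, e a = i
        · obtain ⟨a, rfl⟩ := hi
          simpa [e.injective.extend_apply] using (hw a).le
        · exact (hwe i hi).ge
      · rw [← hw1]
        exact (Fintype.sum_of_injective e e.injective _ _ hwe
          (fun i => by simp [e.injective.extend_apply])).symm
      · intro i _
        by_cases hi : ∃ a, e a = i
        · obtain ⟨a, rfl⟩ := hi
          simpa [e.injective.extend_apply] using hz ⟨a, rfl⟩
        · simpa [Function.extend_apply' _ _ _ hi] using hs₀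
      · exact (Fintype.sum_of_injective e e.injective _ _ (fun i hi => by simp [hwe i hi])
          (fun i => by simp [e.injective.extend_apply])).symm
    · rintro _ ⟨⟨w, z⟩, ⟨hw, hz⟩, rfl⟩
      exact (convex_convexHull ℝ s).sum_mem (fun i _ => hw.1 i) hw.2
        (fun i _ => subset_convexHull ℝ s (hz i (Set.mem_univ i)))
  rw [himg]
  refine ((isCompact_stdSimplex ℝ (Fin d)).prod (isCompact_univ_pi fun _ => hs)).image ?_
  fun_prop

end Hull

/-! ### Entropy of a probability vector -/

section Ent

variable {α β : Type*} [Fintype α] [Fintype β]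

/-- The entropy in bits of a vector of probabilities. -/
def ent (p : α → ℝ) : ℝ := -∑ a, p a * Real.logb 2 (p a)

theorem ent_eq_sum_negMulLog (p : α → ℝ) : ent p = (∑ a, Real.negMulLog (p a)) / Real.log 2 := by
  simp only [ent, Real.negMulLog, Real.logb, Finset.sum_div, ← Finset.sum_neg_distrib]
  exact Finset.sum_congr rfl fun a _ => by ring

@[fun_prop]
theorem continuous_ent : Continuous (ent : (α → ℝ) → ℝ) := by
  have : (ent : (α → ℝ) → ℝ) = fun p => (∑ a, Real.negMulLog (p a)) / Real.log 2 :=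
    funext ent_eq_sum_negMulLog
  rw [this]
  fun_prop

theorem concaveOn_ent : ConcaveOn ℝ (Set.Ici (0 : α → ℝ)) (ent : (α → ℝ) → ℝ) := by
  have hl : 0 < Real.log 2 := Real.log_pos one_lt_two
  refine ⟨convex_Ici 0, fun p hp q hq a b ha hb hab => ?_⟩
  simp only [ent_eq_sum_negMulLog, smul_eq_mul, mul_div_assoc', ← add_div, Finset.mul_sum,
    ← Finset.sum_add_distrib]
  refine div_le_div_of_nonneg_right (Finset.sum_le_sum fun x _ => ?_) hl.le
  exact Real.concaveOn_negMulLog.2 (hp x) (hq x) ha hb hab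

/-- Gibbs' inequality: the cross entropy with a subprobability vector is at least the entropy. -/
theorem ent_le_cross {p q : α → ℝ} (hp : ∀ a, 0 ≤ p a) (hp1 : ∑ a, p a = 1)
    (hq : ∀ a, 0 ≤ q a) (hq1 : ∑ a, q a ≤ 1) (hpq : ∀ a, p a ≠ 0 → q a ≠ 0) :
    ent p ≤ -∑ a, p a * Real.logb 2 (q a) := by
  have hl : 0 < Real.log 2 := Real.log_pos one_lt_two
  have key : ∀ a, p a * Real.log (q a) - p a * Real.log (p a) ≤ q a - p a := fun a => by
    rcases eq_or_ne (p a) 0 with h | h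
    · simp [h, hq a]
    · have hpa := lt_of_le_of_ne (hp a) h.symm
      have hqa := lt_of_le_of_ne (hq a) (hpq a h).symm
      have := Real.log_le_sub_one_of_pos (div_pos hqa hpa)
      rw [Real.log_div hqa.ne' hpa.ne'] at this
      have h2 := mul_le_mul_of_nonneg_left this hpa.le
      have h3 : p a * (q a / p a - 1) = q a - p a := by field_simp
      linarith
  have hs := Finset.sum_le_sum fun a (_ : a ∈ Finset.univ) => key a
  simp only [Finset.sum_sub_distrib, hp1] at hs
  simp only [ent, Real.logb, mul_div_assoc', ← Finset.sum_div, neg_le_neg_iff]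
  exact div_le_div_of_nonneg_right (by linarith) hl.le

theorem ent_nonneg {p : α → ℝ} (hp : p ∈ stdSimplex ℝ α) : 0 ≤ ent p := by
  rw [ent_eq_sum_negMulLog]
  refine div_nonneg (Finset.sum_nonneg fun a _ => Real.negMulLog_nonneg (hp.1 a) ?_)
    (Real.log_pos one_lt_two).le
  rw [← hp.2]
  exact Finset.single_le_sum (fun b _ => hp.1 b) (Finset.mem_univ a)

theorem ent_le_logb_card {p : α → ℝ} (hp : p ∈ stdSimplex ℝ α) :
    ent p ≤ Real.logb 2 (Fintype.card α) := by
  have hne : Nonempty α := by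
    by_contra h
    have := not_nonempty_iff.1 h
    simpa using hp.2
  have hc : (0 : ℝ) < Fintype.card α := by exact_mod_cast Fintype.card_pos
  refine (ent_le_cross (q := fun _ => 1 / (Fintype.card α : ℝ)) hp.1 hp.2 (fun _ => by positivity)
    (by simp [hc.ne']) (fun _ _ => by positivity)).trans ?_
  rw [← Finset.sum_mul, hp.2]
  simp

theorem ent_const {c : ℝ} (hc : (Fintype.card α : ℝ) * c = 1) :
    ent (fun _ : α => c) = Real.logb 2 (Fintype.card α) := by
  have : c = (Fintype.card α : ℝ)⁻¹ := eq_inv_of_mul_eq_one_right hc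
  simp only [ent, Finset.sum_const, Finset.card_univ, nsmul_eq_mul, ← mul_assoc, hc]
  simp [this]

/-- Only the uniform distribution has maximal entropy. -/
theorem eq_uniform_of_logb_card_le_ent {p : α → ℝ} (hp : p ∈ stdSimplex ℝ α)
    (h : Real.logb 2 (Fintype.card α) ≤ ent p) : p = fun _ => 1 / (Fintype.card α : ℝ) := by
  have hne : Nonempty α := by
    by_contra h
    have := not_nonempty_iff.1 h
    simpa using hp.2
  have hc : (0 : ℝ) < Fintype.card α := by exact_mod_cast Fintype.card_pos
  set u : α → ℝ := fun _ => 1 / (Fintype.card α : ℝ)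
  have hu : u ∈ stdSimplex ℝ α := ⟨fun _ => by positivity, by simp [u, hc.ne']⟩
  have hue : ent u = Real.logb 2 (Fintype.card α) := ent_const (by field_simp)
  by_contra hpu
  obtain ⟨a, ha⟩ := Function.ne_iff.1 hpu
  have hl : 0 < Real.log 2 := Real.log_pos one_lt_two
  -- If p were not uniform, strict concavity would lift the entropy of the midpoint of p and u above
  -- log of the cardinality.
  have hlt : (1 / 2 : ℝ) * ent p + 1 / 2 * ent u < ent ((1 / 2 : ℝ) • p + (1 / 2 : ℝ) • u) := by
    simp only [ent_eq_sum_negMulLog, mul_div_assoc', ← add_div, Finset.mul_sum,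
      ← Finset.sum_add_distrib]
    refine div_lt_div_of_pos_right (Finset.sum_lt_sum (fun x _ => ?_) ⟨a, Finset.mem_univ a, ?_⟩) hl
    · exact Real.concaveOn_negMulLog.2 (hp.1 x) (hu.1 x) (by norm_num) (by norm_num) (by norm_num)
    · exact Real.strictConcaveOn_negMulLog.2 (hp.1 a) (hu.1 a) ha (by norm_num) (by norm_num)
        (by norm_num)
  have := ent_le_logb_card (convex_stdSimplex ℝ α hp hu (a := 1 / 2) (b := 1 / 2) (by norm_num)
    (by norm_num) (by norm_num))
  linarith

end Ent

/-! ### The region of information quantities as a double convex hull -/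

section Region

variable {X₁ X₂ Y₁ : Type*} [Fintype X₁] [Fintype X₂] [Fintype Y₁]

/-- The output law of a joint law of state and input. -/
def outLaw (W : X₁ → X₂ → Y₁ → ℝ) (π : X₂ × X₁ → ℝ) : Y₁ → ℝ := fun y => ∑ z, π z * W z.2 z.1 y

/-- The state marginal of a joint law of state and input. -/
def stLaw (π : X₂ × X₁ → ℝ) : X₂ → ℝ := fun x => ∑ x₁, π (x, x₁)

@[fun_prop]
theorem continuous_outLaw (W : X₁ → X₂ → Y₁ → ℝ) : Continuous (outLaw W) := by
  unfold outLaw; fun_prop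

@[fun_prop]
theorem continuous_stLaw : Continuous (stLaw : (X₂ × X₁ → ℝ) → X₂ → ℝ) := by
  unfold stLaw; fun_prop

theorem outLaw_sum {ι : Type*} [Fintype ι] (W : X₁ → X₂ → Y₁ → ℝ) (w : ι → ℝ)
    (π : ι → X₂ × X₁ → ℝ) (y : Y₁) :
    outLaw W (∑ i, w i • π i) y = ∑ i, w i * outLaw W (π i) y := by
  simp only [outLaw, Finset.sum_apply, Pi.smul_apply, smul_eq_mul, Finset.sum_mul, Finset.mul_sum,
    mul_assoc]
  exact Finset.sum_comm

theorem stLaw_sum {ι : Type*} [Fintype ι] (w : ι → ℝ) (π : ι → X₂ × X₁ → ℝ) (x : X₂) :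
    stLaw (∑ i, w i • π i) x = ∑ i, w i * stLaw (π i) x := by
  simp only [stLaw, Finset.sum_apply, Pi.smul_apply, smul_eq_mul, Finset.mul_sum]
  exact Finset.sum_comm

theorem outLaw_sum' {ι : Type*} [Fintype ι] (W : X₁ → X₂ → Y₁ → ℝ) (w : ι → ℝ)
    (π : ι → X₂ × X₁ → ℝ) :
    outLaw W (∑ i, w i • π i) = ∑ i, w i • outLaw W (π i) := by
  ext y; simp [outLaw_sum]

theorem stLaw_sum' {ι : Type*} [Fintype ι] (w : ι → ℝ) (π : ι → X₂ × X₁ → ℝ) :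
    stLaw (∑ i, w i • π i) = ∑ i, w i • stLaw (π i) := by
  ext y; simp [stLaw_sum]

theorem outLaw_mem {W : X₁ → X₂ → Y₁ → ℝ} (hW : ∀ x₁ x₂, W x₁ x₂ ∈ stdSimplex ℝ Y₁)
    {π : X₂ × X₁ → ℝ} (hπ : π ∈ stdSimplex ℝ (X₂ × X₁)) : outLaw W π ∈ stdSimplex ℝ Y₁ := by
  refine ⟨fun y => Finset.sum_nonneg fun z _ => mul_nonneg (hπ.1 z) ((hW _ _).1 y), ?_⟩
  simp only [outLaw]
  rw [Finset.sum_comm]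
  simp only [← Finset.mul_sum, (hW _ _).2, mul_one, hπ.2]

theorem stLaw_mem {π : X₂ × X₁ → ℝ} (hπ : π ∈ stdSimplex ℝ (X₂ × X₁)) :
    stLaw π ∈ stdSimplex ℝ X₂ := by
  refine ⟨fun y => Finset.sum_nonneg fun z _ => hπ.1 _, ?_⟩
  simp only [stLaw, ← Fintype.sum_prod_type', hπ.2]

theorem sum_smul_mem_stdSimplex {ι κ : Type*} [Fintype ι] [Fintype κ] {w : ι → ℝ}
    (hw : w ∈ stdSimplex ℝ ι) {π : ι → κ → ℝ} (hπ : ∀ i, π i ∈ stdSimplex ℝ κ) :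
    ∑ i, w i • π i ∈ stdSimplex ℝ κ :=
  (convex_stdSimplex ℝ κ).sum_mem (fun i _ => hw.1 i) hw.2 fun i _ => hπ i

variable (W : X₁ → X₂ → Y₁ → ℝ)

/-- The pairs `(law of (X₂,X₁), H(Y₁|U) - H(X₂|U))`. -/
def innerHull : Set ((X₂ × X₁ → ℝ) × ℝ) :=
  convexHull ℝ ((fun π => (π, ent (outLaw W π) - ent (stLaw π))) '' stdSimplex ℝ (X₂ × X₁))

/-- The tuple `(law of (X₂,X₁), H(Y₁), H(X₂), I(U;Y₁) - I(U;X₂))` given by an element of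
`innerHull`. -/
def liftPoint (c : (X₂ × X₁ → ℝ) × ℝ) : (X₂ × X₁ → ℝ) × ℝ × ℝ × ℝ :=
  (c.1, ent (outLaw W c.1), ent (stLaw c.1), ent (outLaw W c.1) - ent (stLaw c.1) - c.2)

/-- The tuples `(law of (X₂,X₁), H(Y₁|V), H(X₂|V), I(U;Y₁|V) - I(U;X₂|V))`. -/
def outerHull : Set ((X₂ × X₁ → ℝ) × ℝ × ℝ × ℝ) :=
  convexHull ℝ (liftPoint W '' innerHull W)

/-- The constraint on the state rate. -/
def Feasible (R₂ : ℝ) (z : (X₂ × X₁ → ℝ) × ℝ × ℝ × ℝ) : Prop :=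
  R₂ ≤ z.2.2.1 - z.2.1 + ent (outLaw W z.1) ∧ R₂ ≤ ent (stLaw z.1)

theorem isCompact_innerHull : IsCompact (innerHull W) :=
  isCompact_convexHull_of_finiteDimensional
    ((isCompact_stdSimplex ℝ (X₂ × X₁)).image (by fun_prop))

theorem isCompact_outerHull : IsCompact (outerHull W) :=
  isCompact_convexHull_of_finiteDimensional
    ((isCompact_innerHull W).image (by unfold liftPoint; fun_prop))

variable {W}

theorem innerHull_fst_mem {c : (X₂ × X₁ → ℝ) × ℝ} (hc : c ∈ innerHull W) :
    c.1 ∈ stdSimplex ℝ (X₂ × X₁) := by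
  have : innerHull W ⊆ (LinearMap.fst ℝ (X₂ × X₁ → ℝ) ℝ) ⁻¹' stdSimplex ℝ (X₂ × X₁) :=
    convexHull_min (by rintro _ ⟨π, hπ, rfl⟩; exact hπ)
      ((convex_stdSimplex ℝ _).linear_preimage _)
  exact this hc

theorem outerHull_fst_mem {z : (X₂ × X₁ → ℝ) × ℝ × ℝ × ℝ} (hz : z ∈ outerHull W) :
    z.1 ∈ stdSimplex ℝ (X₂ × X₁) := by
  have : outerHull W ⊆ (LinearMap.fst ℝ (X₂ × X₁ → ℝ) (ℝ × ℝ × ℝ)) ⁻¹' stdSimplex ℝ (X₂ × X₁) :=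
    convexHull_min (by rintro _ ⟨c, hc, rfl⟩; exact innerHull_fst_mem hc)
      ((convex_stdSimplex ℝ _).linear_preimage _)
  exact this hz

theorem liftPoint_mem {c : (X₂ × X₁ → ℝ) × ℝ} (hc : c ∈ innerHull W) :
    liftPoint W c ∈ outerHull W :=
  subset_convexHull ℝ _ ⟨c, hc, rfl⟩

/-- Merging `V` into `U`. -/
theorem merge_mem_innerHull {z : (X₂ × X₁ → ℝ) × ℝ × ℝ × ℝ} (hz : z ∈ outerHull W) :
    (z.1, z.2.1 - z.2.2.1 - z.2.2.2) ∈ innerHull W := by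
  -- This linear map undoes `liftPoint`, so it sends the generators of `outerHull` into the convex
  -- set `innerHull`. Its second coordinate is H(Y₁|U,V) − H(X₂|U,V).
  have : IsLinearMap ℝ fun z : (X₂ × X₁ → ℝ) × ℝ × ℝ × ℝ =>
      ((z.1, z.2.1 - z.2.2.1 - z.2.2.2) : (X₂ × X₁ → ℝ) × ℝ) :=
    ⟨fun x y => by ext <;> simp; ring, fun c x => by ext <;> simp; ring⟩
  have hsub : outerHull W ⊆ this.mk' _ ⁻¹' innerHull W :=
    convexHull_min (by
      rintro _ ⟨c, hc, rfl⟩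
      simpa [liftPoint] using hc) ((convex_convexHull ℝ _).linear_preimage _)
  exact hsub hz

theorem isClosed_feasible (R₂ : ℝ) : IsClosed {z | Feasible W R₂ z} := by
  have h1 : Continuous fun z : (X₂ × X₁ → ℝ) × ℝ × ℝ × ℝ =>
      z.2.2.1 - z.2.1 + ent (outLaw W z.1) := by fun_prop
  have h2 : Continuous fun z : (X₂ × X₁ → ℝ) × ℝ × ℝ × ℝ => ent (stLaw z.1) := by fun_prop
  exact (isClosed_le continuous_const h1).inter (isClosed_le continuous_const h2)

/-- Among the feasible points some point has the greatest objective. -/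
theorem exists_max_feasible {R₂ : ℝ} (hne : ∃ z ∈ outerHull W, Feasible W R₂ z) :
    ∃ z ∈ outerHull W, Feasible W R₂ z ∧
      ∀ z' ∈ outerHull W, Feasible W R₂ z' → z'.2.2.2 ≤ z.2.2.2 := by
  obtain ⟨z₀, hz₀, hf₀⟩ := hne
  obtain ⟨z, hz, hmax⟩ := ((isCompact_outerHull W).inter_right (isClosed_feasible R₂)).exists_isMaxOn
    ⟨z₀, hz₀, hf₀⟩ (f := fun z => z.2.2.2) (by fun_prop)
  exact ⟨z, hz.1, hz.2, fun z' h1 h2 => hmax ⟨h1, h2⟩⟩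

/-- The average of points of `outerHull`: the feasibility margins are concave. -/
theorem feasible_sum {ι : Type*} [Fintype ι] {w : ι → ℝ} (hw : w ∈ stdSimplex ℝ ι)
    {z : ι → (X₂ × X₁ → ℝ) × ℝ × ℝ × ℝ} (hz : ∀ i, z i ∈ outerHull W)
    (hW : ∀ x₁ x₂, W x₁ x₂ ∈ stdSimplex ℝ Y₁) {R₂ : ℝ}
    (h1 : R₂ ≤ ∑ i, w i * ((z i).2.2.1 - (z i).2.1 + ent (outLaw W (z i).1)))
    (h2 : R₂ ≤ ∑ i, w i * ent (stLaw (z i).1)) :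
    Feasible W R₂ (∑ i, w i • z i) := by
  have e1 : (∑ i, w i • z i).1 = ∑ i, w i • (z i).1 := by simp [Prod.fst_sum]
  constructor
  · refine h1.trans ?_
    rw [e1, outLaw_sum']
    have := concaveOn_ent.le_map_sum (t := Finset.univ) (w := w) (p := fun i => outLaw W (z i).1)
      (fun i _ => hw.1 i) hw.2 (fun i _ => (outLaw_mem hW (outerHull_fst_mem (hz i))).1)
    simp only [smul_eq_mul] at this
    simp only [Prod.snd_sum, Prod.fst_sum, Prod.smul_snd, Prod.smul_fst, smul_eq_mul, mul_add,
      mul_sub, Finset.sum_add_distrib, Finset.sum_sub_distrib]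
    linarith
  · refine h2.trans ?_
    rw [e1, stLaw_sum']
    exact concaveOn_ent.le_map_sum (t := Finset.univ) (w := w) (p := fun i => stLaw (z i).1)
      (fun i _ => hw.1 i) hw.2 (fun i _ => (stLaw_mem (outerHull_fst_mem (hz i))).1)

end Region

/-! ### Entropy calculus for random variables on a finite space -/

section Calculus

variable {Ω α β γ δ : Type*} [Fintype Ω] [Fintype α] [Fintype β] [Fintype γ] [Fintype δ]
variable {P : Ω → ℝ}

omit [Fintype α] in
theorem pr_eq_sum_ite [DecidableEq α] (P : Ω → ℝ) (X : Ω → α) (a : α) :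
    pr P X a = ∑ ω, if X ω = a then P ω else 0 := by
  rw [pr, Finset.sum_filter]
  exact Finset.sum_congr rfl fun ω _ => by congr

theorem pr_congr {X : Ω → α} {Y : Ω → β} {a : α} {b : β} (h : ∀ ω, X ω = a ↔ Y ω = b) :
    pr P X a = pr P Y b := by
  exact Finset.sum_congr (by ext; simp [h]) fun _ _ => rfl

theorem pr_nonneg (hP : ∀ ω, 0 ≤ P ω) (X : Ω → α) (a : α) : 0 ≤ pr P X a :=
  Finset.sum_nonneg fun ω _ => hP ω

theorem sum_pr_mul (P : Ω → ℝ) (X : Ω → α) (f : α → ℝ) :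
    ∑ a, pr P X a * f a = ∑ ω, P ω * f (X ω) := by
  classical
  simp only [pr_eq_sum_ite, Finset.sum_mul, ite_mul, zero_mul]
  rw [Finset.sum_comm]
  simp

theorem pr_mem_stdSimplex (hP : P ∈ stdSimplex ℝ Ω) (X : Ω → α) : pr P X ∈ stdSimplex ℝ α :=
  ⟨pr_nonneg hP.1 X, by simpa [hP.2] using sum_pr_mul P X fun _ => 1⟩

theorem pr_eq_sum_pair (P : Ω → ℝ) (X : Ω → α) (Y : Ω → β) (a : α) :
    pr P X a = ∑ b, pr P (fun ω => (X ω, Y ω)) (a, b) := by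
  classical
  simp only [pr_eq_sum_ite, Prod.mk.injEq]
  rw [Finset.sum_comm]
  refine Finset.sum_congr rfl fun ω _ => ?_
  by_cases h : X ω = a <;> simp [h]

theorem le_pr (hP : ∀ ω, 0 ≤ P ω) (X : Ω → α) (ω : Ω) : P ω ≤ pr P X (X ω) := by
  classical
  exact Finset.single_le_sum (f := P) (fun ω _ => hP ω) (by simp)

theorem pr_pos (hP : ∀ ω, 0 ≤ P ω) {ω : Ω} (h : P ω ≠ 0) (X : Ω → α) : 0 < pr P X (X ω) :=
  (lt_of_le_of_ne (hP ω) h.symm).trans_le (le_pr hP X ω)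

theorem entropy_eq_ent (P : Ω → ℝ) (X : Ω → α) : entropy P X = ent (pr P X) := rfl

theorem entropy_eq_sum (P : Ω → ℝ) (X : Ω → α) :
    entropy P X = -∑ ω, P ω * Real.logb 2 (pr P X (X ω)) := by
  rw [entropy, sum_pr_mul P X fun a => Real.logb 2 (pr P X a)]

/-- Entropy depends on the partition generated by the variable only. -/
theorem entropy_congr {X : Ω → α} {Y : Ω → β} (h : ∀ ω ω', X ω = X ω' ↔ Y ω = Y ω') :
    entropy P X = entropy P Y := by
  rw [entropy_eq_sum, entropy_eq_sum]
  congr 1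
  exact Finset.sum_congr rfl fun ω _ => by rw [pr_congr fun ω' => h ω' ω]

/-- Both sides are averages over sample points. Points of mass 0 do not count, and at the others the
marginals are positive, so the logarithm of the quotient splits. -/
theorem condEntropy_eq_sub (hP : ∀ ω, 0 ≤ P ω) (X : Ω → α) (Z : Ω → γ) :
    condEntropy P X Z = entropy P (fun ω => (X ω, Z ω)) - entropy P Z := by
  rw [condEntropy, ← Fintype.sum_prod_type' (f := fun x z => pr P (fun ω => (X ω, Z ω)) (x, z) *
    Real.logb 2 (pr P (fun ω => (X ω, Z ω)) (x, z) / pr P Z z)),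
    sum_pr_mul P (fun ω => (X ω, Z ω)) fun a =>
    Real.logb 2 (pr P (fun ω => (X ω, Z ω)) a / pr P Z a.2), entropy_eq_sum, entropy_eq_sum,
    neg_sub_neg, ← Finset.sum_sub_distrib, ← Finset.sum_neg_distrib]
  refine Finset.sum_congr rfl fun ω _ => ?_
  rcases eq_or_ne (P ω) 0 with h | h
  · simp [h]
  · rw [Real.logb_div (pr_pos hP h _).ne' (pr_pos hP h _).ne']
    ring

theorem mutualInfo_eq (hP : ∀ ω, 0 ≤ P ω) (X : Ω → α) (Y : Ω → β) :
    mutualInfo P X Y = entropy P Y - condEntropy P Y X := by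
  rw [mutualInfo, condEntropy_eq_sub hP, condEntropy_eq_sub hP,
    entropy_congr (X := fun ω => (X ω, Y ω)) (Y := fun ω => (Y ω, X ω))
      fun ω ω' => by simp only [Prod.mk.injEq]; tauto]
  ring

theorem condMutualInfo_eq (hP : ∀ ω, 0 ≤ P ω) (X : Ω → α) (Y : Ω → β) (Z : Ω → γ) :
    condMutualInfo P X Y Z = condEntropy P Y Z - condEntropy P Y (fun ω => (X ω, Z ω)) := by
  rw [condMutualInfo, condEntropy_eq_sub hP, condEntropy_eq_sub hP, condEntropy_eq_sub hP,
    condEntropy_eq_sub hP,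
    entropy_congr (X := fun ω => (X ω, Y ω, Z ω)) (Y := fun ω => (Y ω, X ω, Z ω))
      fun ω ω' => by simp only [Prod.mk.injEq]; tauto]
  ring

/-- The kernel is the conditional law wherever `a z ≠ 0`; elsewhere the term vanishes whatever the
kernel is. -/
theorem condEntropy_of_law {X : Ω → α} {Z : Ω → γ} {a : γ → ℝ} {k : γ → α → ℝ}
    (hk : ∀ z, k z ∈ stdSimplex ℝ α)
    (h : ∀ x z, pr P (fun ω => (X ω, Z ω)) (x, z) = a z * k z x) :
    condEntropy P X Z = ∑ z, a z * ent (k z) := by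
  have hZ : ∀ z, pr P Z z = a z := fun z => by
    rw [pr_eq_sum_pair P Z X z, ← mul_one (a z), ← (hk z).2, Finset.mul_sum]
    exact Finset.sum_congr rfl fun x _ => by
      rw [← h]; exact pr_congr fun ω => by simp only [Prod.mk.injEq]; tauto
  rw [condEntropy, Finset.sum_comm, ← Finset.sum_neg_distrib]
  refine Finset.sum_congr rfl fun z _ => ?_
  simp only [h, hZ, ent, mul_neg, Finset.mul_sum]
  congr 1
  refine Finset.sum_congr rfl fun x _ => ?_
  rcases eq_or_ne (a z) 0 with h0 | h0
  · simp [h0]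
  · rw [mul_div_cancel_left₀ _ h0, mul_assoc]

theorem exists_kernel [Nonempty α] (hP : ∀ ω, 0 ≤ P ω) (X : Ω → α) (Z : Ω → γ) :
    ∃ k : γ → α → ℝ, (∀ z, k z ∈ stdSimplex ℝ α) ∧
      ∀ x z, pr P (fun ω => (X ω, Z ω)) (x, z) = pr P Z z * k z x := by
  classical
  have hc : (Fintype.card α : ℝ) ≠ 0 := by simp
  have hsum : ∀ z, ∑ x, pr P (fun ω => (X ω, Z ω)) (x, z) = pr P Z z := fun z => by
    rw [pr_eq_sum_pair P Z X z]
    exact Finset.sum_congr rfl fun x _ => pr_congr fun ω => by simp only [Prod.mk.injEq]; tauto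
  -- On conditions of probability 0 the kernel is uniform by default, so that it is a probability
  -- vector everywhere.
  refine ⟨fun z x => if pr P Z z = 0 then 1 / (Fintype.card α : ℝ)
    else pr P (fun ω => (X ω, Z ω)) (x, z) / pr P Z z, fun z => ?_, fun x z => ?_⟩
  · by_cases h : pr P Z z = 0
    · exact ⟨fun x => by simp [h], by simp [h]⟩
    · refine ⟨fun x => ?_, ?_⟩
      · simpa [h] using div_nonneg (pr_nonneg hP _ _) (pr_nonneg hP _ _)
      · simp only [h, if_false, ← Finset.sum_div, hsum]
        exact div_self h
  · by_cases h : pr P Z z = 0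
    · rw [h, zero_mul]
      exact (Finset.sum_eq_zero_iff_of_nonneg fun x _ => pr_nonneg hP _ _).1
        ((hsum z).trans h) x (Finset.mem_univ x)
    · simp only [h, if_false]
      field_simp

end Calculus

/-! ### Ensembles of U and V as points of the hulls -/

section Ensemble

variable {X₁ X₂ Y₁ 𝒱 𝒰 : Type*} [Fintype X₁] [Fintype X₂] [Fintype Y₁] [Fintype 𝒱] [Fintype 𝒰]

/-- The inner point of a family of laws of `(X₂,X₁)` mixed with weights `b`. -/
def innerPoint (W : X₁ → X₂ → Y₁ → ℝ) (b : 𝒰 → ℝ) (π : 𝒰 → X₂ × X₁ → ℝ) :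
    (X₂ × X₁ → ℝ) × ℝ :=
  ∑ u, b u • (π u, ent (outLaw W (π u)) - ent (stLaw (π u)))

/-- The tuple of information quantities of `p(v) = a v`, `p(u|v) = b v u`,
`p(x₂,x₁|u,v) = π v u (x₂,x₁)`. -/
def ensPoint (W : X₁ → X₂ → Y₁ → ℝ) (a : 𝒱 → ℝ) (b : 𝒱 → 𝒰 → ℝ) (π : 𝒱 → 𝒰 → X₂ × X₁ → ℝ) :
    (X₂ × X₁ → ℝ) × ℝ × ℝ × ℝ :=
  ∑ v, a v • liftPoint W (innerPoint W (b v) (π v))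

variable {W : X₁ → X₂ → Y₁ → ℝ} {a : 𝒱 → ℝ} {b : 𝒱 → 𝒰 → ℝ} {π : 𝒱 → 𝒰 → X₂ × X₁ → ℝ}

theorem innerPoint_mem {b : 𝒰 → ℝ} {π : 𝒰 → X₂ × X₁ → ℝ} (hb : b ∈ stdSimplex ℝ 𝒰)
    (hπ : ∀ u, π u ∈ stdSimplex ℝ (X₂ × X₁)) : innerPoint W b π ∈ innerHull W :=
  (convex_convexHull ℝ _).sum_mem (fun u _ => hb.1 u) hb.2
    fun u _ => subset_convexHull ℝ _ ⟨π u, hπ u, rfl⟩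

theorem ensPoint_mem (ha : a ∈ stdSimplex ℝ 𝒱) (hb : ∀ v, b v ∈ stdSimplex ℝ 𝒰)
    (hπ : ∀ v u, π v u ∈ stdSimplex ℝ (X₂ × X₁)) : ensPoint W a b π ∈ outerHull W :=
  (convex_convexHull ℝ _).sum_mem (fun u _ => ha.1 u) ha.2
    fun v _ => liftPoint_mem (innerPoint_mem (hb v) (hπ v))

theorem innerPoint_fst (b : 𝒰 → ℝ) (π : 𝒰 → X₂ × X₁ → ℝ) :
    (innerPoint W b π).1 = ∑ u, b u • π u := by
  simp [innerPoint, Prod.fst_sum]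

theorem innerPoint_snd (b : 𝒰 → ℝ) (π : 𝒰 → X₂ × X₁ → ℝ) :
    (innerPoint W b π).2 = ∑ u, b u * (ent (outLaw W (π u)) - ent (stLaw (π u))) := by
  simp [innerPoint, Prod.snd_sum]

theorem ensPoint_fst : (ensPoint W a b π).1 = ∑ v, a v • ∑ u, b v u • π v u := by
  simp [ensPoint, Prod.fst_sum, liftPoint, innerPoint_fst]

theorem ensPoint_out :
    (ensPoint W a b π).2.1 = ∑ v, a v * ent (outLaw W (∑ u, b v u • π v u)) := by
  simp [ensPoint, Prod.fst_sum, Prod.snd_sum, liftPoint, innerPoint_fst]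

theorem ensPoint_st :
    (ensPoint W a b π).2.2.1 = ∑ v, a v * ent (stLaw (∑ u, b v u • π v u)) := by
  simp [ensPoint, Prod.fst_sum, Prod.snd_sum, liftPoint, innerPoint_fst]

theorem ensPoint_obj :
    (ensPoint W a b π).2.2.2 = ∑ v, a v * (ent (outLaw W (∑ u, b v u • π v u)) -
      ent (stLaw (∑ u, b v u • π v u)) -
      ∑ u, b v u * (ent (outLaw W (π v u)) - ent (stLaw (π v u)))) := by
  simp [ensPoint, Prod.snd_sum, liftPoint, innerPoint_fst, innerPoint_snd]

/-- Every element of `innerHull` is a mixture. -/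
theorem exists_innerPoint {c : (X₂ × X₁ → ℝ) × ℝ} (hc : c ∈ innerHull W) :
    ∃ (m : ℕ) (b : Fin m → ℝ) (π : Fin m → X₂ × X₁ → ℝ), b ∈ stdSimplex ℝ (Fin m) ∧
      (∀ u, π u ∈ stdSimplex ℝ (X₂ × X₁)) ∧ innerPoint W b π = c := by
  obtain ⟨ι, _, w, z, hw, hw1, hz, rfl⟩ := mem_convexHull_iff_exists_fintype.1 hc
  choose π hπ hπz using hz
  let e := Fintype.equivFin ι
  refine ⟨Fintype.card ι, w ∘ e.symm, π ∘ e.symm, ⟨fun i => hw _, ?_⟩, fun i => hπ _, ?_⟩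
  · simpa [hw1] using e.symm.sum_comp w
  · simp only [← hπz, innerPoint]
    exact e.symm.sum_comp fun i => w i • (π i, ent (outLaw W (π i)) - ent (stLaw (π i)))

open scoped Classical in
theorem sum_sigma_ite_smul {ι M : Type*} [Fintype ι] [AddCommGroup M] [Module ℝ M] {m : ι → ℕ}
    (b : ∀ i, Fin (m i) → ℝ) (i : ι) (g : (Σ i, Fin (m i)) → M) :
    ∑ u : Σ i, Fin (m i), (if u.1 = i then b u.1 u.2 else 0) • g u = ∑ j, b i j • g ⟨i, j⟩ := by
  rw [Fintype.sum_sigma, Finset.sum_eq_single i]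
  · simp
  · intro j _ hj; simp [hj]
  · simp

/-- Every element of `outerHull` is the point of an ensemble in which the law of `(X₂,X₁)` is
determined by `u`. -/
theorem exists_ensPoint {z : (X₂ × X₁ → ℝ) × ℝ × ℝ × ℝ} (hz : z ∈ outerHull W) :
    ∃ (k m : ℕ) (a : Fin k → ℝ) (b : Fin k → Fin m → ℝ) (π : Fin m → X₂ × X₁ → ℝ),
      a ∈ stdSimplex ℝ (Fin k) ∧ (∀ v, b v ∈ stdSimplex ℝ (Fin m)) ∧
      (∀ u, π u ∈ stdSimplex ℝ (X₂ × X₁)) ∧ ensPoint W a b (fun _ => π) = z := by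
  classical
  obtain ⟨ι, _, w, y, hw, hw1, hy, rfl⟩ := mem_convexHull_iff_exists_fintype.1 hz
  choose c hc hcy using hy
  choose m b π hb hπ hbπ using fun i => exists_innerPoint (hc i)
  let e := Fintype.equivFin ι
  let f := Fintype.equivFin (Σ i, Fin (m i))
  -- U takes values in the disjoint union of the alphabets used for the different v. Then u alone
  -- determines the law of (X₂,X₁), as the form p(x₁|u,x₂) requires.
  let b' : ι → (Σ i, Fin (m i)) → ℝ := fun i u => if u.1 = i then b u.1 u.2 else 0
  let π' : (Σ i, Fin (m i)) → X₂ × X₁ → ℝ := fun u => π u.1 u.2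
  refine ⟨Fintype.card ι, _, w ∘ e.symm, fun v u => b' (e.symm v) (f.symm u),
    fun u => π' (f.symm u), ⟨fun i => hw _, ?_⟩, fun v => ⟨fun u => ?_, ?_⟩, fun u => hπ _ _, ?_⟩
  · simpa [hw1] using e.symm.sum_comp w
  · simp only [b']
    split_ifs
    exacts [(hb _).1 _, le_rfl]
  · rw [f.symm.sum_comp fun u => b' (e.symm v) u]
    simpa [(hb _).2] using sum_sigma_ite_smul b (e.symm v) fun _ => (1 : ℝ)
  · simp only [ensPoint, Function.comp_apply]
    rw [e.symm.sum_comp fun i => w i • liftPoint W (innerPoint W (fun u => b' i (f.symm u))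
      fun u => π' (f.symm u))]
    refine Finset.sum_congr rfl fun i _ => ?_
    rw [← hcy, ← hbπ i]
    congr 2
    rw [innerPoint, f.symm.sum_comp fun u => b' i u • (π' u, ent (outLaw W (π' u)) -
      ent (stLaw (π' u)))]
    exact sum_sigma_ite_smul b i fun u => (π' u, ent (outLaw W (π' u)) - ent (stLaw (π' u)))

variable {Ω : Type*} [Fintype Ω] {P : Ω → ℝ}

/-- The information quantities of random variables with law `a v * b v u * π v u z * W y`. -/
theorem ensPoint_of_law (hP : P ∈ stdSimplex ℝ Ω) (hW : ∀ x₁ x₂, W x₁ x₂ ∈ stdSimplex ℝ Y₁)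
    (hb : ∀ v, b v ∈ stdSimplex ℝ 𝒰)
    (hπ : ∀ v u, π v u ∈ stdSimplex ℝ (X₂ × X₁)) (V : Ω → 𝒱) (U : Ω → 𝒰) (Z : Ω → X₂ × X₁)
    (Y : Ω → Y₁) (h : ∀ v u z y, pr P (fun ω => (V ω, U ω, Z ω, Y ω)) (v, u, z, y) =
      a v * b v u * π v u z * W z.2 z.1 y) :
    pr P Z = (ensPoint W a b π).1 ∧ condEntropy P Y V = (ensPoint W a b π).2.1 ∧
      condEntropy P (fun ω => (Z ω).1) V = (ensPoint W a b π).2.2.1 ∧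
      condMutualInfo P U Y V - condMutualInfo P U (fun ω => (Z ω).1) V =
        (ensPoint W a b π).2.2.2 ∧
      entropy P Y = ent (outLaw W (ensPoint W a b π).1) ∧
      entropy P (fun ω => (Z ω).1) = ent (stLaw (ensPoint W a b π).1) := by
  have hVUZ : ∀ v u z, pr P (fun ω => (V ω, U ω, Z ω)) (v, u, z) = a v * b v u * π v u z :=
    fun v u z => by
      rw [pr_eq_sum_pair _ _ Y]
      calc _ = ∑ y, a v * b v u * π v u z * W z.2 z.1 y := Finset.sum_congr rfl fun y _ => by
            rw [← h]; exact pr_congr fun ω => by simp only [Prod.mk.injEq]; tauto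
        _ = _ := by rw [← Finset.mul_sum, (hW _ _).2, mul_one]
  have hYUV : ∀ y u v, pr P (fun ω => (Y ω, U ω, V ω)) (y, u, v) =
      a v * b v u * outLaw W (π v u) y := fun y u v => by
    rw [pr_eq_sum_pair _ _ Z, outLaw, Finset.mul_sum]
    refine Finset.sum_congr rfl fun z _ => ?_
    rw [← mul_assoc, ← h]
    exact pr_congr fun ω => by simp only [Prod.mk.injEq]; tauto
  have hXUV : ∀ x u v, pr P (fun ω => ((Z ω).1, U ω, V ω)) (x, u, v) =
      a v * b v u * stLaw (π v u) x := fun x u v => by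
    rw [pr_eq_sum_pair _ _ (fun ω => (Z ω).2), stLaw, Finset.mul_sum]
    refine Finset.sum_congr rfl fun x₁ _ => ?_
    rw [← hVUZ]
    exact pr_congr fun ω => by simp only [Prod.ext_iff]; tauto
  have hYV : ∀ y v, pr P (fun ω => (Y ω, V ω)) (y, v) =
      a v * outLaw W (∑ u, b v u • π v u) y := fun y v => by
    rw [pr_eq_sum_pair _ _ U, outLaw_sum, Finset.mul_sum]
    refine Finset.sum_congr rfl fun u _ => ?_
    rw [← mul_assoc, ← hYUV]
    exact pr_congr fun ω => by simp only [Prod.mk.injEq]; tauto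
  have hXV : ∀ x v, pr P (fun ω => ((Z ω).1, V ω)) (x, v) =
      a v * stLaw (∑ u, b v u • π v u) x := fun x v => by
    rw [pr_eq_sum_pair _ _ U, stLaw_sum, Finset.mul_sum]
    refine Finset.sum_congr rfl fun u _ => ?_
    rw [← mul_assoc, ← hXUV]
    exact pr_congr fun ω => by simp only [Prod.mk.injEq]; tauto
  have hbar : ∀ v, ∑ u, b v u • π v u ∈ stdSimplex ℝ (X₂ × X₁) := fun v =>
    sum_smul_mem_stdSimplex (hb v) (hπ v)
  have h1 : condEntropy P Y V = (ensPoint W a b π).2.1 := by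
    rw [ensPoint_out, condEntropy_of_law (fun v => outLaw_mem hW (hbar v)) hYV]
  have h2 : condEntropy P (fun ω => (Z ω).1) V = (ensPoint W a b π).2.2.1 := by
    rw [ensPoint_st, condEntropy_of_law (fun v => stLaw_mem (hbar v)) hXV]
  refine ⟨?_, h1, h2, ?_, ?_, ?_⟩
  · rw [ensPoint_fst]
    ext z
    simp only [Finset.sum_apply, Pi.smul_apply, smul_eq_mul, Finset.mul_sum]
    rw [pr_eq_sum_pair _ _ (fun ω => (V ω, U ω)), Fintype.sum_prod_type]
    refine Finset.sum_congr rfl fun v _ => Finset.sum_congr rfl fun u _ => ?_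
    rw [← mul_assoc, ← hVUZ]
    exact pr_congr fun ω => by simp only [Prod.mk.injEq]; tauto
  · rw [condMutualInfo_eq hP.1, condMutualInfo_eq hP.1, h1, h2,
      condEntropy_of_law (a := fun c : 𝒰 × 𝒱 => a c.2 * b c.2 c.1)
        (k := fun c => outLaw W (π c.2 c.1)) (fun c => outLaw_mem hW (hπ _ _))
        (fun y c => hYUV y c.1 c.2),
      condEntropy_of_law (a := fun c : 𝒰 × 𝒱 => a c.2 * b c.2 c.1)
        (k := fun c => stLaw (π c.2 c.1)) (fun c => stLaw_mem (hπ _ _))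
        (fun y c => hXUV y c.1 c.2), ensPoint_out, ensPoint_st, ensPoint_obj,
      Fintype.sum_prod_type_right, Fintype.sum_prod_type_right]
    simp only [mul_sub, Finset.sum_sub_distrib, Finset.mul_sum, mul_assoc]
    ring
  · rw [entropy_eq_ent]
    congr 1
    ext y
    rw [ensPoint_fst, outLaw_sum, pr_eq_sum_pair _ _ V]
    exact Finset.sum_congr rfl fun v _ => hYV y v
  · rw [entropy_eq_ent]
    congr 1
    ext y
    rw [ensPoint_fst, stLaw_sum, pr_eq_sum_pair _ _ V]
    exact Finset.sum_congr rfl fun v _ => hXV y v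

/-- Random variables such that `Y` is the output of the channel for `Z = (X₂,X₁)`, whatever `V` and
`U` are, come from an ensemble. -/
theorem exists_ensemble_of_law [Nonempty X₁] [Nonempty X₂]
    (hP : P ∈ stdSimplex ℝ Ω)
    (V : Ω → 𝒱) (U : Ω → 𝒰) (Z : Ω → X₂ × X₁)
    (Y : Ω → Y₁) (h : ∀ v u z y, pr P (fun ω => (V ω, U ω, Z ω, Y ω)) (v, u, z, y) =
      pr P (fun ω => (V ω, U ω, Z ω)) (v, u, z) * W z.2 z.1 y) :
    ∃ (b : 𝒱 → 𝒰 → ℝ) (π : 𝒱 → 𝒰 → X₂ × X₁ → ℝ), (∀ v, b v ∈ stdSimplex ℝ 𝒰) ∧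
      (∀ v u, π v u ∈ stdSimplex ℝ (X₂ × X₁)) ∧
      ∀ v u z y, pr P (fun ω => (V ω, U ω, Z ω, Y ω)) (v, u, z, y) =
        pr P V v * b v u * π v u z * W z.2 z.1 y := by
  have : Nonempty Ω := by
    by_contra hne
    have := not_nonempty_iff.1 hne
    simpa using hP.2
  have : Nonempty 𝒰 := this.map U
  obtain ⟨b, hb, hbV⟩ := exists_kernel hP.1 U V
  obtain ⟨π, hπ, hπV⟩ := exists_kernel hP.1 Z (fun ω => (U ω, V ω))
  refine ⟨b, fun v u => π (u, v), hb, fun v u => hπ _, fun v u z y => ?_⟩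
  rw [h, ← hbV, ← hπV]
  congr 1
  exact pr_congr fun ω => by simp only [Prod.mk.injEq]; tauto

end Ensemble

/-! ### The single-letter formulas as values on the hulls -/

section Values

variable {X₁ X₂ Y₁ : Type*} [Fintype X₁] [Fintype X₂] [Fintype Y₁]

theorem pr_of_injective {Ω α : Type*} [Fintype Ω] (P : Ω → ℝ) {X : Ω → α}
    (hX : Function.Injective X) (ω : Ω) : pr P X (X ω) = P ω := by
  classical
  rw [pr_eq_sum_ite, Finset.sum_eq_single ω]
  · simp
  · intro ω' _ h; simp [hX.ne h]
  · simp

theorem exists_disintegration [Nonempty X₁] {π : X₂ × X₁ → ℝ}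
    (hπ : π ∈ stdSimplex ℝ (X₂ × X₁)) :
    ∃ q : X₂ → X₁ → ℝ, (∀ x, q x ∈ stdSimplex ℝ X₁) ∧ ∀ x x₁, π (x, x₁) = stLaw π x * q x x₁ := by
  obtain ⟨q, hq, h⟩ := exists_kernel hπ.1 (Prod.snd : X₂ × X₁ → X₁) Prod.fst
  have hinj : Function.Injective fun ω : X₂ × X₁ => (ω.2, ω.1) := fun a b h => by
    simp only [Prod.mk.injEq] at h; exact Prod.ext h.2 h.1
  have hst : ∀ x, pr π Prod.fst x = stLaw π x := fun x => by
    rw [pr_eq_sum_pair _ _ Prod.snd, stLaw]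
    exact Finset.sum_congr rfl fun x₁ _ => pr_of_injective π Function.injective_id (x, x₁)
  refine ⟨q, hq, fun x x₁ => ?_⟩
  rw [← hst, ← h]
  exact (pr_of_injective π hinj (x, x₁)).symm

variable {W : X₁ → X₂ → Y₁ → ℝ}

section Joint

variable {𝒱 𝒰 : Type*} [Fintype 𝒱] [Fintype 𝒰]

theorem jointLaw_mem {p : 𝒱 × 𝒰 × X₂ → ℝ} {q : 𝒰 → X₂ → X₁ → ℝ}
    (hW : ∀ x₁ x₂, W x₁ x₂ ∈ stdSimplex ℝ Y₁)
    (hp : p ∈ stdSimplex ℝ (𝒱 × 𝒰 × X₂)) (hq : ∀ u x₂, q u x₂ ∈ stdSimplex ℝ X₁) :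
    jointLaw W p q ∈ stdSimplex ℝ (𝒱 × 𝒰 × X₂ × X₁ × Y₁) := by
  refine ⟨fun ω => mul_nonneg (mul_nonneg (hp.1 _) ((hq _ _).1 _)) ((hW _ _).1 _), ?_⟩
  simp only [Fintype.sum_prod_type, jointLaw, ← Finset.mul_sum, (hW _ _).2, (hq _ _).2, mul_one]
  simpa only [Fintype.sum_prod_type] using hp.2

theorem pr_jointLaw (p : 𝒱 × 𝒰 × X₂ → ℝ) (q : 𝒰 → X₂ → X₁ → ℝ) (v : 𝒱) (u : 𝒰) (z : X₂ × X₁)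
    (y : Y₁) :
    pr (jointLaw W p q) (fun ω => (rvV ω, rvU ω, (rvX₂ ω, ω.2.2.2.1), rvY₁ ω)) (v, u, z, y) =
      p (v, u, z.1) * q u z.1 z.2 * W z.2 z.1 y := by
  have hinj : Function.Injective fun ω : 𝒱 × 𝒰 × X₂ × X₁ × Y₁ =>
      (rvV ω, rvU ω, (rvX₂ ω, ω.2.2.2.1), rvY₁ ω) := by
    rintro ⟨_, _, _, _, _⟩ ⟨_, _, _, _, _⟩ h
    simp only [Prod.mk.injEq, rvV, rvU, rvX₂, rvY₁] at h
    simp [h]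
  exact pr_of_injective (jointLaw W p q) hinj (v, u, z.1, z.2, y)

/-- The minimum splits the constraint into two inequalities, and H(X₂|V) + I(V;X₂) = H(X₂) turns the
second one into R₂ ≤ H(X₂). -/
theorem jointLaw_values {P : 𝒱 × 𝒰 × X₂ × X₁ × Y₁ → ℝ}
    (hP : P ∈ stdSimplex ℝ _) (hW : ∀ x₁ x₂, W x₁ x₂ ∈ stdSimplex ℝ Y₁)
    {a : 𝒱 → ℝ} {b : 𝒱 → 𝒰 → ℝ} {π : 𝒱 → 𝒰 → X₂ × X₁ → ℝ}
    (hb : ∀ v, b v ∈ stdSimplex ℝ 𝒰) (hπ : ∀ v u, π v u ∈ stdSimplex ℝ (X₂ × X₁))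
    (h : ∀ v u z y, pr P (fun ω => (rvV ω, rvU ω, (rvX₂ ω, ω.2.2.2.1), rvY₁ ω)) (v, u, z, y) =
      a v * b v u * π v u z * W z.2 z.1 y) (R₂ : ℝ) :
    (stateRateBound P ≥ R₂ ↔ Feasible W R₂ (ensPoint W a b π)) ∧
      objective P = (ensPoint W a b π).2.2.2 := by
  obtain ⟨-, h1, h2, h3, h4, h5⟩ := ensPoint_of_law hP hW hb hπ _ _ _ _ h
  refine ⟨?_, h3⟩
  rw [stateRateBound, mutualInfo_eq hP.1, mutualInfo_eq hP.1]
  change R₂ ≤ condEntropy P (fun ω => rvX₂ ω) rvV + min (entropy P (fun ω => rvY₁ ω) -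
    condEntropy P (fun ω => rvY₁ ω) rvV) (entropy P (fun ω => rvX₂ ω) -
    condEntropy P (fun ω => rvX₂ ω) rvV) ↔ _
  change _ = _ at h2 h5
  dsimp only at h1 h2 h4 h5
  rw [h1, h2, h4, h5, ← min_add_add_left, le_min_iff, Feasible]
  refine and_congr ?_ ?_
  · rw [← add_sub_assoc, sub_add_eq_add_sub]
  · rw [add_sub_cancel]

/-- Conditioning on (v,u) turns the joint law into an ensemble. The point does not depend on R₂, and
the conditional law of (X₂,X₁) may depend on v as well as on u. -/
theorem exists_of_mem_jointLaw [Nonempty X₁] [Nonempty X₂]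
    (hW : ∀ x₁ x₂, W x₁ x₂ ∈ stdSimplex ℝ Y₁) {p : 𝒱 × 𝒰 × X₂ → ℝ}
    {q : 𝒰 → X₂ → X₁ → ℝ} (hp : p ∈ stdSimplex ℝ (𝒱 × 𝒰 × X₂))
    (hq : ∀ u x₂, q u x₂ ∈ stdSimplex ℝ X₁) :
    ∃ z ∈ outerHull W, (∀ R₂, stateRateBound (jointLaw W p q) ≥ R₂ ↔ Feasible W R₂ z) ∧
      objective (jointLaw W p q) = z.2.2.2 := by
  have hP := jointLaw_mem hW hp hq
  obtain ⟨b, π, hb, hπ, h⟩ := exists_ensemble_of_law (W := W) hP rvV rvU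
    (fun ω => (rvX₂ ω, ω.2.2.2.1)) rvY₁ fun v u z y => by
      rw [pr_jointLaw, pr_eq_sum_pair _ (fun ω => (rvV ω, rvU ω, (rvX₂ ω, ω.2.2.2.1))) rvY₁]
      congr 1
      calc _ = ∑ y, p (v, u, z.1) * q u z.1 z.2 * W z.2 z.1 y := by
            rw [← Finset.mul_sum, (hW _ _).2, mul_one]
        _ = _ := Finset.sum_congr rfl fun y _ => by
            rw [← pr_jointLaw]; exact pr_congr fun ω => by simp only [Prod.mk.injEq]; tauto
  exact ⟨_, ensPoint_mem (pr_mem_stdSimplex hP rvV) hb hπ,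
    fun R₂ => (jointLaw_values hP hW hb hπ h R₂).1, (jointLaw_values hP hW hb hπ h 0).2⟩

end Joint

/-- Random variables give a hull point by conditioning. Conversely, `exists_ensPoint` gives an
ensemble whose laws depend on u only, and disintegrating them over x₂ gives p(x₁|u,x₂). -/
theorem mem_capacityValues_iff [Nonempty X₁] [Nonempty X₂]
    (hW : ∀ x₁ x₂, W x₁ x₂ ∈ stdSimplex ℝ Y₁) {R₂ r : ℝ} :
    r ∈ capacityValues W R₂ ↔ ∃ z ∈ outerHull W, Feasible W R₂ z ∧ z.2.2.2 = r := by
  constructor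
  · rintro ⟨k, m, p, q, hp, hq, hR, rfl⟩
    obtain ⟨z, hz, hf, ho⟩ := exists_of_mem_jointLaw hW hp hq
    exact ⟨z, hz, (hf R₂).1 hR, ho.symm⟩
  · rintro ⟨z, hz, hf, rfl⟩
    obtain ⟨k, m, a, b, π, ha, hb, hπ, rfl⟩ := exists_ensPoint hz
    choose q hq hπq using fun u => exists_disintegration (hπ u)
    have hp : (fun ω : Fin k × Fin m × X₂ => a ω.1 * b ω.1 ω.2.1 * stLaw (π ω.2.1) ω.2.2) ∈
        stdSimplex ℝ (Fin k × Fin m × X₂) := by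
      refine ⟨fun ω => mul_nonneg (mul_nonneg (ha.1 _) ((hb _).1 _)) ((stLaw_mem (hπ _)).1 _), ?_⟩
      simp only [Fintype.sum_prod_type, ← Finset.mul_sum, (stLaw_mem (hπ _)).2, (hb _).2, mul_one,
        ha.2]
    obtain ⟨h1, h2⟩ := jointLaw_values (jointLaw_mem hW hp hq) hW hb (fun _ => hπ)
      (fun v u z y => by rw [pr_jointLaw, show z = (z.1, z.2) from rfl, hπq]; ring) R₂
    exact ⟨k, m, _, q, hp, hq, h1.2 hf, h2.symm⟩

section GP

variable {𝒰 : Type*} [Fintype 𝒰]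

theorem gpJointLaw_mem {p : 𝒰 × X₂ → ℝ} {q : 𝒰 → X₂ → X₁ → ℝ}
    (hW : ∀ x₁ x₂, W x₁ x₂ ∈ stdSimplex ℝ Y₁)
    (hp : p ∈ stdSimplex ℝ (𝒰 × X₂)) (hq : ∀ u x₂, q u x₂ ∈ stdSimplex ℝ X₁) :
    gpJointLaw W p q ∈ stdSimplex ℝ (𝒰 × X₂ × X₁ × Y₁) := by
  refine ⟨fun ω => mul_nonneg (mul_nonneg (hp.1 _) ((hq _ _).1 _)) ((hW _ _).1 _), ?_⟩
  simp only [Fintype.sum_prod_type, gpJointLaw, ← Finset.mul_sum, (hW _ _).2, (hq _ _).2, mul_one]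
  simpa only [Fintype.sum_prod_type] using hp.2

theorem condMutualInfo_const {Ω α β : Type*} [Fintype Ω] [Fintype α] [Fintype β] {P : Ω → ℝ}
    (hP : P ∈ stdSimplex ℝ Ω) (X : Ω → α) (Y : Ω → β) :
    condMutualInfo P X Y (fun _ => ()) = mutualInfo P X Y := by
  have h0 : entropy P (fun _ : Ω => ()) = 0 := by
    have : ∀ u, pr P (fun _ : Ω => ()) u = 1 := fun u => by simp [pr, hP.2]
    simp [entropy, this]
  rw [condMutualInfo, mutualInfo, condEntropy_eq_sub hP.1, condEntropy_eq_sub hP.1,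
    condEntropy_eq_sub hP.1, h0, entropy_congr (X := fun ω => (X ω, ())) (Y := X) (by simp),
    entropy_congr (X := fun ω => (X ω, Y ω, ())) (Y := fun ω => (X ω, Y ω)) (by simp),
    entropy_congr (X := fun ω => (Y ω, ())) (Y := Y) (by simp)]
  ring

/-- The classical rate is the conditional objective for a constant V, so the ensemble computation
applies with `Unit` as alphabet. -/
theorem gpJointLaw_value {p : 𝒰 × X₂ → ℝ} {q : 𝒰 → X₂ → X₁ → ℝ}
    (hp : p ∈ stdSimplex ℝ (𝒰 × X₂)) (hq : ∀ u x₂, q u x₂ ∈ stdSimplex ℝ X₁)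
    (hW : ∀ x₁ x₂, W x₁ x₂ ∈ stdSimplex ℝ Y₁) {b : 𝒰 → ℝ} {π : 𝒰 → X₂ × X₁ → ℝ}
    (hb : b ∈ stdSimplex ℝ 𝒰) (hπ : ∀ u, π u ∈ stdSimplex ℝ (X₂ × X₁))
    (h : ∀ u x₂ x₁, p (u, x₂) * q u x₂ x₁ = b u * π u (x₂, x₁)) :
    mutualInfo (gpJointLaw W p q) (fun (u, _, _, _) => u) (fun (_, _, _, y₁) => y₁) -
        mutualInfo (gpJointLaw W p q) (fun (u, _, _, _) => u) (fun (_, x₂, _, _) => x₂) =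
      (liftPoint W (innerPoint W b π)).2.2.2 := by
  have hP := gpJointLaw_mem hW hp hq
  have hinj : Function.Injective fun ω : 𝒰 × X₂ × X₁ × Y₁ =>
      ((), ω.1, (ω.2.1, ω.2.2.1), ω.2.2.2) := by
    rintro ⟨_, _, _, _⟩ ⟨_, _, _, _⟩ h
    simp only [Prod.mk.injEq] at h
    simp [h]
  have := (ensPoint_of_law (a := fun _ : Unit => 1) (b := fun _ => b) (π := fun _ => π) hP hW
    (fun _ => hb) (fun _ => hπ) (fun _ => ()) (fun ω => ω.1)
    (fun ω => (ω.2.1, ω.2.2.1)) (fun ω => ω.2.2.2) fun v u z y => by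
      rw [one_mul, show z = (z.1, z.2) from rfl, ← h]
      exact pr_of_injective (gpJointLaw W p q) hinj (u, z.1, z.2, y)).2.2.2.1
  rw [condMutualInfo_const hP, condMutualInfo_const hP] at this
  simpa [ensPoint] using this

theorem mem_gpValues_iff [Nonempty X₁] [Nonempty X₂]
    (hW : ∀ x₁ x₂, W x₁ x₂ ∈ stdSimplex ℝ Y₁) {pS : X₂ → ℝ} {r : ℝ} :
    r ∈ gpValues W pS ↔ ∃ c ∈ innerHull W, stLaw c.1 = pS ∧ (liftPoint W c).2.2.2 = r := by
  constructor
  · rintro ⟨m, p, q, hp, hpS, hq, rfl⟩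
    have hne : Nonempty (Fin m) := by
      by_contra hne
      have := not_nonempty_iff.1 hne
      simpa using hp.2
    set P : Fin m × X₂ × X₁ → ℝ := fun ω => p (ω.1, ω.2.1) * q ω.1 ω.2.1 ω.2.2
    have hP : P ∈ stdSimplex ℝ (Fin m × X₂ × X₁) := by
      refine ⟨fun ω => mul_nonneg (hp.1 _) ((hq _ _).1 _), ?_⟩
      simp only [P, Fintype.sum_prod_type, ← Finset.mul_sum, (hq _ _).2, mul_one]
      simpa only [Fintype.sum_prod_type] using hp.2
    obtain ⟨π, hπ, h⟩ := exists_kernel hP.1 Prod.snd Prod.fst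
    have hinj : Function.Injective fun ω : Fin m × X₂ × X₁ => (ω.2, ω.1) := fun a b h => by
      simp only [Prod.mk.injEq] at h; exact Prod.ext h.2 h.1
    have h' : ∀ u x₂ x₁, p (u, x₂) * q u x₂ x₁ = pr P Prod.fst u * π u (x₂, x₁) := fun u x₂ x₁ => by
      rw [← h]; exact (pr_of_injective P hinj (u, x₂, x₁)).symm
    have hb := pr_mem_stdSimplex hP (Prod.fst : _ → Fin m)
    refine ⟨_, innerPoint_mem hb hπ, ?_, (gpJointLaw_value hp hq hW hb hπ h').symm⟩
    ext x
    rw [innerPoint_fst, stLaw_sum, ← hpS]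
    refine Finset.sum_congr rfl fun u _ => ?_
    simp only [stLaw, Finset.mul_sum, ← h']
    rw [← Finset.mul_sum, (hq _ _).2, mul_one]
  · rintro ⟨c, hc, rfl, rfl⟩
    obtain ⟨m, b, π, hb, hπ, rfl⟩ := exists_innerPoint hc
    choose q hq hπq using fun u => exists_disintegration (hπ u)
    have hp : (fun ω : Fin m × X₂ => b ω.1 * stLaw (π ω.1) ω.2) ∈ stdSimplex ℝ (Fin m × X₂) := by
      refine ⟨fun ω => mul_nonneg (hb.1 _) ((stLaw_mem (hπ _)).1 _), ?_⟩
      simp only [Fintype.sum_prod_type, ← Finset.mul_sum, (stLaw_mem (hπ _)).2, mul_one, hb.2]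
    exact ⟨m, _, q, hp, fun x => by rw [innerPoint_fst, stLaw_sum], hq,
      (gpJointLaw_value hp hq hW hb hπ fun u x x₁ => by rw [hπq]; ring).symm⟩

end GP

/-- The greatest feasible objective for the largest state rate is the greatest value of the
classical formula for a uniform state. -/
theorem isGreatest_gpValues [Nonempty X₁] [Nonempty X₂]
    (hW : ∀ x₁ x₂, W x₁ x₂ ∈ stdSimplex ℝ Y₁) {z : (X₂ × X₁ → ℝ) × ℝ × ℝ × ℝ}
    (hz : z ∈ outerHull W) (hf : Feasible W (Real.logb 2 (Fintype.card X₂)) z)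
    (hmax : ∀ z' ∈ outerHull W, Feasible W (Real.logb 2 (Fintype.card X₂)) z' →
      z'.2.2.2 ≤ z.2.2.2) :
    IsGreatest (gpValues W fun _ => 1 / (Fintype.card X₂ : ℝ)) z.2.2.2 ∧
      ∃ c ∈ innerHull W, stLaw c.1 = (fun _ => 1 / (Fintype.card X₂ : ℝ)) ∧
        (liftPoint W c).2.2.2 = z.2.2.2 := by
  -- A constant V with uniform state is feasible at the largest rate, so classical values cannot
  -- exceed the maximum.
  have hlift : ∀ c ∈ innerHull W, stLaw c.1 = (fun _ => 1 / (Fintype.card X₂ : ℝ)) →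
      (liftPoint W c).2.2.2 ≤ z.2.2.2 := fun c hc hst => by
    have he : ent (stLaw c.1) = Real.logb 2 (Fintype.card X₂) := by
      rw [hst]; exact ent_const (by field_simp)
    exact hmax _ (liftPoint_mem hc) ⟨by simp [liftPoint, he], by simp [liftPoint, he]⟩
  have hc := merge_mem_innerHull hz
  have hst : stLaw z.1 = (fun _ => 1 / (Fintype.card X₂ : ℝ)) :=
    eq_uniform_of_logb_card_le_ent (stLaw_mem (outerHull_fst_mem hz)) hf.2
  -- Merging V into U adds I(V;Y₁) − I(V;X₂) to the objective. This is nonnegative by the first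
  -- constraint, as H(X₂) is at most log|X₂|.
  have heq : (liftPoint W (z.1, z.2.1 - z.2.2.1 - z.2.2.2)).2.2.2 = z.2.2.2 := by
    refine le_antisymm (hlift _ hc hst) ?_
    have h1 := hf.1
    have h2 := ent_le_logb_card (stLaw_mem (outerHull_fst_mem hz))
    simp only [liftPoint]
    linarith
  have hex : ∃ c ∈ innerHull W, stLaw c.1 = (fun _ => 1 / (Fintype.card X₂ : ℝ)) ∧
      (liftPoint W c).2.2.2 = z.2.2.2 := ⟨_, hc, hst, heq⟩
  refine ⟨⟨(mem_gpValues_iff hW).2 hex, fun r hr => ?_⟩, hex⟩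
  obtain ⟨c, hc, hst, rfl⟩ := (mem_gpValues_iff hW).1 hr
  exact hlift c hc hst

/-- A point that is feasible for every state rate. -/
theorem exists_feasible_logb_card [Nonempty X₁] [Nonempty X₂] (W : X₁ → X₂ → Y₁ → ℝ) :
    ∃ z ∈ outerHull W, Feasible W (Real.logb 2 (Fintype.card X₂)) z := by
  classical
  -- State and input are independent and uniform, with U and V constant.
  set π : X₂ × X₁ → ℝ := fun _ => 1 / ((Fintype.card X₂ : ℝ) * Fintype.card X₁)
  have hπ : π ∈ stdSimplex ℝ (X₂ × X₁) := ⟨fun _ => by positivity, by simp [π]; field_simp⟩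
  have hst : stLaw π = fun _ => 1 / (Fintype.card X₂ : ℝ) := by
    ext x; simp [stLaw, π]
  have he : ent (stLaw π) = Real.logb 2 (Fintype.card X₂) := by
    rw [hst]; exact ent_const (by field_simp)
  exact ⟨_, liftPoint_mem (subset_convexHull ℝ _ ⟨π, hπ, rfl⟩), by simp [liftPoint, he],
    by simp [liftPoint, he]⟩

theorem Feasible.mono {R R' : ℝ} (h : R ≤ R') {z : (X₂ × X₁ → ℝ) × ℝ × ℝ × ℝ}
    (hz : Feasible W R' z) : Feasible W R z :=
  ⟨h.trans hz.1, h.trans hz.2⟩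

end Values

/-! ### Sums against product weights -/

section Products

variable {ι β : Type*} [Fintype ι] [Fintype β] [DecidableEq ι] [DecidableEq β]

/-- Under a product weight, a coordinate is independent of what does not depend on it. -/
theorem sum_prod_mul_ite (f : ι → β → ℝ) (i : ι) (hf : ∑ b, f i b = 1) (F : (ι → β) → ℝ)
    (hF : ∀ y b, F (Function.update y i b) = F y) (b₀ : β) :
    ∑ y : ι → β, (∏ j, f j (y j)) * F y * (if y i = b₀ then 1 else 0) =
      f i b₀ * ∑ y : ι → β, (∏ j, f j (y j)) * F y := by
  -- Coordinate i is split off; `F` sees only the remaining coordinates, so its value at coordinate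
  -- i can be frozen at `b₀`.
  set e := Equiv.funSplitAt i β
  have hei : ∀ b g, e.symm (b, g) i = b := fun b g => by simp [e, Equiv.funSplitAt]
  have hej : ∀ b g (j : {j // j ≠ i}), e.symm (b, g) j = g j := fun b g j => by
    simp [e, Equiv.funSplitAt, j.2]
  have hp : ∀ b g, ∏ j, f j (e.symm (b, g) j) = f i b * ∏ j : {j // j ≠ i}, f j (g j) :=
    fun b g => by
      rw [Fintype.prod_eq_mul_prod_subtype_ne _ i, hei]
      simp only [hej]
  have hFe : ∀ b g, F (e.symm (b, g)) = F (e.symm (b₀, g)) := fun b g => by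
    rw [← hF (e.symm (b, g)) b₀]
    congr 1
    ext j
    by_cases hj : j = i
    · subst hj; simp [hei]
    · rw [Function.update_of_ne hj, hej b g ⟨j, hj⟩, hej b₀ g ⟨j, hj⟩]
  rw [← e.symm.sum_comp, ← e.symm.sum_comp, Fintype.sum_prod_type, Fintype.sum_prod_type]
  simp only [hei, hp, hFe]
  rw [Finset.sum_eq_single b₀ (by intro b _ hb; simp [hb]) (by simp)]
  simp only [if_true, mul_one, mul_assoc, ← Finset.mul_sum, ← Finset.sum_mul, hf, one_mul]

omit [DecidableEq β] in
theorem sum_prod_eq_one (f : ι → β → ℝ) (hf : ∀ i, ∑ b, f i b = 1) :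
    ∑ y : ι → β, ∏ j, f j (y j) = 1 := by
  rw [← Fintype.prod_sum]
  simp [hf]

end Products

/-! ### Fano's inequality and subadditivity of entropy -/

section Inequalities

variable {Ω α β : Type*} [Fintype Ω] [Fintype α] [Fintype β] {P : Ω → ℝ}

/-- Fano's inequality. -/
theorem condEntropy_le_fano {M : ℕ} (hP : P ∈ stdSimplex ℝ Ω) (U : Ω → Fin M) (Y : Ω → β)
    (g : β → Fin M) :
    condEntropy P U Y ≤ 1 + (∑ ω with g (Y ω) ≠ U ω, P ω) * Real.logb 2 M := by
  have hM : 0 < M := by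
    rcases M.eq_zero_or_pos with rfl | h
    · have : IsEmpty Ω := ⟨fun ω => (U ω).elim0⟩
      simpa using hP.2
    · exact h
  have hM' : (0 : ℝ) < M := by exact_mod_cast hM
  -- The comparison kernel for Gibbs' inequality: half its mass on the decoded message, half spread
  -- uniformly. It costs at most one bit when decoding is right and 1 + log M bits otherwise.
  set r : Fin M × β → ℝ := fun a => (if g a.2 = a.1 then 1 / 2 else 0) + 1 / (2 * M)
  have hr : ∀ a, 0 < r a := fun a => by
    simp only [r]; split_ifs <;> positivity
  have hr1 : ∀ y, ∑ w, r (w, y) = 1 := fun y => by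
    simp only [r, Finset.sum_add_distrib, Finset.sum_ite_eq, Finset.mem_univ, if_true,
      Finset.sum_const, Finset.card_univ, Fintype.card_fin, nsmul_eq_mul]
    field_simp
    norm_num
  have hpos := pr_nonneg hP.1 (fun ω => (U ω, Y ω))
  have hcross := ent_le_cross (p := pr P fun ω => (U ω, Y ω)) (q := fun a => pr P Y a.2 * r a)
    hpos (pr_mem_stdSimplex hP _).2 (fun a => mul_nonneg (pr_nonneg hP.1 _ _) (hr a).le)
    (by
      rw [Fintype.sum_prod_type_right]
      simp only [← Finset.mul_sum, hr1, mul_one, (pr_mem_stdSimplex hP Y).2, le_refl])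
    (fun a ha => by
      refine mul_ne_zero (fun h0 => ha ?_) (hr a).ne'
      have : pr P Y a.2 = ∑ w, pr P (fun ω => (U ω, Y ω)) (w, a.2) := by
        rw [pr_eq_sum_pair P Y U]
        exact Finset.sum_congr rfl fun x _ => pr_congr fun ω => by
          simp only [Prod.mk.injEq]; tauto
      rw [this] at h0
      exact (Finset.sum_eq_zero_iff_of_nonneg fun x _ => hpos _).1 h0 a.1 (Finset.mem_univ _))
  rw [sum_pr_mul P (fun ω => (U ω, Y ω)) fun a => Real.logb 2 (pr P Y a.2 * r a)] at hcross
  rw [condEntropy_eq_sub hP.1, entropy_eq_ent P fun ω => (U ω, Y ω), entropy_eq_sum P Y]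
  have hlog : 0 ≤ Real.logb 2 (M : ℝ) := Real.logb_nonneg one_lt_two (by exact_mod_cast hM)
  have key : ∀ ω, -(P ω * Real.logb 2 (pr P Y (Y ω) * r (U ω, Y ω))) ≤
      -(P ω * Real.logb 2 (pr P Y (Y ω))) + P ω +
        (if g (Y ω) ≠ U ω then P ω else 0) * Real.logb 2 M := fun ω => by
    rcases eq_or_ne (P ω) 0 with h | h
    · simp [h]
    have hPω := lt_of_le_of_ne (hP.1 ω) h.symm
    rw [Real.logb_mul (pr_pos hP.1 h _).ne' (hr _).ne']
    have hlr : -Real.logb 2 (r (U ω, Y ω)) ≤ 1 + if g (Y ω) ≠ U ω then Real.logb 2 M else 0 := by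
      by_cases hg : g (Y ω) = U ω
      · have h2 : Real.logb 2 (1 / 2 : ℝ) ≤ Real.logb 2 (r (U ω, Y ω)) :=
          Real.logb_le_logb_of_le one_lt_two (by norm_num) (by simp only [r, hg, if_true]
                                                               linarith [show (0 : ℝ) < 1 / (2 * M) by positivity])
        rw [one_div, Real.logb_inv, Real.logb_self_eq_one one_lt_two] at h2
        simp [hg]; linarith
      · have : r (U ω, Y ω) = (2 * M : ℝ)⁻¹ := by simp [r, hg]
        rw [this, Real.logb_inv, Real.logb_mul two_ne_zero hM'.ne',
          Real.logb_self_eq_one one_lt_two]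
        simp [hg]
    have := mul_le_mul_of_nonneg_left hlr hPω.le
    split_ifs at this ⊢ <;> linarith
  have hsum := Finset.sum_le_sum fun ω (_ : ω ∈ Finset.univ) => key ω
  simp only [Finset.sum_add_distrib, Finset.sum_neg_distrib, hP.2, ← Finset.sum_mul,
    ← Finset.sum_filter] at hsum
  linarith

/-- Gibbs' inequality against the product of the marginals: that cross entropy is the sum of the
marginal entropies. -/
theorem entropy_pi_le {ι : Type*} [Fintype ι] [DecidableEq ι] (hP : P ∈ stdSimplex ℝ Ω)
    (X : ι → Ω → α) :
    entropy P (fun ω i => X i ω) ≤ ∑ i, entropy P (X i) := by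
  have hcross := ent_le_cross (p := pr P fun ω i => X i ω) (q := fun a => ∏ i, pr P (X i) (a i))
    (pr_nonneg hP.1 _) (pr_mem_stdSimplex hP _).2
    (fun a => Finset.prod_nonneg fun i _ => pr_nonneg hP.1 _ _)
    (sum_prod_eq_one _ fun i => (pr_mem_stdSimplex hP (X i)).2).le
    (fun a ha => by
      refine Finset.prod_ne_zero_iff.2 fun i _ h0 => ha ?_
      rw [pr, Finset.sum_eq_zero_iff_of_nonneg fun ω _ => hP.1 ω] at h0
      exact Finset.sum_eq_zero fun ω hω => h0 ω (by simp at hω ⊢; rw [← hω]))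
  rw [entropy_eq_ent]
  refine hcross.trans (le_of_eq ?_)
  rw [sum_pr_mul P (fun ω i => X i ω) fun a => Real.logb 2 (∏ i, pr P (X i) (a i))]
  simp only [entropy_eq_sum, Finset.sum_neg_distrib]
  rw [Finset.sum_comm]
  congr 1
  refine Finset.sum_congr rfl fun ω _ => ?_
  rcases eq_or_ne (P ω) 0 with h | h
  · simp [h]
  rw [← Finset.mul_sum]
  congr 1
  simp only [Real.logb, ← Finset.sum_div]
  rw [Real.log_prod fun i _ => (pr_pos hP.1 h _).ne']

end Inequalities

/-! ### The converse: Csiszár's sum identity by telescoping -/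

section Converse

variable {X₁ X₂ Y₁ : Type*} [Fintype X₁] [Fintype X₂] [Fintype Y₁] {n M N : ℕ}

/-- The joint law of message, state sequence and output sequence of a code. -/
def Code.law (c : Code X₁ X₂ Y₁ n M N) (W : X₁ → X₂ → Y₁ → ℝ) :
    Fin M × c.states × (Fin n → Y₁) → ℝ :=
  fun ω => 1 / ((M : ℝ) * N) * ∏ i, W (c.enc ω.1 ω.2.1 i) (ω.2.1.1 i) (ω.2.2 i)

variable {W : X₁ → X₂ → Y₁ → ℝ} (hW : ∀ x₁ x₂, W x₁ x₂ ∈ stdSimplex ℝ Y₁)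
  (c : Code X₁ X₂ Y₁ n M N)

theorem Code.errorProb_eq_sum (W : X₁ → X₂ → Y₁ → ℝ) :
    c.errorProb W = ∑ ω with c.dec ω.2.2 ≠ ω.1, c.law W ω := by
  simp only [Code.errorProb, Finset.sum_filter, Fintype.sum_prod_type, Code.law, Finset.mul_sum,
    mul_ite, mul_zero]

theorem Code.card_states_coe : Fintype.card c.states = N := by
  simpa using c.card_states

include hW

/-- Summing the memoryless channel over all outputs gives 1, so message and state keep their uniform
joint law. -/
theorem Code.pr_message_state (w : Fin M) (s : c.states) :
    pr (c.law W) (fun ω => (ω.1, ω.2.1)) (w, s) = 1 / ((M : ℝ) * N) := by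
  classical
  rw [pr, Finset.sum_filter, Fintype.sum_prod_type, Finset.sum_eq_single w, Fintype.sum_prod_type,
    Finset.sum_eq_single s]
  · simp only [if_true, Code.law, ← Finset.mul_sum]
    rw [sum_prod_eq_one _ fun i => (hW _ _).2, mul_one]
  · intro s' _ h; simp [h]
  · simp
  · intro w' _ h; simp [h]
  · simp

theorem Code.law_mem (hM : 0 < M) (hN : 0 < N) :
    c.law W ∈ stdSimplex ℝ (Fin M × c.states × (Fin n → Y₁)) := by
  have hM' : (0 : ℝ) < M := by exact_mod_cast hM
  have hN' : (0 : ℝ) < N := by exact_mod_cast hN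
  refine ⟨fun ω => mul_nonneg (by positivity) (Finset.prod_nonneg fun i _ => (hW _ _).1 _), ?_⟩
  simp only [Fintype.sum_prod_type, Code.law, ← Finset.mul_sum]
  simp only [sum_prod_eq_one _ fun i => (hW _ _).2, Finset.sum_const, Finset.card_univ,
    c.card_states_coe, Fintype.card_fin, nsmul_eq_mul]
  field_simp

theorem Code.entropy_message_state (hM : 0 < M) (hN : 0 < N) :
    entropy (c.law W) (fun ω => (ω.1, ω.2.1)) = Real.logb 2 M + Real.logb 2 N := by
  have hM' : (0 : ℝ) < M := by exact_mod_cast hM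
  have hN' : (0 : ℝ) < N := by exact_mod_cast hN
  have hcard : Fintype.card (Fin M × c.states) = M * N := by
    rw [Fintype.card_prod, c.card_states_coe, Fintype.card_fin]
  have : pr (c.law W) (fun ω => (ω.1, ω.2.1)) = fun _ => 1 / ((M : ℝ) * N) := by
    ext a; exact c.pr_message_state hW a.1 a.2
  rw [entropy_eq_ent, this, ent_const (by rw [hcard]; push_cast; field_simp), hcard]
  push_cast
  exact Real.logb_mul hM'.ne' hN'.ne'

theorem Code.entropy_state (hM : 0 < M) (hN : 0 < N) :
    entropy (c.law W) (fun ω => ω.2.1) = Real.logb 2 N := by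
  have hM' : (0 : ℝ) < M := by exact_mod_cast hM
  have hN' : (0 : ℝ) < N := by exact_mod_cast hN
  have : pr (c.law W) (fun ω => ω.2.1) = fun _ => 1 / (N : ℝ) := by
    ext s
    rw [pr_eq_sum_pair _ _ fun ω => ω.1]
    calc _ = ∑ _w : Fin M, 1 / ((M : ℝ) * N) := Finset.sum_congr rfl fun w _ => by
          rw [← c.pr_message_state hW w s]
          exact pr_congr fun ω => by simp only [Prod.mk.injEq]; tauto
      _ = _ := by simp; field_simp
  rw [entropy_eq_ent, this, ent_const (by rw [c.card_states_coe]; field_simp), c.card_states_coe]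

omit hW

/-- The outputs before time `i` and the states from time `i` on. -/
def Code.hybrid (i : ℕ) (ω : Fin M × c.states × (Fin n → Y₁)) : Fin n → Y₁ ⊕ X₂ :=
  fun j => if (j : ℕ) < i then Sum.inl (ω.2.2 j) else Sum.inr (ω.2.1.1 j)

/-- The outputs before time `i` and the states after time `i`. -/
def Code.aux (i : Fin n) (ω : Fin M × c.states × (Fin n → Y₁)) : Fin n → Option (Y₁ ⊕ X₂) :=
  fun j => if j < i then some (Sum.inl (ω.2.2 j)) else if j = i then none
    else some (Sum.inr (ω.2.1.1 j))

/-- State and input at time `i`. -/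
def Code.stateInput (i : Fin n) (ω : Fin M × c.states × (Fin n → Y₁)) : X₂ × X₁ :=
  (ω.2.1.1 i, c.enc ω.1 ω.2.1 i)

variable {c}

theorem Code.hybrid_eq_iff {i : ℕ} {ω ω' : Fin M × c.states × (Fin n → Y₁)} :
    c.hybrid i ω = c.hybrid i ω' ↔ (∀ j : Fin n, (j : ℕ) < i → ω.2.2 j = ω'.2.2 j) ∧
      ∀ j : Fin n, i ≤ j → ω.2.1.1 j = ω'.2.1.1 j := by
  simp only [funext_iff, Code.hybrid]
  rw [← forall_and]
  refine forall_congr' fun j => ?_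
  by_cases h : (j : ℕ) < i
  · simp [h]
  · simp [h, not_lt.1 h]

theorem Code.aux_eq_iff {i : Fin n} {ω ω' : Fin M × c.states × (Fin n → Y₁)} :
    c.aux i ω = c.aux i ω' ↔ (∀ j : Fin n, (j : ℕ) < i → ω.2.2 j = ω'.2.2 j) ∧
      ∀ j : Fin n, (i : ℕ) + 1 ≤ j → ω.2.1.1 j = ω'.2.1.1 j := by
  simp only [funext_iff, Code.aux]
  rw [← forall_and]
  refine forall_congr' fun j => ?_
  rcases lt_trichotomy j i with h | h | h
  · have h2 : (j : ℕ) < i := h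
    simp only [h, h2, if_true, Option.some.injEq, Sum.inl.injEq, forall_true_left, iff_self_and]
    exact fun _ hj => absurd hj (by omega)
  · simp [h]
  · have h2 : (i : ℕ) < j := h
    simp [h.ne', not_lt.2 h.le, h2]

/-- With `Code.state_aux_iff`, this is the reason for telescoping: adjoining the output at time i to
V_i gives the hybrid i + 1, adjoining the state gives the hybrid i. -/
theorem Code.output_aux_iff {i : Fin n} {ω ω' : Fin M × c.states × (Fin n → Y₁)} :
    ω.2.2 i = ω'.2.2 i ∧ c.aux i ω = c.aux i ω' ↔ c.hybrid (i + 1) ω = c.hybrid (i + 1) ω' := by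
  rw [Code.hybrid_eq_iff, Code.aux_eq_iff]
  constructor
  · rintro ⟨h, h1, h2⟩
    refine ⟨fun j hj => ?_, h2⟩
    rcases (Nat.lt_succ_iff_lt_or_eq.1 hj) with hj | hj
    · exact h1 j hj
    · rw [Fin.ext hj]; exact h
  · rintro ⟨h1, h2⟩
    exact ⟨h1 i (Nat.lt_succ_self _), fun j hj => h1 j (by omega), h2⟩

theorem Code.state_aux_iff {i : Fin n} {ω ω' : Fin M × c.states × (Fin n → Y₁)} :
    ω.2.1.1 i = ω'.2.1.1 i ∧ c.aux i ω = c.aux i ω' ↔ c.hybrid i ω = c.hybrid i ω' := by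
  rw [Code.hybrid_eq_iff, Code.aux_eq_iff]
  constructor
  · rintro ⟨h, h1, h2⟩
    refine ⟨h1, fun j hj => ?_⟩
    rcases hj.eq_or_lt with hj | hj
    · rw [← Fin.ext hj]; exact h
    · exact h2 j hj
  · rintro ⟨h1, h2⟩
    exact ⟨h2 i le_rfl, h1, fun j hj => h2 j (by omega)⟩

variable (c)
include hW

/-- The auxiliary, the message, the state and the input at time i do not involve the output at time
i, and without feedback the other outputs are independent of it given message and states. So that
output can be summed separately. -/
theorem Code.pr_channel (i : Fin n) (v : Fin n → Option (Y₁ ⊕ X₂)) (u : Fin M) (z : X₂ × X₁)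
    (y : Y₁) :
    pr (c.law W) (fun ω => (c.aux i ω, ω.1, c.stateInput i ω, ω.2.2 i)) (v, u, z, y) =
      pr (c.law W) (fun ω => (c.aux i ω, ω.1, c.stateInput i ω)) (v, u, z) * W z.2 z.1 y := by
  classical
  rw [pr_eq_sum_ite, pr_eq_sum_ite]
  simp only [Fintype.sum_prod_type, Finset.sum_mul]
  refine Finset.sum_congr rfl fun w _ => Finset.sum_congr rfl fun s _ => ?_
  -- For fixed message and states, the event is a function of the output sequence that does not
  -- change when coordinate i is altered.
  set F : (Fin n → Y₁) → ℝ := fun y =>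
    if (c.aux i (w, s, y), w, c.stateInput i (w, s, y)) = (v, u, z) then 1 else 0
  have hF : ∀ y b, F (Function.update y i b) = F y := fun y b => by
    have : c.aux i (w, s, Function.update y i b) = c.aux i (w, s, y) := by
      rw [Code.aux_eq_iff]
      exact ⟨fun j hj => Function.update_of_ne (by rintro rfl; omega) _ _, fun j hj => rfl⟩
    simp only [F, this]
    rfl
  have := sum_prod_mul_ite (fun j => W (c.enc w s j) (s.1 j)) i (hW _ _).2 F hF y
  have h1 : ∀ y', (if (c.aux i (w, s, y'), w, c.stateInput i (w, s, y'), y' i) = (v, u, z, y)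
      then c.law W (w, s, y') else 0) = 1 / ((M : ℝ) * N) *
      ((∏ j, W (c.enc w s j) (s.1 j) (y' j)) * F y' * if y' i = y then 1 else 0) := fun y' => by
    have h4 : (c.aux i (w, s, y'), w, c.stateInput i (w, s, y'), y' i) = (v, u, z, y) ↔
        (c.aux i (w, s, y'), w, c.stateInput i (w, s, y')) = (v, u, z) ∧ y' i = y := by
      simp only [Prod.mk.injEq]; tauto
    simp only [F, h4, Code.law]
    by_cases h5 : (c.aux i (w, s, y'), w, c.stateInput i (w, s, y')) = (v, u, z)
    · by_cases h6 : y' i = y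
      · simp only [h5, h6, and_self, if_true, mul_one]
      · simp only [h6, and_false, if_false, mul_zero]
    · simp only [h5, false_and, if_false, mul_zero, zero_mul]
  have h2 : ∀ y', (if (c.aux i (w, s, y'), w, c.stateInput i (w, s, y')) = (v, u, z)
      then c.law W (w, s, y') else 0) * W z.2 z.1 y = 1 / ((M : ℝ) * N) *
      (W (c.enc w s i) (s.1 i) y * ((∏ j, W (c.enc w s j) (s.1 j) (y' j)) * F y')) := fun y' => by
    simp only [F, Code.law]
    split_ifs with h
    · simp only [Prod.mk.injEq, Code.stateInput] at h
      rw [← h.2.2]; ring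
    · simp
  simp only [h1, h2, ← Finset.mul_sum, this]

/-- The single-letter bound given by one code. -/
theorem Code.exists_point [Nonempty X₁] [Nonempty X₂] (hn : 0 < n) (hM : 0 < M) (hN : 0 < N) :
    ∃ z ∈ outerHull W, Feasible W (Real.logb 2 N / n) z ∧
      (Real.logb 2 M - (1 + c.errorProb W * Real.logb 2 M)) / n ≤ z.2.2.2 := by
  have hP := c.law_mem hW hM hN
  have hn' : (0 : ℝ) < n := by exact_mod_cast hn
  set P := c.law W
  -- The point of time i, with V = `c.aux i` and U the message; every quantity is a difference
  -- between consecutive hybrids.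
  have hpt : ∀ i : Fin n, ∃ z ∈ outerHull W,
      z.2.2.1 - z.2.1 + ent (outLaw W z.1) =
        entropy P (c.hybrid i) - entropy P (c.hybrid (i + 1)) + entropy P (fun ω => ω.2.2 i) ∧
      ent (stLaw z.1) = entropy P (fun ω => ω.2.1.1 i) ∧
      z.2.2.2 = (entropy P (c.hybrid (i + 1)) - entropy P (c.hybrid i)) -
        (entropy P (fun ω => (ω.1, c.hybrid (i + 1) ω)) -
          entropy P (fun ω => (ω.1, c.hybrid i ω))) := fun i => by
    obtain ⟨b, π, hb, hπ, h⟩ := exists_ensemble_of_law hP (c.aux i) (fun ω => ω.1)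
      (c.stateInput i) (fun ω => ω.2.2 i) (c.pr_channel hW i)
    obtain ⟨-, h1, h2, h3, h4, h5⟩ := ensPoint_of_law hP hW hb hπ _ _ _ _ h
    refine ⟨_, ensPoint_mem (pr_mem_stdSimplex hP _) hb hπ, ?_, h5.symm, ?_⟩
    · rw [← h1, ← h2, ← h4, condEntropy_eq_sub hP.1, condEntropy_eq_sub hP.1,
        entropy_congr (X := fun ω => (ω.2.2 i, c.aux i ω)) (Y := c.hybrid (i + 1))
          (by intro ω ω'; rw [Prod.mk.injEq]; exact Code.output_aux_iff),
        entropy_congr (X := fun ω => ((c.stateInput i ω).1, c.aux i ω)) (Y := c.hybrid i)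
          (by intro ω ω'; rw [Prod.mk.injEq]; exact Code.state_aux_iff)]
      ring
    · rw [← h3, condMutualInfo_eq hP.1, condMutualInfo_eq hP.1, condEntropy_eq_sub hP.1,
        condEntropy_eq_sub hP.1, condEntropy_eq_sub hP.1, condEntropy_eq_sub hP.1,
        entropy_congr (X := fun ω => (ω.2.2 i, c.aux i ω)) (Y := c.hybrid (i + 1))
          (by intro ω ω'; rw [Prod.mk.injEq]; exact Code.output_aux_iff),
        entropy_congr (X := fun ω => ((c.stateInput i ω).1, c.aux i ω)) (Y := c.hybrid i)
          (by intro ω ω'; rw [Prod.mk.injEq]; exact Code.state_aux_iff),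
        entropy_congr (X := fun ω => (ω.2.2 i, ω.1, c.aux i ω))
          (Y := fun ω => (ω.1, c.hybrid (i + 1) ω))
          (by intro ω ω'; simp only [Prod.mk.injEq]; rw [← Code.output_aux_iff]; tauto),
        entropy_congr (X := fun ω => ((c.stateInput i ω).1, ω.1, c.aux i ω))
          (Y := fun ω => (ω.1, c.hybrid i ω))
          (by intro ω ω'; simp only [Prod.mk.injEq]; rw [← Code.state_aux_iff]
              simp only [Code.stateInput]; tauto)]
      ring
  choose z hz hz1 hz2 hz3 using hpt
  have htel : ∀ f : ℕ → ℝ, ∑ i : Fin n, (f (i + 1) - f i) = f n - f 0 := fun f => by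
    rw [Fin.sum_univ_eq_sum_range fun i => f (i + 1) - f i]; exact Finset.sum_range_sub f n
  have hstate : ∀ ω ω' : Fin M × c.states × (Fin n → Y₁),
      c.hybrid 0 ω = c.hybrid 0 ω' ↔ ω.2.1 = ω'.2.1 := fun ω ω' => by
    rw [Code.hybrid_eq_iff, Subtype.ext_iff, funext_iff]; simp
  have hout : ∀ ω ω' : Fin M × c.states × (Fin n → Y₁),
      c.hybrid n ω = c.hybrid n ω' ↔ ω.2.2 = ω'.2.2 := fun ω ω' => by
    rw [Code.hybrid_eq_iff, funext_iff]
    exact ⟨fun h j => h.1 j j.2, fun h => ⟨fun j _ => h j, fun j hj => absurd j.2 (not_lt.2 hj)⟩⟩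
  have hH0 : entropy P (c.hybrid 0) = Real.logb 2 N := by
    rw [← c.entropy_state hW hM hN]; exact entropy_congr hstate
  have hHn : entropy P (c.hybrid n) = entropy P fun ω => ω.2.2 := entropy_congr hout
  have hK0 : entropy P (fun ω => (ω.1, c.hybrid 0 ω)) = Real.logb 2 M + Real.logb 2 N := by
    rw [← c.entropy_message_state hW hM hN]
    exact entropy_congr fun ω ω' => by simp only [Prod.mk.injEq, hstate]
  have hKn : entropy P (fun ω => (ω.1, c.hybrid n ω)) = entropy P fun ω => (ω.1, ω.2.2) :=
    entropy_congr fun ω ω' => by simp only [Prod.mk.injEq, hout]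
  have hw : (fun _ : Fin n => 1 / (n : ℝ)) ∈ stdSimplex ℝ (Fin n) :=
    ⟨fun _ => by positivity, by simp [hn'.ne']⟩
  -- The average over time stays in the hull, which takes the place of a time-sharing variable.
  refine ⟨∑ i, (1 / (n : ℝ)) • z i, (convex_convexHull ℝ _).sum_mem (fun i _ => hw.1 i) hw.2
    fun i _ => hz i, feasible_sum hw hz hW ?_ ?_, ?_⟩
  · simp only [hz1, ← Finset.mul_sum, Finset.sum_add_distrib]
    have h1 := htel fun i => -entropy P (c.hybrid i)
    have h2 := entropy_pi_le hP fun i ω => ω.2.2 i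
    simp only [neg_sub_neg] at h1
    rw [h1, one_div, inv_mul_eq_div, hH0, hHn]
    refine div_le_div_of_nonneg_right ?_ hn'.le
    linarith
  · simp only [hz2, ← Finset.mul_sum]
    rw [one_div, inv_mul_eq_div, ← hH0]
    refine div_le_div_of_nonneg_right ?_ hn'.le
    refine (le_of_eq ?_).trans (entropy_pi_le hP fun i ω => ω.2.1.1 i)
    exact entropy_congr fun ω ω' => by rw [hstate, Subtype.ext_iff]
  · have h1 := htel fun i => entropy P (c.hybrid i)
    have h2 := htel fun i => entropy P (fun ω => (ω.1, c.hybrid i ω))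
    have hfano := condEntropy_le_fano hP (fun ω => ω.1) (fun ω => ω.2.2) c.dec
    rw [← c.errorProb_eq_sum, condEntropy_eq_sub hP.1] at hfano
    simp only [Prod.snd_sum, Prod.smul_snd, smul_eq_mul, ← Finset.mul_sum, hz3]
    rw [Finset.sum_sub_distrib, h1, h2, one_div, inv_mul_eq_div, hH0, hHn, hK0, hKn]
    refine div_le_div_of_nonneg_right ?_ hn'.le
    linarith

omit c

/-- The converse: an achievable rate is approximated by feasible objectives. -/
theorem exists_point_of_achievable [Nonempty X₁] [Nonempty X₂] {R₂ R₁ : ℝ}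
    (h : Achievable W R₂ R₁) {ε : ℝ} (hε : 0 < ε) :
    ∃ z ∈ outerHull W, Feasible W R₂ z ∧ R₁ - ε ≤ z.2.2.2 := by
  obtain ⟨hR₁, c, hc⟩ := h
  have hlim : Tendsto (fun n : ℕ => (c n).errorProb W * R₁ + 1 / (n : ℝ)) atTop (𝓝 0) := by
    simpa using (hc.mul_const R₁).add tendsto_one_div_atTop_nhds_zero_nat
  -- One block length suffices. An error below 1 makes the factor 1 − P_e of log M positive, so that
  -- log M ≥ n R₁ may be inserted.
  obtain ⟨n, hn, hn1, hn0⟩ := ((hlim.eventually_lt_const hε).and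
    ((hc.eventually_lt_const one_pos).and (eventually_gt_atTop 0))).exists
  have hn' : (0 : ℝ) < n := by exact_mod_cast hn0
  have hceil : ∀ R : ℝ, 0 < ⌈(2 : ℝ) ^ ((n : ℝ) * R)⌉₊ ∧
      n * R ≤ Real.logb 2 (⌈(2 : ℝ) ^ ((n : ℝ) * R)⌉₊ : ℝ) := fun R => by
    have hp : (0 : ℝ) < 2 ^ ((n : ℝ) * R) := by positivity
    have hc := Nat.ceil_pos.2 hp
    refine ⟨hc, (Real.le_logb_iff_rpow_le one_lt_two (by exact_mod_cast hc)).2 (Nat.le_ceil _)⟩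
  obtain ⟨z, hz, hf, ho⟩ := (c n).exists_point hW hn0 (hceil R₁).1 (hceil R₂).1
  refine ⟨z, hz, hf.mono ?_, le_trans ?_ ho⟩
  · rw [le_div_iff₀ hn', mul_comm]; exact (hceil R₂).2
  · rw [le_div_iff₀ hn']
    have h1 := mul_le_mul_of_nonneg_left (hceil R₁).2 (sub_pos.2 hn1).le
    have h2 := mul_lt_mul_of_pos_right hn hn'
    rw [add_mul, one_div, inv_mul_cancel₀ hn'.ne'] at h2
    linarith

end Converse

/-! ### Averages and moments under independent sampling -/

section Mean

variable {α β ι : Type*} [Fintype α] [Fintype β] [Fintype ι]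

/-- The average of `f` with weights `p`. -/
def mean (p f : α → ℝ) : ℝ := ∑ x, p x * f x

theorem mean_mono {p f g : α → ℝ} (hp : ∀ x, 0 ≤ p x) (h : ∀ x, f x ≤ g x) :
    mean p f ≤ mean p g :=
  Finset.sum_le_sum fun x _ => mul_le_mul_of_nonneg_left (h x) (hp x)

theorem mean_nonneg {p f : α → ℝ} (hp : ∀ x, 0 ≤ p x) (h : ∀ x, 0 ≤ f x) : 0 ≤ mean p f :=
  Finset.sum_nonneg fun x _ => mul_nonneg (hp x) (h x)

theorem mean_add (p f g : α → ℝ) : mean p (fun x => f x + g x) = mean p f + mean p g := by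
  simp [mean, mul_add, Finset.sum_add_distrib]

theorem mean_sub (p f g : α → ℝ) : mean p (fun x => f x - g x) = mean p f - mean p g := by
  simp [mean, mul_sub, Finset.sum_sub_distrib]

theorem mean_const_mul (p f : α → ℝ) (c : ℝ) : mean p (fun x => c * f x) = c * mean p f := by
  simp only [mean, Finset.mul_sum]
  exact Finset.sum_congr rfl fun x _ => by ring

theorem mean_mul_const (p f : α → ℝ) (c : ℝ) : mean p (fun x => f x * c) = mean p f * c := by
  simp only [mean, Finset.sum_mul, mul_assoc]

theorem mean_const {p : α → ℝ} (hp : ∑ x, p x = 1) (c : ℝ) : mean p (fun _ => c) = c := by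
  simp [mean, ← Finset.sum_mul, hp]

theorem mean_sum (p : α → ℝ) {κ : Type*} (s : Finset κ) (f : κ → α → ℝ) :
    mean p (fun x => ∑ i ∈ s, f i x) = ∑ i ∈ s, mean p (f i) := by
  simp only [mean, Finset.mul_sum]
  exact Finset.sum_comm

theorem mean_comm (p : α → ℝ) (q : β → ℝ) (f : α → β → ℝ) :
    mean p (fun x => mean q (f x)) = mean q fun y => mean p fun x => f x y := by
  simp only [mean, Finset.mul_sum]
  rw [Finset.sum_comm]
  exact Finset.sum_congr rfl fun _ _ => Finset.sum_congr rfl fun _ _ => by ring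

theorem exists_le_of_mean_le {p f : α → ℝ} (hp : p ∈ stdSimplex ℝ α) {r : ℝ} (h : mean p f ≤ r) :
    ∃ x, f x ≤ r := by
  by_contra! hlt
  have hne : ∃ x, 0 < p x := by
    by_contra! h0
    have : ∑ x, p x ≤ 0 := Finset.sum_nonpos fun x _ => h0 x
    linarith [hp.2]
  obtain ⟨x₀, hx₀⟩ := hne
  have : ∑ x, p x * r < ∑ x, p x * f x :=
    Finset.sum_lt_sum (fun x _ => mul_le_mul_of_nonneg_left (hlt x).le (hp.1 x))
      ⟨x₀, Finset.mem_univ _, mul_lt_mul_of_pos_left (hlt x₀) hx₀⟩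
  rw [← Finset.sum_mul, hp.2, one_mul] at this
  exact absurd h (not_le.2 this)

/-- The weights of independent samples. -/
def iidWeight (p : α → ℝ) : (ι → α) → ℝ := fun c => ∏ i, p (c i)

variable [DecidableEq ι]

theorem iidWeight_mem {p : α → ℝ} (hp : p ∈ stdSimplex ℝ α) :
    (iidWeight p : (ι → α) → ℝ) ∈ stdSimplex ℝ (ι → α) :=
  ⟨fun _ => Finset.prod_nonneg fun _ _ => hp.1 _, sum_prod_eq_one (fun _ => p) fun _ => hp.2⟩

/-- The sample `c i` is independent of anything that does not look at coordinate i, so it can be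
averaged after the others. -/
theorem mean_iidWeight_split {p : α → ℝ} (hp : ∑ x, p x = 1) (i : ι) (F : α → (ι → α) → ℝ)
    (hF : ∀ a c a', F a (Function.update c i a') = F a c) :
    mean (iidWeight p) (fun c : ι → α => F (c i) c) =
      mean p fun a => mean (iidWeight p) (F a) := by
  classical
  have h : ∀ c : ι → α, F (c i) c = ∑ a, F a c * if c i = a then 1 else 0 := fun c => by simp
  simp only [h, mean_sum]
  refine Finset.sum_congr rfl fun a _ => ?_
  refine Eq.trans ?_ (sum_prod_mul_ite (fun _ => p) i hp (F a) (hF a) a)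
  exact Finset.sum_congr rfl fun c _ => (mul_assoc _ _ _).symm

theorem mean_iidWeight_one {p : α → ℝ} (hp : p ∈ stdSimplex ℝ α) (i : ι) (f : α → ℝ) :
    mean (iidWeight p) (fun c : ι → α => f (c i)) = mean p f := by
  rw [mean_iidWeight_split hp.2 i (fun a _ => f a) fun _ _ _ => rfl]
  simp only [mean_const (iidWeight_mem hp).2]

theorem mean_iidWeight_two {p : α → ℝ} (hp : p ∈ stdSimplex ℝ α) {i j : ι} (hij : i ≠ j)
    (f : α → α → ℝ) :
    mean (iidWeight p) (fun c : ι → α => f (c i) (c j)) = mean p fun a => mean p fun b => f a b := by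
  rw [mean_iidWeight_split hp.2 i (fun a c => f a (c j)) fun _ _ _ => by
    simp [Function.update_of_ne hij.symm]]
  simp only [mean_iidWeight_one hp]

/-- The second moment of a sum of independent centered variables. -/
theorem mean_iidWeight_sq {p : α → ℝ} (hp : p ∈ stdSimplex ℝ α) {z : α → ℝ} (hz : mean p z = 0)
    {κ : Type*} [Fintype κ] {e : κ → ι} (he : Function.Injective e) :
    mean (iidWeight p) (fun c : ι → α => (∑ k, z (c (e k))) ^ 2) =
      Fintype.card κ * mean p fun a => z a ^ 2 := by
  classical
  have h : ∀ c : ι → α, (∑ k, z (c (e k))) ^ 2 = ∑ k, ∑ l, z (c (e k)) * z (c (e l)) := fun c => by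
    rw [sq, Finset.sum_mul_sum]
  simp only [h, mean_sum]
  have hk : ∀ k, ∑ l, mean (iidWeight p) (fun c : ι → α => z (c (e k)) * z (c (e l))) =
      mean p fun a => z a ^ 2 := fun k => by
    rw [Finset.sum_eq_single k]
    · rw [mean_iidWeight_one hp (e k) fun a => z a * z a]
      simp only [sq]
    · intro l _ hl
      rw [mean_iidWeight_two hp (he.ne hl.symm) fun a b => z a * z b]
      simp only [mean_const_mul, hz, mul_zero, mean_const hp.2]
    · simp
  simp [hk]

end Mean

/-! ### The random codebook: packing, soft covering, atoms of the mixture -/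

section Random

variable {A B X Y κ : Type*} [Fintype A] [Fintype B] [Fintype X] [Fintype Y] [Fintype κ]
  [DecidableEq κ]

/-- The weights of a random cloud: a center `v` and independent satellites given `v`. -/
def cloudWeight (a : A → ℝ) (b : A → B → ℝ) : A × (κ → B) → ℝ :=
  fun z => a z.1 * iidWeight (b z.1) z.2

variable {a : A → ℝ} {b : A → B → ℝ}

theorem mean_cloudWeight (f : A × (κ → B) → ℝ) :
    mean (cloudWeight a b) f = mean a fun v => mean (iidWeight (b v)) fun us => f (v, us) := by
  simp only [mean, cloudWeight, Fintype.sum_prod_type, Finset.mul_sum, mul_assoc]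

theorem cloudWeight_mem (ha : a ∈ stdSimplex ℝ A) (hb : ∀ v, b v ∈ stdSimplex ℝ B) :
    (cloudWeight a b : A × (κ → B) → ℝ) ∈ stdSimplex ℝ (A × (κ → B)) := by
  refine ⟨fun z => mul_nonneg (ha.1 _) ((iidWeight_mem (hb _)).1 _), ?_⟩
  simp only [Fintype.sum_prod_type, cloudWeight, ← Finset.mul_sum, (iidWeight_mem (hb _)).2,
    mul_one, ha.2]

theorem mean_cloudWeight_center (hb : ∀ v, b v ∈ stdSimplex ℝ B)
    (f : A → ℝ) :
    mean (cloudWeight a b) (fun z : A × (κ → B) => f z.1) = mean a f := by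
  rw [mean_cloudWeight]
  simp only [mean_const (iidWeight_mem (hb _)).2]

theorem mean_cloudWeight_one (hb : ∀ v, b v ∈ stdSimplex ℝ B)
    (k : κ) (f : A → B → ℝ) :
    mean (cloudWeight a b) (fun z : A × (κ → B) => f z.1 (z.2 k)) =
      mean a fun v => mean (b v) (f v) := by
  rw [mean_cloudWeight]
  simp only [mean_iidWeight_one (hb _)]

theorem mean_cloudWeight_two (hb : ∀ v, b v ∈ stdSimplex ℝ B) {k l : κ} (hkl : k ≠ l)
    (f : A → B → B → ℝ) :
    mean (cloudWeight a b) (fun z : A × (κ → B) => f z.1 (z.2 k) (z.2 l)) =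
      mean a fun v => mean (b v) fun u => mean (b v) fun u' => f v u u' := by
  rw [mean_cloudWeight]
  simp only [mean_iidWeight_two (hb _) hkl]

open scoped Classical in
/-- Indicator of a proposition. -/
def ind (p : Prop) : ℝ := if p then 1 else 0

theorem ind_nonneg (p : Prop) : 0 ≤ ind p := by unfold ind; split_ifs <;> norm_num

theorem ind_le_one (p : Prop) : ind p ≤ 1 := by unfold ind; split_ifs <;> norm_num

theorem ind_of {p : Prop} (h : p) : ind p = 1 := if_pos h

theorem ind_of_not {p : Prop} (h : ¬p) : ind p = 0 := if_neg h

theorem ind_or_le (p q : Prop) : ind (p ∨ q) ≤ ind p + ind q := by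
  unfold ind; split_ifs <;> first | tauto | norm_num

theorem ind_mono {p q : Prop} (h : p → q) : ind p ≤ ind q := by
  unfold ind; split_ifs <;> first | tauto | norm_num

/-- The tests passed by the satellite `u` of the center `v` when `y` is received. -/
def Cand (a : A → ℝ) (b : A → B → ℝ) (o : A → B → Y → ℝ) (t₁ t₂ : ℝ) (v : A) (u : B) (y : Y) :
    Prop :=
  mean (b v) (fun u => o v u y) ≤ t₁ * o v u y ∧
    mean a (fun v => mean (b v) fun u => o v u y) ≤ t₂ * o v u y

variable {o : A → B → Y → ℝ} {t₁ t₂ : ℝ}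

theorem mean_not_cand_le (ha : a ∈ stdSimplex ℝ A) (hb : ∀ v, b v ∈ stdSimplex ℝ B)
    (ho : ∀ v u, o v u ∈ stdSimplex ℝ Y) :
    (mean a fun v => mean (b v) fun u => mean (o v u) fun y => ind (¬Cand a b o t₁ t₂ v u y)) ≤
      (mean a fun v => mean (b v) fun u => mean (o v u) fun y =>
        ind (t₁ * o v u y < mean (b v) fun u => o v u y)) +
      mean a fun v => mean (b v) fun u => mean (o v u) fun y =>
        ind (t₂ * o v u y < mean a fun v => mean (b v) fun u => o v u y) := by
  simp only [← mean_add]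
  refine mean_mono ha.1 fun v => mean_mono (hb v).1 fun u => mean_mono (ho v u).1 fun y => ?_
  refine le_trans (le_of_eq ?_) (ind_or_le _ _)
  congr 1
  rw [Cand, not_and_or, not_le, not_le]

/-- A change of measure: averaged over the sent satellite u, the output law is at most t₁ times that
of u' wherever u' passes the first test, and the output law of u' has total mass 1. -/
theorem mean_cand_same_le (ha : a ∈ stdSimplex ℝ A) (hb : ∀ v, b v ∈ stdSimplex ℝ B)
    (ho : ∀ v u, o v u ∈ stdSimplex ℝ Y) (ht₁ : 0 ≤ t₁) :
    (mean a fun v => mean (b v) fun u => mean (b v) fun u' =>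
      mean (o v u) fun y => ind (Cand a b o t₁ t₂ v u' y)) ≤ t₁ := by
  calc _ ≤ mean a fun v => mean (b v) fun _ => t₁ := mean_mono ha.1 fun v => by
        rw [mean_comm]
        refine mean_mono (hb v).1 fun u' => ?_
        have hle : ∀ y, mean (b v) (fun u => o v u y) * ind (Cand a b o t₁ t₂ v u' y) ≤
            t₁ * o v u' y := fun y => by
          by_cases h : Cand a b o t₁ t₂ v u' y
          · rw [ind_of h, mul_one]; exact h.1
          · rw [ind_of_not h, mul_zero]; exact mul_nonneg ht₁ ((ho v u').1 y)
        calc _ = ∑ y, mean (b v) (fun u => o v u y) * ind (Cand a b o t₁ t₂ v u' y) := by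
              simp only [mean, Finset.mul_sum, Finset.sum_mul, mul_assoc]
              exact Finset.sum_comm
          _ ≤ ∑ y, t₁ * o v u' y := Finset.sum_le_sum fun y _ => hle y
          _ = t₁ := by rw [← Finset.mul_sum, (ho v u').2, mul_one]
    _ = t₁ := by simp only [mean_const (hb _).2, mean_const ha.2]

/-- The same change of measure with the second test; the codeword of another cloud is independent of
the output, so the output is averaged over v and u. -/
theorem mean_cand_other_le (ha : a ∈ stdSimplex ℝ A) (hb : ∀ v, b v ∈ stdSimplex ℝ B)
    (ho : ∀ v u, o v u ∈ stdSimplex ℝ Y) (ht₂ : 0 ≤ t₂) :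
    (mean a fun v' => mean (b v') fun u' => mean a fun v => mean (b v) fun u =>
      mean (o v u) fun y => ind (Cand a b o t₁ t₂ v' u' y)) ≤ t₂ := by
  calc _ ≤ mean a fun v' => mean (b v') fun _ => t₂ :=
        mean_mono ha.1 fun v' => mean_mono (hb v').1 fun u' => by
        have hle : ∀ y, (mean a fun v => mean (b v) fun u => o v u y) *
            ind (Cand a b o t₁ t₂ v' u' y) ≤ t₂ * o v' u' y := fun y => by
          by_cases h : Cand a b o t₁ t₂ v' u' y
          · rw [ind_of h, mul_one]; exact h.2
          · rw [ind_of_not h, mul_zero]; exact mul_nonneg ht₂ ((ho v' u').1 y)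
        calc _ = ∑ y, (mean a fun v => mean (b v) fun u => o v u y) *
                ind (Cand a b o t₁ t₂ v' u' y) := by
              simp only [← mean_mul_const, ← mean_sum]
              rfl
          _ ≤ ∑ y, t₂ * o v' u' y := Finset.sum_le_sum fun y _ => hle y
          _ = t₂ := by rw [← Finset.mul_sum, (ho v' u').2, mul_one]
    _ = t₂ := by simp only [mean_const (hb _).2, mean_const ha.2]

/-- The expected probability that the transmitted codeword `(j,k)` fails its tests or another
codeword passes them. -/
theorem packing {J : ℕ} (ha : a ∈ stdSimplex ℝ A) (hb : ∀ v, b v ∈ stdSimplex ℝ B)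
    (ho : ∀ v u, o v u ∈ stdSimplex ℝ Y) (ht₁ : 0 ≤ t₁) (ht₂ : 0 ≤ t₂) (j : Fin J) (k : κ) :
    (mean (iidWeight (cloudWeight a b)) fun c : Fin J → A × (κ → B) =>
      mean (o (c j).1 ((c j).2 k)) fun y => ind (¬Cand a b o t₁ t₂ (c j).1 ((c j).2 k) y) +
        ((∑ k' ∈ Finset.univ.erase k, ind (Cand a b o t₁ t₂ (c j).1 ((c j).2 k') y)) +
        ∑ j' ∈ Finset.univ.erase j, ∑ k', ind (Cand a b o t₁ t₂ (c j').1 ((c j').2 k') y))) ≤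
      (mean a fun v => mean (b v) fun u => mean (o v u) fun y =>
        ind (t₁ * o v u y < mean (b v) fun u => o v u y)) +
      (mean a fun v => mean (b v) fun u => mean (o v u) fun y =>
        ind (t₂ * o v u y < mean a fun v => mean (b v) fun u => o v u y)) +
      (Fintype.card κ * t₁ + ((J : ℝ) - 1) * (Fintype.card κ * t₂)) := by
  have hc := cloudWeight_mem (κ := κ) ha hb
  simp only [mean_add, mean_sum]
  refine add_le_add ?_ (add_le_add ?_ ?_)
  · rw [mean_iidWeight_one hc j fun z => mean (o z.1 (z.2 k)) fun y =>
      ind (¬Cand a b o t₁ t₂ z.1 (z.2 k) y), mean_cloudWeight_one hb k fun v u =>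
      mean (o v u) fun y => ind (¬Cand a b o t₁ t₂ v u y)]
    exact mean_not_cand_le ha hb ho
  · calc _ ≤ ∑ k' ∈ Finset.univ.erase k, t₁ := Finset.sum_le_sum fun k' hk' => by
          rw [mean_iidWeight_one hc j fun z => mean (o z.1 (z.2 k)) fun y =>
            ind (Cand a b o t₁ t₂ z.1 (z.2 k') y), mean_cloudWeight_two hb
            (Finset.ne_of_mem_erase hk').symm fun v u u' =>
            mean (o v u) fun y => ind (Cand a b o t₁ t₂ v u' y)]
          exact mean_cand_same_le ha hb ho ht₁
      _ ≤ ∑ _k' : κ, t₁ :=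
          Finset.sum_le_sum_of_subset_of_nonneg (Finset.erase_subset _ _) fun _ _ _ => ht₁
      _ = _ := by simp
  -- The count J − 1 is kept exactly: it is at most 2^{nR_V} for a cloud rate R_V of either sign.
  · calc _ ≤ ∑ j' ∈ Finset.univ.erase j, ∑ _k' : κ, t₂ :=
          Finset.sum_le_sum fun j' hj' => Finset.sum_le_sum fun k' _ => by
          rw [mean_iidWeight_two hc (Finset.ne_of_mem_erase hj') fun z' z =>
            mean (o z.1 (z.2 k)) fun y => ind (Cand a b o t₁ t₂ z'.1 (z'.2 k') y)]
          have h1 : ∀ z' : A × (κ → B), (mean (cloudWeight a b) fun z : A × (κ → B) =>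
              mean (o z.1 (z.2 k)) fun y => ind (Cand a b o t₁ t₂ z'.1 (z'.2 k') y)) =
              mean a fun v => mean (b v) fun u => mean (o v u) fun y =>
              ind (Cand a b o t₁ t₂ z'.1 (z'.2 k') y) := fun z' =>
            mean_cloudWeight_one hb k fun v u => mean (o v u) fun y =>
              ind (Cand a b o t₁ t₂ z'.1 (z'.2 k') y)
          simp only [h1]
          rw [mean_cloudWeight_one hb k' fun v' u' => mean a fun v => mean (b v) fun u =>
            mean (o v u) fun y => ind (Cand a b o t₁ t₂ v' u' y)]
          exact mean_cand_other_le ha hb ho ht₂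
      _ = _ := by
          have : 1 ≤ J := Nat.one_le_of_lt j.2
          simp [Finset.card_erase_of_mem, Nat.cast_sub this]

/-- Soft covering: the satellites `e l` of a random cloud reproduce the law of the state given the
center, up to a small one-sided error. -/
theorem covering {s : A → B → X → ℝ} (ha : a ∈ stdSimplex ℝ A) (hb : ∀ v, b v ∈ stdSimplex ℝ B)
    (hs : ∀ v u, s v u ∈ stdSimplex ℝ X) {L : ℕ} (hL : 0 < L) {e : Fin L → κ}
    (he : Function.Injective e) {T ε : ℝ} (hε : 0 < ε) (hT0 : 0 ≤ T) (hT : T ≤ ε ^ 2 * L) :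
    (mean (cloudWeight a b) fun z : A × (κ → B) => ∑ x,
      max 0 (mean (b z.1) (fun u => s z.1 u x) - 1 / L * ∑ l, s z.1 (z.2 (e l)) x)) ≤
      (mean a fun v => mean (b v) fun u => mean (s v u) fun x =>
        ind (T * mean (b v) (fun u => s v u x) < s v u x)) + ε := by
  have hL' : (0 : ℝ) < L := by exact_mod_cast hL
  rw [mean_cloudWeight]
  have hε1 : ε = mean a fun _ => ε := (mean_const ha.2 ε).symm
  conv_rhs => rw [hε1]
  rw [← mean_add]
  refine mean_mono ha.1 fun v => ?_
  have hpsum : ∑ x, mean (b v) (fun u => s v u x) = 1 := by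
    rw [← mean_sum]
    simp only [(hs v _).2, mean_const (hb v).2]
  have hrhs : (mean (b v) fun u => mean (s v u) fun x =>
      ind (T * mean (b v) (fun u => s v u x) < s v u x)) + ε =
      ∑ x, ((mean (b v) fun u => s v u x * ind (T * mean (b v) (fun u => s v u x) < s v u x)) +
        mean (b v) (fun u => s v u x) * ε) := by
    rw [Finset.sum_add_distrib, ← Finset.sum_mul, hpsum, one_mul, ← mean_sum]
    rfl
  rw [hrhs, mean_sum]
  refine Finset.sum_le_sum fun x _ => ?_
  set p := mean (b v) fun u => s v u x with hp_def
  have hsx : ∀ u, 0 ≤ s v u x := fun u => (hs v u).1 x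
  have hp : 0 ≤ p := mean_nonneg (hb v).1 hsx
  have hw := iidWeight_mem (ι := κ) (hb v)
  have htail : 0 ≤ mean (b v) fun u => s v u x * ind (T * p < s v u x) :=
    mean_nonneg (hb v).1 fun u => mul_nonneg (hsx u) (ind_nonneg _)
  rcases hp.eq_or_lt with hp0 | hp0
  · rw [show p * ε = 0 by rw [← hp0, zero_mul], add_zero]
    refine le_trans (le_of_eq ?_) htail
    refine (congrArg (mean _) (funext fun us => ?_)).trans (mean_const hw.2 0)
    refine max_eq_left ?_
    change p - _ ≤ 0
    rw [← hp0, zero_sub, neg_nonpos]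
    exact mul_nonneg (by positivity) (Finset.sum_nonneg fun l _ => hsx _)
  -- Truncating at T p makes the variance finite in terms of T. As the error is one-sided,
  -- discarding the large values only increases it; the lost mean p − μ is the tail term of the
  -- bound.
  set h : B → ℝ := fun u => s v u x * ind (s v u x ≤ T * p) with hh_def
  set μ := mean (b v) h
  have hh0 : ∀ u, 0 ≤ h u := fun u => mul_nonneg (hsx u) (ind_nonneg _)
  have hhs : ∀ u, h u ≤ s v u x := fun u => mul_le_of_le_one_right (hsx u) (ind_le_one _)
  have hμp : μ ≤ p := mean_mono (hb v).1 hhs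
  have hμ0 : 0 ≤ μ := mean_nonneg (hb v).1 hh0
  have hgap : p - μ = mean (b v) fun u => s v u x * ind (T * p < s v u x) := by
    refine (mean_sub (b v) (fun u => s v u x) h).symm.trans (congrArg _ (funext fun u => ?_))
    by_cases hc : s v u x ≤ T * p
    · simp [hh_def, ind_of hc, ind_of_not (not_lt.2 hc)]
    · simp [hh_def, ind_of_not hc, ind_of (not_le.1 hc)]
  have hvar : (mean (b v) fun u => (μ - h u) ^ 2) ≤ T * p * p := by
    calc _ = (mean (b v) fun u => h u ^ 2) - μ ^ 2 := by
          have : ∀ u, (μ - h u) ^ 2 = h u ^ 2 - (2 * μ * h u - μ ^ 2) := fun u => by ring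
          simp only [this, mean_sub, mean_const_mul, mean_const (hb v).2]
          change _ - (2 * μ * μ - μ ^ 2) = _
          ring
      _ ≤ mean (b v) fun u => h u ^ 2 := sub_le_self _ (sq_nonneg _)
      _ ≤ mean (b v) fun u => T * p * h u := mean_mono (hb v).1 fun u => by
          rw [sq]
          refine mul_le_mul_of_nonneg_right ?_ (hh0 u)
          by_cases hc : s v u x ≤ T * p
          · simpa [hh_def, ind_of hc] using hc
          · simp only [hh_def, ind_of_not hc, mul_zero]; positivity
      _ = T * p * μ := mean_const_mul _ _ _
      _ ≤ T * p * p := mul_le_mul_of_nonneg_left hμp (by positivity)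
  have hz : mean (b v) (fun u => μ - h u) = 0 := by
    rw [mean_sub, mean_const (hb v).2]; exact sub_self _
  have hpε : 0 < p * ε := mul_pos hp0 hε
  -- The inequality S/L ≤ pε/2 + (S/L)²/(2pε) replaces an absolute deviation by a second moment; T ≤
  -- ε²L then makes the expected quadratic part at most pε/2.
  have hpt : ∀ us : κ → B, max 0 (p - 1 / L * ∑ l, s v (us (e l)) x) ≤
      (p - μ) + (p * ε / 2 + 1 / (2 * (p * ε) * L ^ 2) * (∑ l, (μ - h (us (e l)))) ^ 2) :=
    fun us => by
      have h1 : 1 / (L : ℝ) * ∑ l, h (us (e l)) ≤ 1 / L * ∑ l, s v (us (e l)) x :=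
        mul_le_mul_of_nonneg_left (Finset.sum_le_sum fun l _ => hhs _) (by positivity)
      set S := ∑ l, (μ - h (us (e l))) with hS
      have hS' : S = L * μ - ∑ l, h (us (e l)) := by
        rw [hS, Finset.sum_sub_distrib]; simp
      have h2 : μ - 1 / L * ∑ l, h (us (e l)) = S / L := by rw [hS']; field_simp
      have h3 : S / L ≤ p * ε / 2 + 1 / (2 * (p * ε) * L ^ 2) * S ^ 2 := by
        have : p * ε / 2 + 1 / (2 * (p * ε) * L ^ 2) * S ^ 2 - S / L =
            (p * ε - S / L) ^ 2 / (2 * (p * ε)) := by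
          have := hpε.ne'
          field_simp
          ring
        have h4 : 0 ≤ (p * ε - S / L) ^ 2 / (2 * (p * ε)) := by positivity
        linarith
      refine max_le ?_ ?_
      · have : 0 ≤ 1 / (2 * (p * ε) * L ^ 2) * S ^ 2 := by positivity
        linarith
      · linarith
  refine (mean_mono hw.1 hpt).trans ?_
  rw [mean_add, mean_add, mean_const hw.2, mean_const hw.2, mean_const_mul,
    mean_iidWeight_sq (hb v) hz he, Fintype.card_fin, hgap]
  have : 1 / (2 * (p * ε) * L ^ 2) * (L * mean (b v) fun u => (μ - h u) ^ 2) ≤ p * ε / 2 := by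
    calc _ ≤ 1 / (2 * (p * ε) * L ^ 2) * (L * (ε ^ 2 * L * p * p)) := by
          refine mul_le_mul_of_nonneg_left (mul_le_mul_of_nonneg_left (hvar.trans ?_) hL'.le)
            (by positivity)
          exact mul_le_mul_of_nonneg_right (mul_le_mul_of_nonneg_right hT hp) hp
      _ = p * ε / 2 := by field_simp
  linarith

/-- A random mixture of `J` laws has no large atoms. -/
theorem mean_atoms_le {J : ℕ} (ha : a ∈ stdSimplex ℝ A) {s : A → X → ℝ}
    (hs : ∀ v, s v ∈ stdSimplex ℝ X) {θ θ' : ℝ} (hθ : 0 < θ) (hθ' : 0 ≤ θ')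
    (j : Fin J) :
    (mean (iidWeight a) fun vs : Fin J → A => mean (s (vs j)) fun x =>
      ind (θ < 1 / J * ∑ j', s (vs j') x)) ≤
      (mean a fun v => mean (s v) fun x => ind (J * θ / 2 < s v x)) +
      (mean a fun v => mean (s v) fun x => ind (θ' < mean a fun v => s v x)) +
      2 * θ' / θ := by
  have hJ : (0 : ℝ) < J := by exact_mod_cast (Nat.zero_le _).trans_lt j.2
  have hw := iidWeight_mem (ι := Fin J) ha
  set s₀ : X → ℝ := fun x => mean a fun v => s v x with hs₀
  have hs0 : ∀ x, 0 ≤ s₀ x := fun x => mean_nonneg ha.1 fun v => (hs v).1 x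
  -- An atom above θ has three possible causes: its own component exceeds Jθ/2, the averaged law
  -- exceeds θ', or the other components together reach Jθ/2. The last is bounded by Markov's
  -- inequality, giving 2θ'/θ.
  have hpt : ∀ (vs : Fin J → A) x, ind (θ < 1 / J * ∑ j', s (vs j') x) ≤
      ind (J * θ / 2 < s (vs j) x) + ind (θ' < s₀ x) +
        ∑ j' ∈ Finset.univ.erase j, 2 / (θ * J) * (s (vs j') x * ind (s₀ x ≤ θ')) := fun vs x => by
    have hnn : ∀ j', 0 ≤ s (vs j') x := fun j' => (hs _).1 x
    have hsum : 0 ≤ ∑ j' ∈ Finset.univ.erase j, 2 / (θ * J) * (s (vs j') x * ind (s₀ x ≤ θ')) :=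
      Finset.sum_nonneg fun j' _ => mul_nonneg (by positivity)
        (mul_nonneg (hnn j') (ind_nonneg _))
    have i1 := ind_nonneg (J * θ / 2 < s (vs j) x)
    have i2 := ind_nonneg (θ' < s₀ x)
    have i3 := ind_le_one (θ < 1 / J * ∑ j', s (vs j') x)
    by_cases h1 : J * θ / 2 < s (vs j) x
    · rw [ind_of h1]; linarith
    by_cases h2 : θ' < s₀ x
    · rw [ind_of h2]; linarith
    by_cases h3 : θ < 1 / J * ∑ j', s (vs j') x
    · rw [ind_of h3, ind_of (not_lt.1 h2)]
      have h4 : 1 / (J : ℝ) * ∑ j', s (vs j') x =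
          1 / J * (s (vs j) x + ∑ j' ∈ Finset.univ.erase j, s (vs j') x) := by
        rw [Finset.add_sum_erase _ (fun j' => s (vs j') x) (Finset.mem_univ j)]
      rw [h4, one_div, inv_mul_eq_div, lt_div_iff₀ hJ] at h3
      simp only [mul_one, ← Finset.mul_sum]
      have h5 : θ * J / 2 ≤ ∑ j' ∈ Finset.univ.erase j, s (vs j') x := by
        have := not_lt.1 h1
        linarith
      have h6 : 1 ≤ 2 / (θ * J) * ∑ j' ∈ Finset.univ.erase j, s (vs j') x := by
        rw [div_mul_eq_mul_div, le_div_iff₀ (by positivity)]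
        linarith
      linarith
    · rw [ind_of_not h3]; linarith
  refine (mean_mono hw.1 fun vs => mean_mono (hs _).1 fun x => hpt vs x).trans ?_
  simp only [mean_add, mean_sum, mean_const_mul]
  refine add_le_add (add_le_add (le_of_eq ?_) (le_of_eq ?_)) ?_
  · exact mean_iidWeight_one ha j fun v => mean (s v) fun x => ind (J * θ / 2 < s v x)
  · exact mean_iidWeight_one ha j fun v => mean (s v) fun x => ind (θ' < s₀ x)
  · calc _ ≤ ∑ j' ∈ Finset.univ.erase j, 2 / (θ * J) * θ' := Finset.sum_le_sum fun j' hj' => by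
          refine mul_le_mul_of_nonneg_left ?_ (by positivity)
          rw [mean_iidWeight_two ha (Finset.ne_of_mem_erase hj').symm fun v v' =>
            mean (s v) fun x => s v' x * ind (s₀ x ≤ θ')]
          calc _ = mean a fun v => mean (s v) fun x => s₀ x * ind (s₀ x ≤ θ') := by
                congr 1; ext v
                rw [mean_comm]
                simp only [mean_mul_const]
                rfl
            _ ≤ mean a fun v => mean (s v) fun _ => θ' :=
                mean_mono ha.1 fun v => mean_mono (hs v).1 fun x => by
                  by_cases h : s₀ x ≤ θ'
                  · rw [ind_of h, mul_one]; exact h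
                  · rw [ind_of_not h, mul_zero]; exact hθ'
            _ = θ' := by simp only [mean_const (hs _).2, mean_const ha.2]
      _ ≤ ∑ _j' : Fin J, 2 / (θ * J) * θ' :=
          Finset.sum_le_sum_of_subset_of_nonneg (Finset.erase_subset _ _)
            fun _ _ _ => by positivity
      _ = _ := by
          simp only [Finset.sum_const, Finset.card_univ, Fintype.card_fin, nsmul_eq_mul]
          field_simp

end Random

/-! ### The one-shot coding bound -/

section OneShot

variable {A B X X₁ Y : Type*} [Fintype A] [Fintype B] [Fintype X] [Fintype X₁] [Fintype Y]

theorem avg_le {n : ℕ} (hn : 0 < n) {f : Fin n → ℝ} {r : ℝ} (h : ∀ i, f i ≤ r) :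
    1 / (n : ℝ) * ∑ i, f i ≤ r := by
  have hn' : (0 : ℝ) < n := by exact_mod_cast hn
  rw [one_div, inv_mul_eq_div, div_le_iff₀ hn']
  calc ∑ i, f i ≤ ∑ _i : Fin n, r := Finset.sum_le_sum fun i _ => h i
    _ = r * n := by simp [mul_comm]

theorem avg_mono {n : ℕ} {f g : Fin n → ℝ} (h : ∀ i, f i ≤ g i) :
    1 / (n : ℝ) * ∑ i, f i ≤ 1 / (n : ℝ) * ∑ i, g i :=
  mul_le_mul_of_nonneg_left (Finset.sum_le_sum fun i _ => h i) (by positivity)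

theorem mean_avg {α : Type*} [Fintype α] (p : α → ℝ) {n : ℕ} (f : Fin n → α → ℝ) :
    mean p (fun x => 1 / (n : ℝ) * ∑ i, f i x) = 1 / (n : ℝ) * ∑ i, mean p (f i) := by
  rw [mean_const_mul, mean_sum]

/-- A decoder that errs only if the transmitted codeword fails or another one passes. -/
theorem exists_decoder {M L J : ℕ} (hM : 0 < M)
    (C : Fin J → Fin M × Fin L → Y → Prop) :
    ∃ g : Y → Fin M, ∀ y j w l, ind (g y ≠ w) ≤ ind (¬C j (w, l) y) +
      ((∑ k' ∈ Finset.univ.erase (w, l), ind (C j k' y)) +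
        ∑ j' ∈ Finset.univ.erase j, ∑ k', ind (C j' k' y)) := by
  classical
  -- Any passing codeword may be chosen: if it carries a wrong message it is one of the other
  -- codewords in the bound. With none passing, message 0 is output.
  refine ⟨fun y => if h : ∃ jk : Fin J × (Fin M × Fin L), C jk.1 jk.2 y then h.choose.2.1
    else ⟨0, hM⟩, fun y j w l => ?_⟩
  have n1 : 0 ≤ ∑ k' ∈ Finset.univ.erase (w, l), ind (C j k' y) :=
    Finset.sum_nonneg fun _ _ => ind_nonneg _
  have n2 : 0 ≤ ∑ j' ∈ Finset.univ.erase j, ∑ k', ind (C j' k' y) :=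
    Finset.sum_nonneg fun _ _ => Finset.sum_nonneg fun _ _ => ind_nonneg _
  by_cases hC : C j (w, l) y
  · have h : ∃ jk : Fin J × (Fin M × Fin L), C jk.1 jk.2 y := ⟨(j, w, l), hC⟩
    simp only [dif_pos h]
    have hs := h.choose_spec
    set jk := h.choose
    have n0 := ind_nonneg (¬C j (w, l) y)
    by_cases hw : jk.2.1 = w
    · rw [ind_of_not (not_not.2 hw)]; linarith
    · refine (ind_le_one _).trans ?_
      by_cases hj : jk.1 = j
      · have : (1 : ℝ) ≤ ∑ k' ∈ Finset.univ.erase (w, l), ind (C j k' y) := by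
          rw [← ind_of (hj ▸ hs)]
          exact Finset.single_le_sum (f := fun k' => ind (C j k' y)) (fun _ _ => ind_nonneg _)
            (Finset.mem_erase.2 ⟨fun h => hw (by rw [h]), Finset.mem_univ _⟩)
        linarith
      · have : (1 : ℝ) ≤ ∑ j' ∈ Finset.univ.erase j, ∑ k', ind (C j' k' y) := by
          rw [← ind_of hs]
          refine le_trans ?_ (Finset.single_le_sum (f := fun j' => ∑ k', ind (C j' k' y))
            (fun _ _ => Finset.sum_nonneg fun _ _ => ind_nonneg _)
            (Finset.mem_erase.2 ⟨hj, Finset.mem_univ _⟩))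
          exact Finset.single_le_sum (f := fun k' => ind (C jk.1 k' y))
            (fun _ _ => ind_nonneg _) (Finset.mem_univ jk.2)
        linarith
  · rw [ind_of hC]
    linarith [ind_le_one ((if h : ∃ jk : Fin J × (Fin M × Fin L), C jk.1 jk.2 y
      then h.choose.2.1 else ⟨0, hM⟩) ≠ w)]

/-- The conditional error probability `e x`, if at most that of every input, is bounded by that of
the satellites plus the covering error. -/
theorem mean_minError_le {W : X₁ → X → Y → ℝ} {L : ℕ} {p : X → ℝ} {π : Fin L → X × X₁ → ℝ}
    (hπ : ∀ l, π l ∈ stdSimplex ℝ (X × X₁)) {e : X → ℝ} {f : Y → ℝ}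
    (he1 : ∀ x, e x ≤ 1) (he0 : ∀ x, 0 ≤ e x) (he : ∀ x x₁, e x ≤ mean (W x₁ x) f) :
    mean p e ≤ 1 / L * ∑ l, mean (outLaw W (π l)) f +
      ∑ x, max 0 (p x - 1 / L * ∑ l, stLaw (π l) x) := by
  have h1 : ∀ l, mean (stLaw (π l)) e ≤ mean (outLaw W (π l)) f := fun l => by
    calc _ = ∑ z, π l z * e z.1 := by
          simp only [mean, stLaw, Finset.sum_mul, Fintype.sum_prod_type]
      _ ≤ ∑ z, π l z * mean (W z.2 z.1) f :=
          Finset.sum_le_sum fun z _ => mul_le_mul_of_nonneg_left (he _ _) ((hπ l).1 z)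
      _ = _ := by
          simp only [mean, outLaw, Finset.sum_mul, Finset.mul_sum, mul_assoc]
          exact Finset.sum_comm
  have h2 : mean p e ≤ mean (fun x => 1 / (L : ℝ) * ∑ l, stLaw (π l) x) e +
      ∑ x, max 0 (p x - 1 / L * ∑ l, stLaw (π l) x) := by
    rw [mean, mean, ← Finset.sum_add_distrib]
    refine Finset.sum_le_sum fun x _ => ?_
    have h3 := mul_le_mul_of_nonneg_right
      (le_max_right 0 (p x - 1 / (L : ℝ) * ∑ l, stLaw (π l) x)) (he0 x)
    have h4 := mul_le_mul_of_nonneg_left (he1 x)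
      (le_max_left 0 (p x - 1 / (L : ℝ) * ∑ l, stLaw (π l) x))
    linarith
  refine h2.trans (add_le_add_left ?_ _)
  calc _ = 1 / (L : ℝ) * ∑ l, mean (stLaw (π l)) e := by
        simp only [mean, Finset.sum_mul, Finset.mul_sum, mul_assoc]
        exact Finset.sum_comm
    _ ≤ _ := avg_mono h1

/-- The one-shot random coding bound. -/
theorem one_shot [Nonempty X₁] {W : X₁ → X → Y → ℝ} (hW : ∀ x₁ x, W x₁ x ∈ stdSimplex ℝ Y)
    {a : A → ℝ} {b : A → B → ℝ} {π : A → B → X × X₁ → ℝ}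
    (ha : a ∈ stdSimplex ℝ A) (hb : ∀ v, b v ∈ stdSimplex ℝ B)
    (hπ : ∀ v u, π v u ∈ stdSimplex ℝ (X × X₁)) {J M L : ℕ} (hJ : 0 < J) (hM : 0 < M) (hL : 0 < L)
    {t₁ t₂ T θ θ' ε : ℝ} (ht₁ : 0 ≤ t₁) (ht₂ : 0 ≤ t₂) (hT0 : 0 ≤ T) (hθ : 0 < θ) (hθ' : 0 ≤ θ')
    (hε : 0 < ε) (hT : T ≤ ε ^ 2 * L) :
    ∃ (vs : Fin J → A) (g : Y → Fin M) (φ : Fin M → X → X₁),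
      (mean (fun x => 1 / (J : ℝ) * ∑ j, mean (b (vs j)) fun u => stLaw (π (vs j) u) x) fun x =>
        1 / (M : ℝ) * (∑ w, mean (W (φ w x) x) fun y => ind (g y ≠ w)) +
        ind (θ < 1 / (J : ℝ) * ∑ j, mean (b (vs j)) fun u => stLaw (π (vs j) u) x)) ≤
      ((mean a fun v => mean (b v) fun u => mean (outLaw W (π v u)) fun y =>
        ind (t₁ * outLaw W (π v u) y < mean (b v) fun u => outLaw W (π v u) y)) +
      (mean a fun v => mean (b v) fun u => mean (outLaw W (π v u)) fun y =>
        ind (t₂ * outLaw W (π v u) y < mean a fun v => mean (b v) fun u => outLaw W (π v u) y)) +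
      ((M * L : ℝ) * t₁ + ((J : ℝ) - 1) * (M * L * t₂))) +
      ((mean a fun v => mean (b v) fun u => mean (stLaw (π v u)) fun x =>
        ind (T * (mean (b v) fun u => stLaw (π v u) x) < stLaw (π v u) x)) + ε) +
      ((mean a fun v => mean (fun x => mean (b v) fun u => stLaw (π v u) x) fun x =>
        ind (J * θ / 2 < mean (b v) fun u => stLaw (π v u) x)) +
      (mean a fun v => mean (fun x => mean (b v) fun u => stLaw (π v u) x) fun x =>
        ind (θ' < mean a fun v => mean (b v) fun u => stLaw (π v u) x)) +
      2 * θ' / θ) := by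
  classical
  set s : A → B → X → ℝ := fun v u => stLaw (π v u) with hs_def
  set o : A → B → Y → ℝ := fun v u => outLaw W (π v u) with ho_def
  set sv : A → X → ℝ := fun v x => mean (b v) fun u => s v u x with hsv_def
  have hs : ∀ v u, s v u ∈ stdSimplex ℝ X := fun v u => stLaw_mem (hπ v u)
  have ho : ∀ v u, o v u ∈ stdSimplex ℝ Y := fun v u => outLaw_mem hW (hπ v u)
  have hsv : ∀ v, sv v ∈ stdSimplex ℝ X := fun v => by
    refine ⟨fun x => mean_nonneg (hb v).1 fun u => (hs v u).1 x, ?_⟩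
    simp only [sv, ← mean_sum, (hs v _).2, mean_const (hb v).2]
  have hcl := cloudWeight_mem (κ := Fin M × Fin L) ha hb
  have hcw := iidWeight_mem (ι := Fin J) hcl
  choose g hg using fun c : Fin J → A × (Fin M × Fin L → B) =>
    exists_decoder hM fun j k y => Cand a b o t₁ t₂ (c j).1 ((c j).2 k) y
  -- The encoder is deterministic: for each message and state it picks an input with the least
  -- decoding error. No input has to be drawn from the satellites.
  have hφ : ∀ (c : Fin J → A × (Fin M × Fin L → B)) (w : Fin M) (x : X), ∃ x₀ : X₁, ∀ x₁,
      (mean (W x₀ x) fun y => ind (g c y ≠ w)) ≤ mean (W x₁ x) fun y => ind (g c y ≠ w) :=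
    fun c w x => Finite.exists_min _
  choose φ hφ using hφ
  set E : (Fin J → A × (Fin M × Fin L → B)) → Fin M → X → ℝ := fun c w x =>
    mean (W (φ c w x) x) fun y => ind (g c y ≠ w) with hE
  have hE0 : ∀ c w x, 0 ≤ E c w x := fun c w x => mean_nonneg (hW _ _).1 fun _ => ind_nonneg _
  have hE1 : ∀ c w x, E c w x ≤ 1 := fun c w x =>
    (mean_mono (hW _ _).1 fun _ => ind_le_one _).trans (mean_const (hW _ _).2 1).le
  set D : (Fin J → A × (Fin M × Fin L → B)) → Fin J → Fin M × Fin L → ℝ := fun c j k =>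
    mean (o (c j).1 ((c j).2 k)) fun y => ind (¬Cand a b o t₁ t₂ (c j).1 ((c j).2 k) y) +
        ((∑ k' ∈ Finset.univ.erase k, ind (Cand a b o t₁ t₂ (c j).1 ((c j).2 k') y)) +
        ∑ j' ∈ Finset.univ.erase j, ∑ k', ind (Cand a b o t₁ t₂ (c j').1 ((c j').2 k') y)) with hD
  set cov : A × (Fin M × Fin L → B) → Fin M → ℝ := fun z w =>
    ∑ x, max 0 (sv z.1 x - 1 / L * ∑ l, s z.1 (z.2 (w, l)) x) with hcov
  set at' : (Fin J → A × (Fin M × Fin L → B)) → Fin J → ℝ := fun c j =>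
    mean (sv (c j).1) fun x => ind (θ < 1 / (J : ℝ) * ∑ j', sv (c j').1 x) with hat
  have hdet : ∀ c : Fin J → A × (Fin M × Fin L → B),
      (mean (fun x => 1 / (J : ℝ) * ∑ j, sv (c j).1 x) fun x => 1 / (M : ℝ) * (∑ w, E c w x) +
        ind (θ < 1 / (J : ℝ) * ∑ j, sv (c j).1 x)) ≤
      1 / (J : ℝ) * ∑ j, (1 / (M : ℝ) * (∑ w, (1 / (L : ℝ) * (∑ l, D c j (w, l)) + cov (c j) w)) +
        at' c j) := fun c => by
    have hsplit : ∀ F : X → ℝ, mean (fun x => 1 / (J : ℝ) * ∑ j, sv (c j).1 x) F =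
        1 / (J : ℝ) * ∑ j, mean (sv (c j).1) F := fun F => by
      simp only [mean, Finset.sum_mul, Finset.mul_sum, mul_assoc]
      exact Finset.sum_comm
    rw [hsplit]
    refine avg_mono fun j => ?_
    rw [mean_add, mean_avg]
    refine add_le_add_left (avg_mono fun w => ?_) _
    refine (mean_minError_le (fun l => hπ (c j).1 ((c j).2 (w, l))) (hE1 c w) (hE0 c w)
      fun x x₁ => hφ c w x x₁).trans (add_le_add_left (avg_mono fun l => ?_) _)
    exact mean_mono (ho _ _).1 fun y => hg c y j w l
  -- Only the average over codebooks is bounded; some codebook does at least as well. By symmetry it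
  -- suffices to treat each j, w and l separately.
  refine Exists.elim (exists_le_of_mean_le hcw (f := fun c => 1 / (J : ℝ) * ∑ j, (1 / (M : ℝ) *
    (∑ w, (1 / (L : ℝ) * (∑ l, D c j (w, l)) + cov (c j) w)) + at' c j)) ?_)
    fun c hc => ⟨fun j => (c j).1, g c, φ c, (hdet c).trans hc⟩
  rw [mean_avg]
  refine avg_le hJ fun j => ?_
  rw [mean_add, mean_avg]
  refine add_le_add (avg_le hM fun w => ?_) ?_
  · rw [mean_add, mean_avg]
    refine add_le_add (avg_le hL fun l => ?_) ?_
    · have := packing ha hb ho ht₁ ht₂ j (w, l)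
      simp only [Fintype.card_prod, Fintype.card_fin, Nat.cast_mul] at this
      exact this
    · rw [mean_iidWeight_one hcl j fun z => cov z w]
      exact covering ha hb hs hL (e := fun l => (w, l)) (fun l l' h => (Prod.mk.inj h).2) hε
        hT0 hT
  · have hat := mean_atoms_le hcl (s := fun z => sv z.1) (fun z => hsv _) hθ hθ' j
    have h1 : ∀ F : A → ℝ, (mean (cloudWeight a b) fun z : A × (Fin M × Fin L → B) => F z.1) =
        mean a F := mean_cloudWeight_center hb
    rw [h1 fun v => mean (sv v) fun x => ind (J * θ / 2 < sv v x),
      h1 fun v => mean (sv v) fun x => ind (θ' < mean (cloudWeight a b)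
        fun z : A × (Fin M × Fin L → B) => sv z.1 x)] at hat
    have h2 : ∀ x, (mean (cloudWeight a b) fun z : A × (Fin M × Fin L → B) => sv z.1 x) =
        mean a fun v => sv v x := fun x => h1 fun v => sv v x
    simp only [h2] at hat
    exact hat

end OneShot

/-! ### Product structure of blocks and Chebyshev tails -/

section Block

variable {ι α β γ : Type*} [Fintype ι] [DecidableEq ι] [Fintype α] [Fintype β] [Fintype γ]

theorem mean_mono_of_ne {p f g : α → ℝ} (hp : ∀ x, 0 ≤ p x) (h : ∀ x, p x ≠ 0 → f x ≤ g x) :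
    mean p f ≤ mean p g := by
  refine Finset.sum_le_sum fun x _ => ?_
  rcases eq_or_ne (p x) 0 with h0 | h0
  · simp [h0]
  · exact mul_le_mul_of_nonneg_left (h x h0) (hp x)

theorem mean_prod (p f : ι → α → ℝ) :
    mean (fun c : ι → α => ∏ i, p i (c i)) (fun c => ∏ i, f i (c i)) =
      ∏ i, mean (p i) (f i) := by
  simp only [mean, ← Finset.prod_mul_distrib]
  exact (Fintype.prod_sum fun i x => p i x * f i x).symm

theorem prod_mem_stdSimplex {p : ι → α → ℝ} (hp : ∀ i, p i ∈ stdSimplex ℝ α) :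
    (fun c : ι → α => ∏ i, p i (c i)) ∈ stdSimplex ℝ (ι → α) :=
  ⟨fun _ => Finset.prod_nonneg fun _ _ => (hp _).1 _, sum_prod_eq_one p fun i => (hp i).2⟩

/-- A product kernel applied to an i.i.d. sequence gives an i.i.d. sequence of pairs, which is the
setting of the tail estimate. -/
theorem mean_block_pair (p : α → ℝ) (k : α → β → ℝ) (F : (ι → α) → (ι → β) → ℝ) :
    mean (iidWeight p) (fun x : ι → α => mean (fun y : ι → β => ∏ i, k (x i) (y i)) (F x)) =
      mean (iidWeight fun z : α × β => p z.1 * k z.1 z.2)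
        fun z : ι → α × β => F (fun i => (z i).1) fun i => (z i).2 := by
  simp only [mean, iidWeight]
  rw [← (Equiv.arrowProdEquivProdArrow ι (fun _ => α) (fun _ => β)).symm.sum_comp,
    Fintype.sum_prod_type]
  refine Finset.sum_congr rfl fun x _ => ?_
  rw [Finset.mul_sum]
  refine Finset.sum_congr rfl fun y _ => ?_
  rw [← mul_assoc, ← Finset.prod_mul_distrib]
  rfl

theorem mean_block_triple (a : α → ℝ) (b : α → β → ℝ) (k : α → β → γ → ℝ)
    (F : (ι → α) → (ι → β) → (ι → γ) → ℝ) :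
    (mean (iidWeight a) fun v : ι → α => mean (fun u : ι → β => ∏ i, b (v i) (u i)) fun u =>
      mean (fun y : ι → γ => ∏ i, k (v i) (u i) (y i)) (F v u)) =
      mean (iidWeight fun z : (α × β) × γ => a z.1.1 * b z.1.1 z.1.2 * k z.1.1 z.1.2 z.2)
        fun z : ι → (α × β) × γ =>
          F (fun i => (z i).1.1) (fun i => (z i).1.2) fun i => (z i).2 := by
  rw [mean_block_pair a b fun v u => mean (fun y : ι → γ => ∏ i, k (v i) (u i) (y i)) (F v u)]
  exact mean_block_pair (fun z : α × β => a z.1 * b z.1 z.2) (fun z => k z.1 z.2)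
    fun z y => F (fun i => (z i).1) (fun i => (z i).2) y

theorem mean_triple (a : α → ℝ) (b : α → β → ℝ) (k : α → β → γ → ℝ) (F : α → β → γ → ℝ) :
    mean (fun z : (α × β) × γ => a z.1.1 * b z.1.1 z.1.2 * k z.1.1 z.1.2 z.2)
      (fun z => F z.1.1 z.1.2 z.2) =
      mean a fun v => mean (b v) fun u => mean (k v u) fun y => F v u y := by
  simp only [mean, Fintype.sum_prod_type, Finset.mul_sum, mul_assoc]

theorem mean_pair (a : α → ℝ) (k : α → β → ℝ) (F : α → β → ℝ) :
    mean (fun z : α × β => a z.1 * k z.1 z.2) (fun z => F z.1 z.2) =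
      mean a fun v => mean (k v) (F v) := by
  simp only [mean, Fintype.sum_prod_type, Finset.mul_sum, mul_assoc]

theorem pair_mem {a : α → ℝ} {k : α → β → ℝ} (ha : a ∈ stdSimplex ℝ α)
    (hk : ∀ v, k v ∈ stdSimplex ℝ β) :
    (fun z : α × β => a z.1 * k z.1 z.2) ∈ stdSimplex ℝ (α × β) := by
  refine ⟨fun z => mul_nonneg (ha.1 _) ((hk _).1 _), ?_⟩
  simp only [Fintype.sum_prod_type, ← Finset.mul_sum, (hk _).2, mul_one, ha.2]

theorem mean_mean (p : α → ℝ) (k : α → β → ℝ) (F : β → ℝ) :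
    mean p (fun u => mean (k u) F) = mean (fun y => mean p fun u => k u y) F := by
  simp only [mean, Finset.mul_sum, Finset.sum_mul, mul_assoc]
  exact Finset.sum_comm

theorem mean_logb_self (p : α → ℝ) : mean p (fun x => Real.logb 2 (p x)) = -ent p := by
  rw [ent, neg_neg]; rfl

/-- The probability of a large likelihood ratio tends to zero. -/
theorem tendsto_tail {P f g : α → ℝ} (hP : P ∈ stdSimplex ℝ α) (hf : ∀ x, P x ≠ 0 → 0 < f x)
    (hg : ∀ x, P x ≠ 0 → 0 < g x) {θ : ℝ}
    (hθ : mean P (fun x => Real.logb 2 (f x) - Real.logb 2 (g x)) < θ) :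
    Tendsto (fun n : ℕ => mean (iidWeight P) fun ω : Fin n → α =>
      ind ((2 : ℝ) ^ ((n : ℝ) * θ) * ∏ i, g (ω i) < ∏ i, f (ω i))) atTop (𝓝 0) := by
  set φ : α → ℝ := fun x => Real.logb 2 (f x) - Real.logb 2 (g x)
  set m := mean P φ with hm
  set V := mean P fun x => (φ x - m) ^ 2 with hV
  have hδ : 0 < θ - m := sub_pos.2 hθ
  have hz : mean P (fun x => φ x - m) = 0 := by
    rw [mean_sub, mean_const hP.2]; exact sub_self _
  have hlim : Tendsto (fun n : ℕ => V / (θ - m) ^ 2 * (1 / (n : ℝ))) atTop (𝓝 0) := by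
    simpa using tendsto_one_div_atTop_nhds_zero_nat.const_mul (V / (θ - m) ^ 2)
  refine tendsto_of_tendsto_of_tendsto_of_le_of_le' tendsto_const_nhds hlim
    (Eventually.of_forall fun n => mean_nonneg (iidWeight_mem hP).1 fun _ => ind_nonneg _)
    ((eventually_gt_atTop 0).mono fun n hn => ?_)
  have hn' : (0 : ℝ) < n := by exact_mod_cast hn
  -- Chebyshev: a likelihood ratio above 2^{nθ} forces the centered sum of log-ratios to reach n(θ −
  -- m). Logarithms are taken only on the support, where all factors are positive.
  have hpt : ∀ ω : Fin n → α, iidWeight P ω ≠ 0 →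
      ind ((2 : ℝ) ^ ((n : ℝ) * θ) * ∏ i, g (ω i) < ∏ i, f (ω i)) ≤
      1 / (n * (θ - m)) ^ 2 * (∑ i, (φ (ω (id i)) - m)) ^ 2 := fun ω hω => by
    by_cases h : (2 : ℝ) ^ ((n : ℝ) * θ) * ∏ i, g (ω i) < ∏ i, f (ω i)
    · have hω' : ∀ i, P (ω i) ≠ 0 := fun i => Finset.prod_ne_zero_iff.1 hω i (Finset.mem_univ i)
      have hgp : 0 < ∏ i, g (ω i) := Finset.prod_pos fun i _ => hg _ (hω' i)
      have h1 := Real.logb_lt_logb one_lt_two (by positivity) h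
      have hlogf : Real.logb 2 (∏ i, f (ω i)) = ∑ i, Real.logb 2 (f (ω i)) := by
        simp only [Real.logb, ← Finset.sum_div, Real.log_prod fun i _ => (hf _ (hω' i)).ne']
      have hlogg : Real.logb 2 (∏ i, g (ω i)) = ∑ i, Real.logb 2 (g (ω i)) := by
        simp only [Real.logb, ← Finset.sum_div, Real.log_prod fun i _ => (hg _ (hω' i)).ne']
      rw [Real.logb_mul (by positivity) hgp.ne', Real.logb_rpow two_pos (by norm_num),
        hlogf, hlogg] at h1
      have h2 : n * (θ - m) ≤ ∑ i, (φ (ω (id i)) - m) := by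
        simp only [φ, id, Finset.sum_sub_distrib, Finset.sum_const, Finset.card_univ,
          Fintype.card_fin, nsmul_eq_mul]
        linarith
      rw [ind_of h, one_div, inv_mul_eq_div, le_div_iff₀ (by positivity), one_mul]
      exact pow_le_pow_left₀ (by positivity) h2 2
    · rw [ind_of_not h]; positivity
  refine (mean_mono_of_ne (iidWeight_mem hP).1 hpt).trans (le_of_eq ?_)
  rw [mean_const_mul, mean_iidWeight_sq hP hz Function.injective_id, Fintype.card_fin]
  have := hδ.ne'
  field_simp
  rw [hV]

variable {X₁ X₂ Y₁ : Type*} [Fintype X₁] [Fintype X₂] [Fintype Y₁]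

theorem stLaw_block (p : ι → X₂ × X₁ → ℝ) (x : ι → X₂) :
    stLaw (fun z : (ι → X₂) × (ι → X₁) => ∏ i, p i (z.1 i, z.2 i)) x =
      ∏ i, stLaw (p i) (x i) :=
  (Fintype.prod_sum fun i x₁ => p i (x i, x₁)).symm

theorem outLaw_block (W : X₁ → X₂ → Y₁ → ℝ) (p : ι → X₂ × X₁ → ℝ) (y : ι → Y₁) :
    outLaw (fun (x₁ : ι → X₁) (x : ι → X₂) (y : ι → Y₁) => ∏ i, W (x₁ i) (x i) (y i))
      (fun z : (ι → X₂) × (ι → X₁) => ∏ i, p i (z.1 i, z.2 i)) y =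
      ∏ i, outLaw W (p i) (y i) := by
  simp only [outLaw, Fintype.prod_sum, ← Finset.prod_mul_distrib]
  rw [← (Equiv.arrowProdEquivProdArrow ι (fun _ => X₂) (fun _ => X₁)).symm.sum_comp]
  rfl

theorem block_mem {p : ι → X₂ × X₁ → ℝ} (hp : ∀ i, p i ∈ stdSimplex ℝ (X₂ × X₁)) :
    (fun z : (ι → X₂) × (ι → X₁) => ∏ i, p i (z.1 i, z.2 i)) ∈
      stdSimplex ℝ ((ι → X₂) × (ι → X₁)) := by
  refine ⟨fun _ => Finset.prod_nonneg fun _ _ => (hp _).1 _, ?_⟩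
  rw [← sum_prod_eq_one p fun i => (hp i).2,
    ← (Equiv.arrowProdEquivProdArrow ι (fun _ => X₂) (fun _ => X₁)).symm.sum_comp]
  rfl

end Block

/-! ### Tail estimates for conditional laws -/

section Tails

variable {α β γ : Type*} [Fintype α] [Fintype β] [Fintype γ]

theorem tendsto_tail_triple {a : α → ℝ} {b : α → β → ℝ} {k : α → β → γ → ℝ}
    (ha : a ∈ stdSimplex ℝ α) (hb : ∀ v, b v ∈ stdSimplex ℝ β)
    (hk : ∀ v u, k v u ∈ stdSimplex ℝ γ) {f g : α → β → γ → ℝ}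
    (hf : ∀ v u y, a v ≠ 0 → b v u ≠ 0 → k v u y ≠ 0 → 0 < f v u y)
    (hg : ∀ v u y, a v ≠ 0 → b v u ≠ 0 → k v u y ≠ 0 → 0 < g v u y) {θ : ℝ}
    (hθ : (mean a fun v => mean (b v) fun u => mean (k v u) fun y =>
      Real.logb 2 (f v u y) - Real.logb 2 (g v u y)) < θ) :
    Tendsto (fun n : ℕ => mean (iidWeight a) fun v : Fin n → α =>
      mean (fun u : Fin n → β => ∏ i, b (v i) (u i)) fun u =>
      mean (fun y : Fin n → γ => ∏ i, k (v i) (u i) (y i)) fun y =>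
      ind ((2 : ℝ) ^ ((n : ℝ) * θ) * ∏ i, g (v i) (u i) (y i) < ∏ i, f (v i) (u i) (y i)))
      atTop (𝓝 0) := by
  simp only [mean_block_triple a b k]
  have hne : ∀ z : (α × β) × γ, a z.1.1 * b z.1.1 z.1.2 * k z.1.1 z.1.2 z.2 ≠ 0 →
      a z.1.1 ≠ 0 ∧ b z.1.1 z.1.2 ≠ 0 ∧ k z.1.1 z.1.2 z.2 ≠ 0 := fun z hz => by
    rw [mul_ne_zero_iff, mul_ne_zero_iff] at hz; tauto
  refine tendsto_tail (f := fun z : (α × β) × γ => f z.1.1 z.1.2 z.2)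
    (g := fun z : (α × β) × γ => g z.1.1 z.1.2 z.2)
    (pair_mem (pair_mem ha hb) fun z => hk z.1 z.2) (fun z hz => ?_) (fun z hz => ?_)
    ((mean_triple a b k fun v u y => Real.logb 2 (f v u y) - Real.logb 2 (g v u y)).trans_lt hθ)
  · exact hf _ _ _ (hne z hz).1 (hne z hz).2.1 (hne z hz).2.2
  · exact hg _ _ _ (hne z hz).1 (hne z hz).2.1 (hne z hz).2.2

theorem tendsto_tail_pair {a : α → ℝ} {k : α → γ → ℝ}
    (ha : a ∈ stdSimplex ℝ α) (hk : ∀ v, k v ∈ stdSimplex ℝ γ) {f : α → γ → ℝ}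
    (hf : ∀ v y, a v ≠ 0 → k v y ≠ 0 → 0 < f v y) {θ : ℝ}
    (hθ : (mean a fun v => mean (k v) fun y => Real.logb 2 (f v y)) < θ) :
    Tendsto (fun n : ℕ => mean (iidWeight a) fun v : Fin n → α =>
      mean (fun y : Fin n → γ => ∏ i, k (v i) (y i)) fun y =>
      ind ((2 : ℝ) ^ ((n : ℝ) * θ) < ∏ i, f (v i) (y i))) atTop (𝓝 0) := by
  simp only [mean_block_pair a k]
  have := tendsto_tail (P := fun z : α × γ => a z.1 * k z.1 z.2)
    (f := fun z : α × γ => f z.1 z.2) (g := fun _ => 1) (pair_mem ha hk)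
    (fun z hz => hf _ _ (left_ne_zero_of_mul hz) (right_ne_zero_of_mul hz)) (fun _ _ => one_pos)
    (θ := θ) (by
      simp only [Real.logb_one, sub_zero]
      exact (mean_pair a k fun v y => Real.logb 2 (f v y)).trans_lt hθ)
  simpa only [Finset.prod_const_one, mul_one] using this

theorem mean_pos_of_ne {p f : α → ℝ} (hp : ∀ x, 0 ≤ p x) (hf : ∀ x, 0 ≤ f x) {x : α}
    (hpx : p x ≠ 0) (hfx : f x ≠ 0) : 0 < mean p f :=
  Finset.sum_pos' (fun x _ => mul_nonneg (hp x) (hf x)) ⟨x, Finset.mem_univ x,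
    mul_pos (lt_of_le_of_ne (hp x) hpx.symm) (lt_of_le_of_ne (hf x) hfx.symm)⟩

theorem mean_mem {b : β → ℝ} {k : β → γ → ℝ} (hb : b ∈ stdSimplex ℝ β)
    (hk : ∀ u, k u ∈ stdSimplex ℝ γ) : (fun y => mean b fun u => k u y) ∈ stdSimplex ℝ γ :=
  ⟨fun _ => mean_nonneg hb.1 fun u => (hk u).1 _, by
    rw [← mean_sum]; simp only [(hk _).2, mean_const hb.2]⟩

/-- Jensen's inequality for the concave entropy: conditioning reduces entropy. It makes I(U;X₂|V)
nonnegative in the coding theorem. -/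
theorem mean_ent_le {b : β → ℝ} {k : β → γ → ℝ} (hb : b ∈ stdSimplex ℝ β)
    (hk : ∀ u, k u ∈ stdSimplex ℝ γ) :
    mean b (fun u => ent (k u)) ≤ ent fun y => mean b fun u => k u y := by
  have := concaveOn_ent.le_map_sum (t := Finset.univ) (w := b) (p := k)
    (fun i _ => hb.1 i) hb.2 (fun i _ => (hk i).1)
  refine this.trans (le_of_eq (congrArg _ (funext fun y => ?_)))
  simp [mean]

end Tails

/-! ### The asymptotic random coding theorem -/

section Coding

variable {X₁ X₂ Y₁ 𝒱 𝒰 : Type*} [Fintype X₁] [Fintype X₂] [Fintype Y₁] [Fintype 𝒱] [Fintype 𝒰]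

/-- The one-shot bound for blocks. -/
theorem one_shot_block [Nonempty X₁] {W : X₁ → X₂ → Y₁ → ℝ}
    (hW : ∀ x₁ x, W x₁ x ∈ stdSimplex ℝ Y₁)
    {a : 𝒱 → ℝ} {b : 𝒱 → 𝒰 → ℝ} {π : 𝒱 → 𝒰 → X₂ × X₁ → ℝ}
    (ha : a ∈ stdSimplex ℝ 𝒱) (hb : ∀ v, b v ∈ stdSimplex ℝ 𝒰)
    (hπ : ∀ v u, π v u ∈ stdSimplex ℝ (X₂ × X₁))
    {s : 𝒱 → 𝒰 → X₂ → ℝ} (hs : s = fun v u => stLaw (π v u))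
    {o : 𝒱 → 𝒰 → Y₁ → ℝ} (ho : o = fun v u => outLaw W (π v u))
    {sv : 𝒱 → X₂ → ℝ} (hsv : sv = fun v x => mean (b v) fun u => s v u x)
    {ov : 𝒱 → Y₁ → ℝ} (hov : ov = fun v y => mean (b v) fun u => o v u y)
    {s₀ : X₂ → ℝ} (hs₀ : s₀ = fun x => mean a fun v => sv v x)
    {o₀ : Y₁ → ℝ} (ho₀ : o₀ = fun y => mean a fun v => ov v y) (n : ℕ)
    {J M L : ℕ} (hJ : 0 < J) (hM : 0 < M) (hL : 0 < L)
    {t₁ t₂ T θ θ' ε : ℝ} (ht₁ : 0 ≤ t₁) (ht₂ : 0 ≤ t₂) (hT0 : 0 ≤ T) (hθ : 0 < θ) (hθ' : 0 ≤ θ')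
    (hε : 0 < ε) (hT : T ≤ ε ^ 2 * L) :
    ∃ (vs : Fin J → Fin n → 𝒱) (g : (Fin n → Y₁) → Fin M)
      (φ : Fin M → (Fin n → X₂) → Fin n → X₁),
      (mean (fun x : Fin n → X₂ => 1 / (J : ℝ) * ∑ j, ∏ i, sv (vs j i) (x i)) fun x =>
        1 / (M : ℝ) * (∑ w, mean (fun y : Fin n → Y₁ => ∏ i, W (φ w x i) (x i) (y i)) fun y => ind (g y ≠ w)) +
        ind (θ < 1 / (J : ℝ) * ∑ j, ∏ i, sv (vs j i) (x i))) ≤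
      ((mean (iidWeight a) fun v : Fin n → 𝒱 => mean (fun u : Fin n → 𝒰 => ∏ i, b (v i) (u i)) fun u =>
        mean (fun y : Fin n → Y₁ => ∏ i, o (v i) (u i) (y i)) fun y =>
        ind (t₁ * ∏ i, o (v i) (u i) (y i) < ∏ i, ov (v i) (y i))) +
      (mean (iidWeight a) fun v : Fin n → 𝒱 => mean (fun u : Fin n → 𝒰 => ∏ i, b (v i) (u i)) fun u =>
        mean (fun y : Fin n → Y₁ => ∏ i, o (v i) (u i) (y i)) fun y =>
        ind (t₂ * ∏ i, o (v i) (u i) (y i) < ∏ i, o₀ (y i))) +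
      ((M * L : ℝ) * t₁ + ((J : ℝ) - 1) * (M * L * t₂))) +
      ((mean (iidWeight a) fun v : Fin n → 𝒱 => mean (fun u : Fin n → 𝒰 => ∏ i, b (v i) (u i)) fun u =>
        mean (fun x : Fin n → X₂ => ∏ i, s (v i) (u i) (x i)) fun x =>
        ind (T * ∏ i, sv (v i) (x i) < ∏ i, s (v i) (u i) (x i))) + ε) +
      ((mean (iidWeight a) fun v : Fin n → 𝒱 => mean (fun x : Fin n → X₂ => ∏ i, sv (v i) (x i)) fun x =>
        ind (J * θ / 2 < ∏ i, sv (v i) (x i))) +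
      (mean (iidWeight a) fun v : Fin n → 𝒱 => mean (fun x : Fin n → X₂ => ∏ i, sv (v i) (x i)) fun x =>
        ind (θ' < ∏ i, s₀ (x i))) + 2 * θ' / θ) := by
  have e1 : ∀ (v : Fin n → 𝒱) (u : Fin n → 𝒰), (stLaw fun z : (Fin n → X₂) × (Fin n → X₁) =>
      ∏ i, π (v i) (u i) (z.1 i, z.2 i)) = fun x => ∏ i, s (v i) (u i) (x i) := fun v u => by
    subst hs; exact funext fun x => stLaw_block (fun i => π (v i) (u i)) x
  have e2 : ∀ (v : Fin n → 𝒱) (u : Fin n → 𝒰),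
      (outLaw (fun (x₁ : Fin n → X₁) (x : Fin n → X₂) (y : Fin n → Y₁) =>
      ∏ i, W (x₁ i) (x i) (y i)) fun z : (Fin n → X₂) × (Fin n → X₁) =>
      ∏ i, π (v i) (u i) (z.1 i, z.2 i)) = fun y => ∏ i, o (v i) (u i) (y i) := fun v u => by
    subst ho; exact funext fun y => outLaw_block W (fun i => π (v i) (u i)) y
  have e3 : ∀ (v : Fin n → 𝒱) (x : Fin n → X₂), (mean (fun u : Fin n → 𝒰 => ∏ i, b (v i) (u i))
      fun u => ∏ i, s (v i) (u i) (x i)) = ∏ i, sv (v i) (x i) := fun v x => by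
    subst hsv; exact mean_prod (fun i => b (v i)) fun i u => s (v i) u (x i)
  have e4 : ∀ (v : Fin n → 𝒱) (y : Fin n → Y₁), (mean (fun u : Fin n → 𝒰 => ∏ i, b (v i) (u i))
      fun u => ∏ i, o (v i) (u i) (y i)) = ∏ i, ov (v i) (y i) := fun v x => by
    subst hov; exact mean_prod (fun i => b (v i)) fun i u => o (v i) u (x i)
  have e5 : ∀ x : Fin n → X₂, (mean (iidWeight a) fun v : Fin n → 𝒱 => ∏ i, sv (v i) (x i)) =
      ∏ i, s₀ (x i) := fun x => by
    subst hs₀; exact mean_prod (fun _ => a) fun i v => sv v (x i)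
  have e6 : ∀ x : Fin n → Y₁, (mean (iidWeight a) fun v : Fin n → 𝒱 => ∏ i, ov (v i) (x i)) =
      ∏ i, o₀ (x i) := fun x => by
    subst ho₀; exact mean_prod (fun _ => a) fun i v => ov v (x i)
  obtain ⟨vs, g, φ, h⟩ := one_shot
    (W := fun (x₁ : Fin n → X₁) (x : Fin n → X₂) (y : Fin n → Y₁) => ∏ i, W (x₁ i) (x i) (y i))
    (a := iidWeight a) (b := fun (v : Fin n → 𝒱) (u : Fin n → 𝒰) => ∏ i, b (v i) (u i))
    (π := fun v u z => ∏ i, π (v i) (u i) (z.1 i, z.2 i))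
    (fun x₁ x => prod_mem_stdSimplex fun i => hW _ _) (iidWeight_mem ha)
    (fun v => prod_mem_stdSimplex fun i => hb _) (fun v u => block_mem fun i => hπ _ _)
    hJ hM hL ht₁ ht₂ hT0 hθ hθ' hε hT
  simp only [e1, e2, e3, e4, e5, e6] at h
  exact ⟨vs, g, φ, h⟩

/-- Rounding must be harmless also for a negative cloud rate, where the ceiling is at least 1: the
bound on the ceiling minus 1 holds for every R, the factor-2 bound only for R ≥ 0. -/
theorem ceil_rpow_bounds {n : ℕ} {R : ℝ} :
    0 < ⌈(2 : ℝ) ^ ((n : ℝ) * R)⌉₊ ∧ (2 : ℝ) ^ ((n : ℝ) * R) ≤ ⌈(2 : ℝ) ^ ((n : ℝ) * R)⌉₊ ∧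
      (⌈(2 : ℝ) ^ ((n : ℝ) * R)⌉₊ : ℝ) - 1 ≤ (2 : ℝ) ^ ((n : ℝ) * R) ∧
      (0 ≤ R → (⌈(2 : ℝ) ^ ((n : ℝ) * R)⌉₊ : ℝ) ≤ 2 * (2 : ℝ) ^ ((n : ℝ) * R)) := by
  have hp : (0 : ℝ) < 2 ^ ((n : ℝ) * R) := by positivity
  have h := (Nat.ceil_lt_add_one hp.le).le
  refine ⟨Nat.ceil_pos.2 hp, Nat.le_ceil _, by linarith, fun hR => ?_⟩
  have := Real.one_le_rpow one_le_two (mul_nonneg n.cast_nonneg hR)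
  linarith

theorem tendsto_two_rpow_neg {δ : ℝ} (hδ : 0 < δ) :
    Tendsto (fun n : ℕ => (2 : ℝ) ^ (-((n : ℝ) * δ))) atTop (𝓝 0) := by
  have h := tendsto_pow_atTop_nhds_zero_of_lt_one (r := (2 : ℝ) ^ (-δ)) (by positivity)
    (Real.rpow_lt_one_of_one_lt_of_neg one_lt_two (by linarith))
  refine h.congr fun n => ?_
  rw [← Real.rpow_natCast, ← Real.rpow_mul two_pos.le]
  congr 1
  ring

/-- The random coding theorem. -/
theorem random_coding [Nonempty X₁] {W : X₁ → X₂ → Y₁ → ℝ}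
    (hW : ∀ x₁ x, W x₁ x ∈ stdSimplex ℝ Y₁)
    {a : 𝒱 → ℝ} {b : 𝒱 → 𝒰 → ℝ} {π : 𝒱 → 𝒰 → X₂ × X₁ → ℝ}
    (ha : a ∈ stdSimplex ℝ 𝒱) (hb : ∀ v, b v ∈ stdSimplex ℝ 𝒰)
    (hπ : ∀ v u, π v u ∈ stdSimplex ℝ (X₂ × X₁)) {R₁ RV R : ℝ} (hR₁ : 0 ≤ R₁)
    (h1 : R₁ < (ensPoint W a b π).2.2.2)
    (hV : RV < ent (outLaw W (ensPoint W a b π).1) - (ensPoint W a b π).2.1)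
    (hR : R < (ensPoint W a b π).2.2.1 + RV) (hR' : R < ent (stLaw (ensPoint W a b π).1))
    {η : ℝ} (hη : 0 < η) :
    ∀ᶠ n : ℕ in atTop, ∃ (vs : Fin ⌈(2 : ℝ) ^ ((n : ℝ) * RV)⌉₊ → Fin n → 𝒱)
      (g : (Fin n → Y₁) → Fin ⌈(2 : ℝ) ^ ((n : ℝ) * R₁)⌉₊)
      (φ : Fin ⌈(2 : ℝ) ^ ((n : ℝ) * R₁)⌉₊ → (Fin n → X₂) → Fin n → X₁),
      (mean (fun x : Fin n → X₂ => 1 / (⌈(2 : ℝ) ^ ((n : ℝ) * RV)⌉₊ : ℝ) *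
          ∑ j, ∏ i, stLaw (∑ u, b (vs j i) u • π (vs j i) u) (x i)) fun x =>
        1 / (⌈(2 : ℝ) ^ ((n : ℝ) * R₁)⌉₊ : ℝ) *
          (∑ w, mean (fun y : Fin n → Y₁ => ∏ i, W (φ w x i) (x i) (y i)) fun y => ind (g y ≠ w)) +
        ind ((2 : ℝ) ^ (-((n : ℝ) * R)) < 1 / (⌈(2 : ℝ) ^ ((n : ℝ) * RV)⌉₊ : ℝ) *
          ∑ j, ∏ i, stLaw (∑ u, b (vs j i) u • π (vs j i) u) (x i))) ≤ η := by
  set s : 𝒱 → 𝒰 → X₂ → ℝ := fun v u => stLaw (π v u) with hs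
  set o : 𝒱 → 𝒰 → Y₁ → ℝ := fun v u => outLaw W (π v u) with ho
  set sv : 𝒱 → X₂ → ℝ := fun v x => mean (b v) fun u => s v u x with hsv
  set ov : 𝒱 → Y₁ → ℝ := fun v y => mean (b v) fun u => o v u y with hov
  set s₀ : X₂ → ℝ := fun x => mean a fun v => sv v x with hs₀
  set o₀ : Y₁ → ℝ := fun y => mean a fun v => ov v y with ho₀
  have ms : ∀ v u, s v u ∈ stdSimplex ℝ X₂ := fun v u => stLaw_mem (hπ v u)
  have mo : ∀ v u, o v u ∈ stdSimplex ℝ Y₁ := fun v u => outLaw_mem hW (hπ v u)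
  have msv : ∀ v, sv v ∈ stdSimplex ℝ X₂ := fun v => mean_mem (hb v) (ms v)
  have mov : ∀ v, ov v ∈ stdSimplex ℝ Y₁ := fun v => mean_mem (hb v) (mo v)
  have esv : ∀ v, stLaw (∑ u, b v u • π v u) = sv v := fun v => funext fun x => stLaw_sum _ _ _
  have eov : ∀ v, outLaw W (∑ u, b v u • π v u) = ov v := fun v => funext fun x => outLaw_sum _ _ _ _
  have es₀ : stLaw (ensPoint W a b π).1 = s₀ := by
    ext x; rw [ensPoint_fst, stLaw_sum]; simp only [esv]; rfl
  have eo₀ : outLaw W (ensPoint W a b π).1 = o₀ := by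
    ext x; rw [ensPoint_fst, outLaw_sum]; simp only [eov]; rfl
  set HYV := mean a fun v => ent (ov v) with hHYV
  set HXV := mean a fun v => ent (sv v) with hHXV
  set HYU := mean a fun v => mean (b v) fun u => ent (o v u) with hHYU
  set HXU := mean a fun v => mean (b v) fun u => ent (s v u) with hHXU
  have eobj : (ensPoint W a b π).2.2.2 = HYV - HXV - (HYU - HXU) := by
    rw [ensPoint_obj]
    simp only [esv, eov, hHYV, hHXV, hHYU, hHXU, ← mean_sub]
    rfl
  have eout : (ensPoint W a b π).2.1 = HYV := by
    rw [ensPoint_out]; simp only [eov]; rfl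
  have est : (ensPoint W a b π).2.2.1 = HXV := by
    rw [ensPoint_st]; simp only [esv]; rfl
  rw [eobj] at h1
  rw [eo₀, eout] at hV
  rw [est] at hR
  rw [es₀] at hR'
  simp only [esv]
  have hIX : 0 ≤ HXV - HXU := sub_nonneg.2 (mean_mono ha.1 fun v => mean_ent_le (hb v) (ms v))
  -- positivity of the averaged laws on the support
  have psv : ∀ v u x, b v u ≠ 0 → s v u x ≠ 0 → 0 < sv v x := fun v u x h1 h2 =>
    mean_pos_of_ne (hb v).1 (fun u => (ms v u).1 x) h1 h2
  have pov : ∀ v u y, b v u ≠ 0 → o v u y ≠ 0 → 0 < ov v y := fun v u x h1 h2 =>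
    mean_pos_of_ne (hb v).1 (fun u => (mo v u).1 x) h1 h2
  have ps₀ : ∀ v x, a v ≠ 0 → sv v x ≠ 0 → 0 < s₀ x := fun v x h1 h2 =>
    mean_pos_of_ne ha.1 (fun v => (msv v).1 x) h1 h2
  have po₀ : ∀ v x, a v ≠ 0 → ov v x ≠ 0 → 0 < o₀ x := fun v x h1 h2 =>
    mean_pos_of_ne ha.1 (fun v => (mov v).1 x) h1 h2
  have lo : (mean a fun v => mean (b v) fun u => mean (o v u) fun y => Real.logb 2 (o v u y)) =
      -HYU := by
    simp only [mean_logb_self, hHYU]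
    simp [mean]
  have ls : (mean a fun v => mean (b v) fun u => mean (s v u) fun y => Real.logb 2 (s v u y)) =
      -HXU := by
    simp only [mean_logb_self, hHXU]
    simp [mean]
  have lov' : (mean a fun v => mean (ov v) fun y => Real.logb 2 (ov v y)) = -HYV := by
    simp only [mean_logb_self, hHYV]
    simp [mean]
  have lsv' : (mean a fun v => mean (sv v) fun y => Real.logb 2 (sv v y)) = -HXV := by
    simp only [mean_logb_self, hHXV]
    simp [mean]
  have lov : (mean a fun v => mean (b v) fun u => mean (o v u) fun y => Real.logb 2 (ov v y)) =
      -HYV := by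
    rw [← lov']; simp only [mean_mean (b _)]; rfl
  have lsv : (mean a fun v => mean (b v) fun u => mean (s v u) fun y => Real.logb 2 (sv v y)) =
      -HXV := by
    rw [← lsv']; simp only [mean_mean (b _)]; rfl
  have lo₀ : (mean a fun v => mean (b v) fun u => mean (o v u) fun y => Real.logb 2 (o₀ y)) =
      -ent o₀ := by
    rw [← mean_logb_self]; simp only [mean_mean (b _)]; rw [mean_mean a]
  have ls₀ : (mean a fun v => mean (sv v) fun y => Real.logb 2 (s₀ y)) = -ent s₀ := by
    rw [← mean_logb_self, mean_mean a]
  -- the slack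
  obtain ⟨δ, hδ, d1, d2, d3⟩ : ∃ δ : ℝ, 0 < δ ∧ 4 * δ < HYV - HXV - (HYU - HXU) - R₁ ∧
      2 * δ < HXV + RV - R ∧ 2 * δ < ent s₀ - R := by
    refine ⟨min (HYV - HXV - (HYU - HXU) - R₁) (min (HXV + RV - R) (ent s₀ - R)) / 5, ?_, ?_⟩
    · have : 0 < min (HYV - HXV - (HYU - HXU) - R₁) (min (HXV + RV - R) (ent s₀ - R)) :=
        lt_min (by linarith) (lt_min (by linarith) (by linarith))
      linarith
    · have hp : 0 < min (HYV - HXV - (HYU - HXU) - R₁) (min (HXV + RV - R) (ent s₀ - R)) :=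
        lt_min (by linarith) (lt_min (by linarith) (by linarith))
      have i1 := min_le_left (HYV - HXV - (HYU - HXU) - R₁) (min (HXV + RV - R) (ent s₀ - R))
      have i2 := (min_le_right (HYV - HXV - (HYU - HXU) - R₁)
        (min (HXV + RV - R) (ent s₀ - R))).trans (min_le_left _ _)
      have i3 := (min_le_right (HYV - HXV - (HYU - HXU) - R₁)
        (min (HXV + RV - R) (ent s₀ - R))).trans (min_le_right _ _)
      exact ⟨by linarith, by linarith, by linarith⟩
  -- The rate of the index l: slightly above I(U;X₂|V), as soft covering needs. One δ goes into T
  -- and the other into ε².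
  set RL := HXV - HXU + 2 * δ with hRL
  have T1 := tendsto_tail_triple ha hb mo (f := fun v _ y => ov v y) (g := o)
    (fun v u y _ h2 h3 => pov v u y h2 h3)
    (fun v u y _ _ h3 => lt_of_le_of_ne ((mo v u).1 y) h3.symm) (θ := -(HYV - HYU - δ))
    (by simp only [mean_sub, lov, lo]; linarith)
  have T2 := tendsto_tail_triple ha hb mo (f := fun v _ y => o₀ y) (g := o)
    (fun v u y h1 h2 h3 => po₀ v y h1 (pov v u y h2 h3).ne')
    (fun v u y _ _ h3 => lt_of_le_of_ne ((mo v u).1 y) h3.symm) (θ := -(ent o₀ - HYU - δ))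
    (by simp only [mean_sub, lo₀, lo]; linarith)
  have T3 := tendsto_tail_triple ha hb ms (f := s) (g := fun v _ x => sv v x)
    (fun v u y _ _ h3 => lt_of_le_of_ne ((ms v u).1 y) h3.symm)
    (fun v u y _ h2 h3 => psv v u y h2 h3) (θ := HXV - HXU + δ)
    (by simp only [mean_sub, lsv, ls]; linarith)
  have T4 := tendsto_tail_pair ha msv (f := sv)
    (fun v y _ h3 => lt_of_le_of_ne ((msv v).1 y) h3.symm) (θ := RV - R - δ)
    (by rw [lsv']; linarith)
  have T5 := tendsto_tail_pair ha msv (f := fun _ x => s₀ x) (fun v y h1 h3 => ps₀ v y h1 h3)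
    (θ := -(R + δ)) (by rw [ls₀]; linarith)
  have Tδ := tendsto_two_rpow_neg hδ
  have Tδ' := tendsto_two_rpow_neg (half_pos hδ)
  -- The constant 10 is 4 + 4 from the two packing terms plus 2 from the atoms; the last term is the
  -- covering error ε.
  have hsum := ((((((T1.add T2).add T3).add T4).add T5).add (Tδ.const_mul 10)).add Tδ')
  simp only [add_zero, mul_zero] at hsum
  filter_upwards [hsum.eventually_le_const hη,
    (tendsto_natCast_atTop_atTop (R := ℝ)).eventually_ge_atTop (1 / δ)] with n hn hnδ
  have hnδ1 : 1 ≤ n * δ := by rwa [div_le_iff₀ hδ] at hnδ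
  obtain ⟨pJ, J1, J2, -⟩ := ceil_rpow_bounds (n := n) (R := RV)
  obtain ⟨pM, -, -, M3⟩ := ceil_rpow_bounds (n := n) (R := R₁)
  obtain ⟨pL, L1, -, L3⟩ := ceil_rpow_bounds (n := n) (R := RL)
  replace M3 := M3 hR₁
  replace L3 := L3 (by linarith)
  set J := ⌈(2 : ℝ) ^ ((n : ℝ) * RV)⌉₊
  set M := ⌈(2 : ℝ) ^ ((n : ℝ) * R₁)⌉₊
  set L := ⌈(2 : ℝ) ^ ((n : ℝ) * RL)⌉₊
  have hn0 : (0 : ℝ) ≤ n := n.cast_nonneg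
  have hadd : ∀ x y : ℝ, (2 : ℝ) ^ x * 2 ^ y = 2 ^ (x + y) := fun x y =>
    (Real.rpow_add two_pos x y).symm
  have hmono : ∀ {x y : ℝ}, x ≤ y → (2 : ℝ) ^ x ≤ 2 ^ y := fun h =>
    Real.rpow_le_rpow_of_exponent_le one_le_two h
  -- The thresholds sit δ away from the typical exponents: I(U;Y₁|V) for t₁, I(U,V;Y₁) for t₂,
  -- I(U;X₂|V) for T. The atom threshold is θ = 2^{−nR}, and θ' is smaller by 2^{−nδ}.
  obtain ⟨vs, g, φ, h⟩ := one_shot_block hW ha hb hπ hs ho hsv hov hs₀ ho₀ n pJ pM pL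
    (t₁ := (2 : ℝ) ^ ((n : ℝ) * -(HYV - HYU - δ))) (t₂ := (2 : ℝ) ^ ((n : ℝ) * -(ent o₀ - HYU - δ)))
    (T := (2 : ℝ) ^ ((n : ℝ) * (HXV - HXU + δ))) (θ := (2 : ℝ) ^ (-((n : ℝ) * R)))
    (θ' := (2 : ℝ) ^ ((n : ℝ) * -(R + δ))) (ε := (2 : ℝ) ^ (-((n : ℝ) * (δ / 2))))
    (by positivity) (by positivity) (by positivity) (by positivity) (by positivity) (by positivity)
    (by
      refine le_trans (le_of_eq ?_) (mul_le_mul_of_nonneg_left L1 (by positivity))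
      rw [sq, hadd, hadd, hRL]
      congr 1; ring)
  refine ⟨vs, g, φ, h.trans (le_trans ?_ hn)⟩
  have hML : (M * L : ℝ) ≤ 4 * 2 ^ (n * R₁ + n * RL) := by
    calc (M * L : ℝ) ≤ (2 * 2 ^ (n * R₁)) * (2 * 2 ^ (n * RL)) :=
          mul_le_mul M3 L3 (Nat.cast_nonneg _) (by positivity)
      _ = _ := by rw [← hadd]; ring
  have b1 : (M * L : ℝ) * (2 : ℝ) ^ ((n : ℝ) * -(HYV - HYU - δ)) ≤ 4 * 2 ^ (-((n : ℝ) * δ)) := by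
    refine (mul_le_mul_of_nonneg_right hML (by positivity)).trans ?_
    rw [mul_assoc, hadd]
    refine mul_le_mul_of_nonneg_left (hmono ?_) (by norm_num)
    have := mul_le_mul_of_nonneg_left d1.le hn0
    simp only [hRL]
    linarith
  have b2 : ((J : ℝ) - 1) * (M * L * (2 : ℝ) ^ ((n : ℝ) * -(ent o₀ - HYU - δ))) ≤
      4 * 2 ^ (-((n : ℝ) * δ)) := by
    refine (mul_le_mul_of_nonneg_right J2 (by positivity)).trans ?_
    refine (mul_le_mul_of_nonneg_left (mul_le_mul_of_nonneg_right hML (by positivity))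
      (by positivity)).trans ?_
    rw [mul_assoc 4, hadd, mul_left_comm, hadd]
    refine mul_le_mul_of_nonneg_left (hmono ?_) (by norm_num)
    have := mul_le_mul_of_nonneg_left d1.le hn0
    have := mul_le_mul_of_nonneg_left hV.le hn0
    simp only [hRL]
    linarith
  have b3 : 2 * (2 : ℝ) ^ ((n : ℝ) * -(R + δ)) / 2 ^ (-((n : ℝ) * R)) =
      2 * 2 ^ (-((n : ℝ) * δ)) := by
    rw [mul_div_assoc, ← Real.rpow_sub two_pos]
    congr 2; ring
  -- The factor 1/2 from the atom estimate is absorbed by nδ ≥ 1.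
  have b4 : (2 : ℝ) ^ ((n : ℝ) * (RV - R - δ)) ≤ J * 2 ^ (-((n : ℝ) * R)) / 2 := by
    calc (2 : ℝ) ^ ((n : ℝ) * (RV - R - δ)) ≤ 2 ^ (n * RV + -(n * R) - 1) :=
          hmono (by linarith)
      _ = 2 ^ (n * RV) * 2 ^ (-(n * R)) / 2 := by
          rw [Real.rpow_sub two_pos, Real.rpow_one, hadd]
      _ ≤ _ := div_le_div_of_nonneg_right
          (mul_le_mul_of_nonneg_right J1 (by positivity)) two_pos.le
  have b5 : (mean (iidWeight a) fun v : Fin n → 𝒱 => mean (fun x : Fin n → X₂ => ∏ i, sv (v i) (x i)) fun x =>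
        ind (J * 2 ^ (-((n : ℝ) * R)) / 2 < ∏ i, sv (v i) (x i))) ≤
      mean (iidWeight a) fun v : Fin n → 𝒱 => mean (fun x : Fin n → X₂ => ∏ i, sv (v i) (x i)) fun x =>
        ind ((2 : ℝ) ^ ((n : ℝ) * (RV - R - δ)) < ∏ i, sv (v i) (x i)) :=
    mean_mono (iidWeight_mem ha).1 fun v =>
      mean_mono (prod_mem_stdSimplex fun i => msv (v i)).1 fun x => ind_mono fun h => b4.trans_lt h
  rw [b3]
  linarith

end Coding

/-! ### From random coding to achievable rates -/

section Achievability

variable {X₁ X₂ Y₁ : Type*} [Fintype X₁] [Fintype X₂] [Fintype Y₁] {W : X₁ → X₂ → Y₁ → ℝ}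

theorem two_rpow_mul_logb_card [Nonempty X₂] (n : ℕ) :
    (2 : ℝ) ^ ((n : ℝ) * Real.logb 2 (Fintype.card X₂)) = ((Fintype.card (Fin n → X₂) : ℕ) : ℝ) := by
  have hc : (0 : ℝ) < Fintype.card X₂ := by exact_mod_cast Fintype.card_pos
  rw [mul_comm, Real.rpow_mul two_pos.le, Real.rpow_logb two_pos (by norm_num) hc,
    Real.rpow_natCast]
  simp

theorem exists_code [Nonempty X₁] [Nonempty X₂] {R₂ : ℝ}
    (hR₂ : R₂ ≤ Real.logb 2 (Fintype.card X₂)) (n : ℕ) (R₁ : ℝ) :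
    Nonempty (Code X₁ X₂ Y₁ n ⌈(2 : ℝ) ^ ((n : ℝ) * R₁)⌉₊ ⌈(2 : ℝ) ^ ((n : ℝ) * R₂)⌉₊) := by
  have hcard : ⌈(2 : ℝ) ^ ((n : ℝ) * R₂)⌉₊ ≤ (Finset.univ : Finset (Fin n → X₂)).card := by
    rw [Finset.card_univ, Nat.ceil_le, ← two_rpow_mul_logb_card]
    exact Real.rpow_le_rpow_of_exponent_le one_le_two
      (mul_le_mul_of_nonneg_left hR₂ n.cast_nonneg)
  obtain ⟨S, -, hS⟩ := Finset.exists_subset_card_eq hcard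
  exact ⟨⟨S, hS, fun _ _ _ => Classical.arbitrary X₁, fun _ => ⟨0, ceil_rpow_bounds.1⟩⟩⟩

theorem Code.errorProb_nonneg (hW : ∀ x₁ x₂, W x₁ x₂ ∈ stdSimplex ℝ Y₁) {n M N : ℕ}
    (c : Code X₁ X₂ Y₁ n M N) : 0 ≤ c.errorProb W :=
  mul_nonneg (by positivity) (Finset.sum_nonneg fun _ _ => Finset.sum_nonneg fun _ _ =>
    Finset.sum_nonneg fun _ _ => Finset.prod_nonneg fun _ _ => (hW _ _).1 _)

/-- Achievability asks for one sequence of codes serving all ε. Taking at each n a code within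
1/(n+1) of the least error serves all of them, and `exists_code` covers the small n. -/
theorem achievable_of_eventually [Nonempty X₁] [Nonempty X₂]
    (hW : ∀ x₁ x₂, W x₁ x₂ ∈ stdSimplex ℝ Y₁) {R₂ R₁ : ℝ}
    (hR₂ : R₂ ≤ Real.logb 2 (Fintype.card X₂)) (hR₁ : 0 ≤ R₁)
    (h : ∀ ε : ℝ, 0 < ε → ε ≤ 1 → ∀ᶠ n : ℕ in atTop, ∃ c : Code X₁ X₂ Y₁ n
      ⌈(2 : ℝ) ^ ((n : ℝ) * R₁)⌉₊ ⌈(2 : ℝ) ^ ((n : ℝ) * R₂)⌉₊, c.errorProb W ≤ ε) :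
    Achievable W R₂ R₁ := by
  refine ⟨hR₁, ?_⟩
  have hbest : ∀ n : ℕ, ∃ c : Code X₁ X₂ Y₁ n ⌈(2 : ℝ) ^ ((n : ℝ) * R₁)⌉₊
      ⌈(2 : ℝ) ^ ((n : ℝ) * R₂)⌉₊, ∀ c' : Code X₁ X₂ Y₁ n ⌈(2 : ℝ) ^ ((n : ℝ) * R₁)⌉₊
      ⌈(2 : ℝ) ^ ((n : ℝ) * R₂)⌉₊, c.errorProb W ≤ c'.errorProb W + 1 / ((n : ℝ) + 1) := fun n => by
    have := exists_code (X₁ := X₁) (Y₁ := Y₁) hR₂ n R₁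
    have hbdd : BddBelow (Set.range fun c : Code X₁ X₂ Y₁ n ⌈(2 : ℝ) ^ ((n : ℝ) * R₁)⌉₊
      ⌈(2 : ℝ) ^ ((n : ℝ) * R₂)⌉₊ => c.errorProb W) :=
      ⟨0, by rintro _ ⟨c, rfl⟩; exact c.errorProb_nonneg hW⟩
    obtain ⟨_, ⟨c, rfl⟩, hc⟩ := exists_lt_of_csInf_lt (Set.range_nonempty _)
      (lt_add_of_pos_right (sInf (Set.range fun c : Code X₁ X₂ Y₁ n ⌈(2 : ℝ) ^ ((n : ℝ) * R₁)⌉₊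
      ⌈(2 : ℝ) ^ ((n : ℝ) * R₂)⌉₊ => c.errorProb W)) (Nat.one_div_pos_of_nat (n := n) (α := ℝ)))
    refine ⟨c, fun c' => hc.le.trans ?_⟩
    have := csInf_le hbdd ⟨c', rfl⟩
    linarith
  choose c hc using hbest
  refine ⟨c, ?_⟩
  rw [Metric.tendsto_atTop']
  intro ε hε
  have hlim := tendsto_one_div_add_atTop_nhds_zero_nat (𝕜 := ℝ)
  have hmin : 0 < min (ε / 2) 1 := lt_min (half_pos hε) one_pos
  obtain ⟨n₀, hn₀⟩ := eventually_atTop.1 ((h _ hmin (min_le_right _ _)).and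
    (hlim.eventually_lt_const (half_pos hε)))
  refine ⟨n₀, fun n hn => ?_⟩
  obtain ⟨⟨c', hc'⟩, h2⟩ := hn₀ n hn.le
  rw [Real.dist_eq, sub_zero, abs_of_nonneg ((c n).errorProb_nonneg hW)]
  have h3 := hc n c'
  have h4 := min_le_left (ε / 2) 1
  linarith

/-- The error probability of the code with state set `S`, encoder `φ` and decoder `g`. -/
theorem errorProb_mk {n M N : ℕ} (S : Finset (Fin n → X₂)) (hS : S.card = N)
    (g : (Fin n → Y₁) → Fin M) (φ : Fin M → (Fin n → X₂) → Fin n → X₁) :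
    (Code.mk S hS (fun w s => φ w s.1) g).errorProb W = 1 / (N : ℝ) * ∑ x ∈ S,
      1 / (M : ℝ) * ∑ w, mean (fun y : Fin n → Y₁ => ∏ i, W (φ w x i) (x i) (y i))
        fun y => ind (g y ≠ w) := by
  have h : ∀ (w : Fin M) (x : Fin n → X₂), (∑ y with g y ≠ w, ∏ i, W (φ w x i) (x i) (y i)) =
      mean (fun y : Fin n → Y₁ => ∏ i, W (φ w x i) (x i) (y i)) fun y => ind (g y ≠ w) :=
    fun w x => by
      rw [mean, Finset.sum_filter]
      refine Finset.sum_congr rfl fun y _ => ?_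
      by_cases hg : g y ≠ w
      · rw [ind_of hg, if_pos hg, mul_one]
      · rw [ind_of_not hg, if_neg hg, mul_zero]
  simp only [Code.errorProb, h]
  rw [Finset.sum_comm, Finset.sum_coe_sort S fun x => ∑ w, mean (fun y : Fin n → Y₁ =>
    ∏ i, W (φ w x i) (x i) (y i)) fun y => ind (g y ≠ w), ← Finset.mul_sum, ← mul_assoc]
  congr 1
  rw [one_div_mul_one_div, mul_comm]

/-- A law without large atoms has many points at which a function of small mean is small. -/
theorem exists_finset_of_mean_le {X : Type*} [Fintype X] {p e : X → ℝ} (hp : p ∈ stdSimplex ℝ X)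
    (he : ∀ x, 0 ≤ e x) {θ ε : ℝ} (hθ : 0 < θ) (hε : 0 < ε) (hε1 : ε ≤ 1)
    (h : mean p (fun x => e x + ind (θ < p x)) ≤ ε / 2) {N : ℕ} (hN : N * θ ≤ 1 / 2) :
    ∃ S : Finset X, S.card = N ∧ ∀ x ∈ S, e x ≤ ε := by
  classical
  set G : Finset X := Finset.univ.filter fun x => p x ≤ θ ∧ e x ≤ ε
  have hpt : ∀ x, 1 - ind (x ∈ G) ≤ 1 / ε * (e x + ind (θ < p x)) := fun x => by
    have i1 := ind_nonneg (θ < p x)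
    have i2 := he x
    by_cases hx : x ∈ G
    · rw [ind_of hx, sub_self]; positivity
    · rw [ind_of_not hx, sub_zero, one_div, inv_mul_eq_div, le_div_iff₀ hε, one_mul]
      by_cases h1 : θ < p x
      · rw [ind_of h1]; linarith
      · have h2 : ¬ e x ≤ ε := fun h2 => hx (by simp [G, not_lt.1 h1, h2])
        linarith
  -- Outside G the error exceeds ε or the atom exceeds θ, so by Markov G has mass at least 1/2. As
  -- its atoms are at most θ, it has at least 1/(2θ) ≥ N points.
  have h1 : 1 - mean p (fun x => ind (x ∈ G)) ≤ 1 / 2 := by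
    rw [← mean_const hp.2 1, ← mean_sub]
    refine (mean_mono hp.1 hpt).trans ?_
    rw [mean_const_mul, mean_const hp.2]
    refine (mul_le_mul_of_nonneg_left h (by positivity)).trans (le_of_eq ?_)
    field_simp
  have h2 : mean p (fun x => ind (x ∈ G)) ≤ G.card * θ := by
    calc mean p (fun x => ind (x ∈ G)) = ∑ x ∈ G, p x := by
          simp only [mean, ind, mul_ite, mul_one, mul_zero]
          rw [← Finset.sum_filter]
          congr 1
          ext x; simp
      _ ≤ ∑ x ∈ G, θ := Finset.sum_le_sum fun x hx => ((Finset.mem_filter.1 hx).2).1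
      _ = G.card * θ := by simp
  have h3 : N ≤ G.card := by
    have : (N : ℝ) * θ ≤ G.card * θ := by linarith
    exact_mod_cast le_of_mul_le_mul_right this hθ
  obtain ⟨S, hSG, hS⟩ := Finset.exists_subset_card_eq h3
  exact ⟨S, hS, fun x hx => ((Finset.mem_filter.1 (hSG hx)).2).2⟩

/-- A rate below the objective of a point with slack in the state rate is achievable. -/
theorem achievable_of_slack [Nonempty X₁] [Nonempty X₂]
    (hW : ∀ x₁ x₂, W x₁ x₂ ∈ stdSimplex ℝ Y₁) {R₂ R₁ R : ℝ} (hR₂ : 0 ≤ R₂)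
    (hR₂' : R₂ ≤ Real.logb 2 (Fintype.card X₂)) (hR₁ : 0 ≤ R₁) (hR : R₂ < R)
    {z : (X₂ × X₁ → ℝ) × ℝ × ℝ × ℝ} (hz : z ∈ outerHull W) (hf : Feasible W R z)
    (ho : R₁ < z.2.2.2) : Achievable W R₂ R₁ := by
  obtain ⟨k, m, a, b, π, ha, hb, hπ, rfl⟩ := exists_ensPoint hz
  refine achievable_of_eventually hW hR₂' hR₁ fun ε hε hε1 => ?_
  set z := ensPoint W a b fun _ => π
  -- The cloud rate lies below I(V;Y₁), yet with H(X₂|V) it exceeds R₂; it may be negative.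
  obtain ⟨RV, hV1, hV2⟩ : ∃ RV, R₂ - z.2.2.1 < RV ∧ RV < ent (outLaw W z.1) - z.2.1 :=
    exists_between (by linarith [hf.1])
  obtain ⟨R', h1, h2⟩ : ∃ R', R₂ < R' ∧ R' < min (z.2.2.1 + RV) (ent (stLaw z.1)) :=
    exists_between (lt_min (by linarith) (by linarith [hf.2]))
  have hδ : 0 < R' - R₂ := sub_pos.2 h1
  filter_upwards [random_coding hW ha hb (fun _ => hπ) hR₁ ho hV2 (h2.trans_le (min_le_left _ _))
    (h2.trans_le (min_le_right _ _)) (half_pos hε),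
    (tendsto_two_rpow_neg hδ).eventually_le_const (show (0 : ℝ) < 1 / 4 by norm_num)]
    with n ⟨vs, g, φ, h⟩ hn
  obtain ⟨pJ, -⟩ := ceil_rpow_bounds (n := n) (R := RV)
  obtain ⟨-, -, -, hN⟩ := ceil_rpow_bounds (n := n) (R := R₂)
  replace hN := hN hR₂
  have hJ' : (0 : ℝ) < ⌈(2 : ℝ) ^ ((n : ℝ) * RV)⌉₊ := by exact_mod_cast pJ
  have hp : (fun x : Fin n → X₂ => 1 / (⌈(2 : ℝ) ^ ((n : ℝ) * RV)⌉₊ : ℝ) *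
      ∑ j, ∏ i, stLaw (∑ u, b (vs j i) u • π u) (x i)) ∈ stdSimplex ℝ (Fin n → X₂) := by
    have hblock : ∀ j : Fin ⌈(2 : ℝ) ^ ((n : ℝ) * RV)⌉₊, (fun x : Fin n → X₂ =>
        ∏ i, stLaw (∑ u, b (vs j i) u • π u) (x i)) ∈ stdSimplex ℝ (Fin n → X₂) := fun j =>
      prod_mem_stdSimplex fun i => stLaw_mem (sum_smul_mem_stdSimplex (hb _) hπ)
    have := mean_mem (b := fun _ : Fin ⌈(2 : ℝ) ^ ((n : ℝ) * RV)⌉₊ => 1 / (⌈(2 : ℝ) ^ ((n : ℝ) * RV)⌉₊ : ℝ))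
      ⟨fun _ => by positivity, by simp [hJ'.ne']⟩ hblock
    simpa only [mean, ← Finset.mul_sum] using this
  obtain ⟨S, hS, hSe⟩ := exists_finset_of_mean_le
    (e := fun x => 1 / (⌈(2 : ℝ) ^ ((n : ℝ) * R₁)⌉₊ : ℝ) *
      (∑ w, mean (fun y : Fin n → Y₁ => ∏ i, W (φ w x i) (x i) (y i)) fun y => ind (g y ≠ w)))
    hp (fun x => mul_nonneg (by positivity) (Finset.sum_nonneg fun w _ =>
      mean_nonneg (prod_mem_stdSimplex fun i => hW _ _).1 fun _ => ind_nonneg _))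
    (θ := (2 : ℝ) ^ (-((n : ℝ) * R'))) (by positivity) hε hε1 h
    (N := ⌈(2 : ℝ) ^ ((n : ℝ) * R₂)⌉₊) (by
      refine (mul_le_mul_of_nonneg_right hN (by positivity)).trans ?_
      rw [mul_assoc, ← Real.rpow_add two_pos, show (n : ℝ) * R₂ + -(n * R') = -(n * (R' - R₂)) by
        ring]
      linarith)
  refine ⟨⟨S, hS, fun w s => φ w s.1, g⟩, ?_⟩
  rw [errorProb_mk]
  have hNpos : (0 : ℝ) < ⌈(2 : ℝ) ^ ((n : ℝ) * R₂)⌉₊ := by exact_mod_cast ceil_rpow_bounds.1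
  rw [one_div, inv_mul_eq_div, div_le_iff₀ hNpos]
  calc _ ≤ ∑ x ∈ S, ε := Finset.sum_le_sum hSe
    _ = _ := by rw [Finset.sum_const, hS, nsmul_eq_mul, mul_comm]

/-- For a state uniform on all sequences every rate below a value of the classical formula is
achievable. -/
theorem achievable_of_uniform [Nonempty X₁] [Nonempty X₂]
    (hW : ∀ x₁ x₂, W x₁ x₂ ∈ stdSimplex ℝ Y₁) {R₁ : ℝ} (hR₁ : 0 ≤ R₁)
    {c : (X₂ × X₁ → ℝ) × ℝ} (hc : c ∈ innerHull W)
    (hst : stLaw c.1 = fun _ => 1 / (Fintype.card X₂ : ℝ))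
    (ho : R₁ < (liftPoint W c).2.2.2) :
    Achievable W (Real.logb 2 (Fintype.card X₂)) R₁ := by
  obtain ⟨m, b, π, hb, hπ, rfl⟩ := exists_innerPoint hc
  refine achievable_of_eventually hW le_rfl hR₁ fun ε hε hε1 => ?_
  have ha : (fun _ : Unit => (1 : ℝ)) ∈ stdSimplex ℝ Unit := ⟨fun _ => zero_le_one, by simp⟩
  have hpt : ensPoint W (fun _ : Unit => (1 : ℝ)) (fun _ => b) (fun _ => π) =
      liftPoint W (innerPoint W b π) := by simp [ensPoint]
  have hst0 := ent_nonneg (stLaw_mem (innerHull_fst_mem hc))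
  -- V is constant, so every cloud has the uniform state law and the mixture is exactly uniform. The
  -- rates −1 and −2 merely satisfy the hypotheses; the atom term is dropped.
  filter_upwards [random_coding hW ha (fun _ => hb) (fun _ => hπ) (R := -2) (RV := -1) hR₁
    (by rw [hpt]; exact ho) (by rw [hpt]; simp [liftPoint])
    (by rw [hpt]; simp only [liftPoint]; linarith)
    (by rw [hpt]; simp only [liftPoint]; linarith) hε] with n ⟨vs, g, φ, h⟩
  have hN : (Finset.univ : Finset (Fin n → X₂)).card =
      ⌈(2 : ℝ) ^ ((n : ℝ) * Real.logb 2 (Fintype.card X₂))⌉₊ := by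
    rw [two_rpow_mul_logb_card, Nat.ceil_natCast, Finset.card_univ]
  refine ⟨⟨Finset.univ, hN, fun w s => φ w s.1, g⟩, ?_⟩
  rw [errorProb_mk, ← hN, Finset.card_univ]
  refine le_trans (le_of_eq ?_) ((mean_mono (f := fun x =>
    1 / (⌈(2 : ℝ) ^ ((n : ℝ) * R₁)⌉₊ : ℝ) * (∑ w, mean (fun y : Fin n → Y₁ =>
      ∏ i, W (φ w x i) (x i) (y i)) fun y => ind (g y ≠ w)))
    (fun x => mul_nonneg (by positivity) (Finset.sum_nonneg fun j _ => Finset.prod_nonneg fun i _ =>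
      (stLaw_mem (sum_smul_mem_stdSimplex hb hπ)).1 _))
    fun x => le_add_of_nonneg_right (ind_nonneg _)).trans h)
  rw [innerPoint_fst] at hst
  have hJ' : (⌈(2 : ℝ) ^ ((n : ℝ) * (-1))⌉₊ : ℝ) ≠ 0 := by
    exact_mod_cast (ceil_rpow_bounds (n := n) (R := -1)).1.ne'
  simp only [hst, mean, Finset.prod_const, Finset.card_univ, Fintype.card_fin, Finset.sum_const,
    nsmul_eq_mul, ← Finset.mul_sum]
  rw [← mul_assoc (1 / _) _ ((1 / (Fintype.card X₂ : ℝ)) ^ n), one_div_mul_cancel hJ', one_mul]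
  simp

/-- At rate 0 there is a single message, so no decoding error is possible. This makes the set of
achievable rates nonempty. -/
theorem achievable_zero [Nonempty X₁] [Nonempty X₂]
    (hW : ∀ x₁ x₂, W x₁ x₂ ∈ stdSimplex ℝ Y₁) {R₂ : ℝ}
    (hR₂ : R₂ ≤ Real.logb 2 (Fintype.card X₂)) : Achievable W R₂ 0 := by
  refine achievable_of_eventually hW hR₂ le_rfl fun ε hε _ => Eventually.of_forall fun n => ?_
  obtain ⟨c⟩ := exists_code (X₁ := X₁) (Y₁ := Y₁) hR₂ n 0
  refine ⟨c, le_trans (le_of_eq ?_) hε.le⟩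
  have hsub : Subsingleton (Fin ⌈(2 : ℝ) ^ ((n : ℝ) * 0)⌉₊) := by
    rw [mul_zero, Real.rpow_zero, Nat.ceil_one]; infer_instance
  have : ∀ w y, c.dec y = w := fun w y => Subsingleton.elim _ _
  exact mul_eq_zero_of_right _ (Finset.sum_eq_zero fun w _ => Finset.sum_eq_zero fun _ _ =>
    Finset.sum_eq_zero fun y hy => absurd (this w y) (Finset.mem_filter.1 hy).2)

/-- Every rate below the greatest feasible objective is achievable. -/
theorem achievable_of_lt_max [Nonempty X₁] [Nonempty X₂]
    (hW : ∀ x₁ x₂, W x₁ x₂ ∈ stdSimplex ℝ Y₁) {R₂ : ℝ} (h0 : 0 ≤ R₂)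
    (hR₂ : R₂ ≤ Real.logb 2 (Fintype.card X₂)) {z : (X₂ × X₁ → ℝ) × ℝ × ℝ × ℝ}
    (hz : z ∈ outerHull W) (hf : Feasible W R₂ z)
    (hmax : ∀ z' ∈ outerHull W, Feasible W R₂ z' → z'.2.2.2 ≤ z.2.2.2) {R₁ : ℝ} (hR₁ : 0 ≤ R₁)
    (hlt : R₁ < z.2.2.2) : Achievable W R₂ R₁ := by
  rcases hR₂.eq_or_lt with rfl | hR₂'
  · obtain ⟨c, hc, hst, ho⟩ := (isGreatest_gpValues hW hz hf hmax).2
    exact achievable_of_uniform hW hR₁ hc hst (ho ▸ hlt)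
  · obtain ⟨z', hz', hf'⟩ := exists_feasible_logb_card W
    set D := |z.2.2.2 - z'.2.2.2| + 1 with hD
    have hDpos : 0 < D := by positivity
    -- Weight t on `z'` gives state-rate slack t (log|X₂| − R₂), by concavity of the margins. The
    -- objective is linear and falls by at most t D, less than its gap to R₁.
    obtain ⟨t, ht0, ht1, htD⟩ : ∃ t : ℝ, 0 < t ∧ t ≤ 1 ∧ t * D < z.2.2.2 - R₁ := by
      refine ⟨min 1 ((z.2.2.2 - R₁) / (2 * D)), lt_min one_pos (div_pos (sub_pos.2 hlt)
        (by positivity)), min_le_left _ _, ?_⟩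
      calc _ ≤ (z.2.2.2 - R₁) / (2 * D) * D :=
            mul_le_mul_of_nonneg_right (min_le_right _ _) hDpos.le
        _ = (z.2.2.2 - R₁) / 2 := by field_simp
        _ < _ := half_lt_self (sub_pos.2 hlt)
    have hw : (![1 - t, t] : Fin 2 → ℝ) ∈ stdSimplex ℝ (Fin 2) :=
      ⟨fun i => by fin_cases i <;> simp [ht0.le, ht1], by simp⟩
    have hzz : ∀ i, (![z, z'] : Fin 2 → _) i ∈ outerHull W := fun i => by
      fin_cases i
      exacts [hz, hz']
    have h1t : 0 ≤ 1 - t := sub_nonneg.2 ht1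
    have hfeas : Feasible W ((1 - t) * R₂ + t * Real.logb 2 (Fintype.card X₂))
        (∑ i, (![1 - t, t] : Fin 2 → ℝ) i • (![z, z'] : Fin 2 → _) i) := by
      refine feasible_sum hw hzz hW ?_ ?_
      · rw [Fin.sum_univ_two]
        exact add_le_add (mul_le_mul_of_nonneg_left hf.1 h1t)
          (mul_le_mul_of_nonneg_left hf'.1 ht0.le)
      · rw [Fin.sum_univ_two]
        exact add_le_add (mul_le_mul_of_nonneg_left hf.2 h1t)
          (mul_le_mul_of_nonneg_left hf'.2 ht0.le)
    refine achievable_of_slack hW h0 hR₂ hR₁ ?_ ((convex_convexHull ℝ _).sum_mem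
      (fun i _ => hw.1 i) hw.2 fun i _ => hzz i) hfeas ?_
    · have := mul_lt_mul_of_pos_left hR₂' ht0
      linarith
    · rw [Fin.sum_univ_two]
      have h2 := mul_le_mul_of_nonneg_left ((le_abs_self (z.2.2.2 - z'.2.2.2)).trans
        (le_add_of_nonneg_right zero_le_one)) ht0.le
      change R₁ < (1 - t) * z.2.2.2 + t * z'.2.2.2
      linarith

end Achievability

end

end GenGP

/-! ### The capacity theorem -/

theorem mainTheorem4 {X₁ X₂ Y₁ : Type*} [Fintype X₁] [Fintype X₂] [Fintype Y₁]
    [Nonempty X₁] [Nonempty X₂]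
    (W : X₁ → X₂ → Y₁ → ℝ) (hW : ∀ x₁ x₂, W x₁ x₂ ∈ stdSimplex ℝ Y₁) :
    (∀ R₂ : ℝ, 0 ≤ R₂ → R₂ ≤ Real.logb 2 (Fintype.card X₂ : ℝ) →
      IsLUB {R₁ : ℝ | GenGP.Achievable W R₂ R₁} (GenGP.capacity W R₂) ∧
      IsGreatest (GenGP.capacityValues W R₂) (GenGP.capacity W R₂)) ∧
    IsGreatest (GenGP.gpValues W (fun _ => 1 / (Fintype.card X₂ : ℝ)))
      (GenGP.capacity W (Real.logb 2 (Fintype.card X₂ : ℝ))) := by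
  have key : ∀ R₂ : ℝ, 0 ≤ R₂ → R₂ ≤ Real.logb 2 (Fintype.card X₂ : ℝ) →
      ∃ z ∈ GenGP.outerHull W, GenGP.Feasible W R₂ z ∧
        (∀ z' ∈ GenGP.outerHull W, GenGP.Feasible W R₂ z' → z'.2.2.2 ≤ z.2.2.2) ∧
        IsLUB {R₁ : ℝ | GenGP.Achievable W R₂ R₁} z.2.2.2 ∧
        GenGP.capacity W R₂ = z.2.2.2 := fun R₂ h0 hR₂ => by
    obtain ⟨z₀, hz₀, hf₀⟩ := GenGP.exists_feasible_logb_card W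
    obtain ⟨z, hz, hf, hmax⟩ := GenGP.exists_max_feasible ⟨z₀, hz₀, hf₀.mono hR₂⟩
    have hzero := GenGP.achievable_zero hW hR₂
    have hlub : IsLUB {R₁ : ℝ | GenGP.Achievable W R₂ R₁} z.2.2.2 := by
      refine ⟨fun R₁ hR₁ => le_of_forall_pos_le_add fun ε hε => ?_, fun r hr => ?_⟩
      · obtain ⟨z', hz', hf', ho⟩ := GenGP.exists_point_of_achievable hW hR₁ hε
        linarith [hmax z' hz' hf']
      -- A smaller upper bound r is nonnegative because rate 0 is achievable, so the midpoint
      -- between r and the maximum is an achievable rate above r.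
      · by_contra! hlt
        have hr0 : 0 ≤ r := hr hzero
        have := hr (GenGP.achievable_of_lt_max hW h0 hR₂ hz hf hmax
          (R₁ := (r + z.2.2.2) / 2) (by linarith) (by linarith))
        linarith
    exact ⟨z, hz, hf, hmax, hlub, hlub.csSup_eq ⟨0, hzero⟩⟩
  refine ⟨fun R₂ h0 hR₂ => ?_, ?_⟩
  · obtain ⟨z, hz, hf, hmax, hlub, heq⟩ := key R₂ h0 hR₂
    rw [heq]
    refine ⟨hlub, (GenGP.mem_capacityValues_iff hW).2 ⟨z, hz, hf, rfl⟩, fun r hr => ?_⟩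
    obtain ⟨z', hz', hf', rfl⟩ := (GenGP.mem_capacityValues_iff hW).1 hr
    exact hmax z' hz' hf'
  · obtain ⟨z, hz, hf, hmax, hlub, heq⟩ := key _
      (Real.logb_nonneg one_lt_two (by exact_mod_cast Fintype.card_pos)) le_rfl
    rw [heq]
    exact (GenGP.isGreatest_gpValues hW hz hf hmax).1
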